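/- For $\nu\in\mathbb C$ let $J_\nu(z)=\sum_{n\ge 0}\frac{(-1)^n (z/2)^{\nu+2n}}{n!\,\Gamma(\nu+n+1)}$ be the Bessel function of the first kind, and write $e(x)=e^{2\pi i x}$. For $\mu\in\mathbb C$, $d\in\mathbb Z$ and $z\in\mathbb C\smallsetminus\{0\}$ set $$J_{\mu,d}(z)=J_{\mu+d}(z)\,J_{\mu-d}(\bar z),\qquad P_{\mu,d}(z)=\frac{(z/2)^{\mu+d}(\bar z/2)^{\mu-d}}{\Gamma(\mu+d+1)\,\Gamma(\mu-d+1)},$$ where $\log\bar z=\overline{\log z}$ (the result does not depend on the choice of $\log z$), and $$\boldsymbol J_{\mu,d}(z)=\frac{J_{-\mu,-d}(4\pi z)-J_{\mu,d}(4\pi z)}{\sin(\pi\mu)},\qquad \boldsymbol R_{\mu,d}(z)=\frac{P_{-\mu,-d}(4\pi z)-P_{\mu,d}(4\pi z)}{\sin(\pi\mu)},$$ the right-hand sides being replaced by their limits in the order if $\mu=0$. Let $\boldsymbol M_{\mu,d}=\boldsymbol J_{\mu,d}-\boldsymbol R_{\mu,d}$ be the regularized Bessel function, and let $$Y(z)=\frac{|z+\sqrt{z^2-4}|}{2},\qquad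 E(z)=\frac{z+\sqrt{z^2-4}}{|z+\sqrt{z^2-4}|}.$$ **Theorem.** Suppose that $|\mathrm{Re}\,\mu|<\tfrac12$ and $d\in\mathbb Z$. Then for all $y\in(0,\infty)$ and $\theta\in[0,2\pi)$, and for either choice of the square root $\sqrt{z^2-4}$ at $z=ye^{i\theta}$, $$\int_0^{2\pi}\!\!\int_0^\infty \boldsymbol M_{\mu,d}(xe^{i\phi})\,e(-2xy\cos(\phi+\theta))\,\frac{dx\,d\phi}{x} =\frac{1}{d^2-\mu^2}\left\{\left(Y(ye^{i\theta})^{2\mu}E(ye^{i\theta})^{2d}-y^{2\mu}e^{2id\theta}\right)+\left(\frac1{Y(ye^{i\theta})^{2\mu}E(ye^{i\theta})^{2d}}-\frac1{y^{2\mu}e^{2id\theta}}\right)\right\};$$ if $d=0$ and $\mu=0$, the right-hand side is replaced by its limit as $\mu\to0$. The integral is improper at infinity, and the identity holds in both of the following senses: as the limit for $T\to\infty$ of the absolutely convergent integrals over the discs $0<x\le T$, and as an iterated integral in which the inner integral over $x\in(0,\infty)$ converges (possibly conditionally at infinity) for almost every $\phi$ to an integrable function of $\phi$. -/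

import Mathlib

open Filter Topology MeasureTheory Set

namespace ComplexBessel

noncomputable section

/-- The additive character `e (x) = exp (2 π i x)`. -/
def e (x : ℝ) : ℂ := Complex.exp (2 * Real.pi * Complex.I * x)

/-- The Bessel function `J_ν (z) = ∑ (-1)^n (z/2)^(ν+2n) / (n! Γ(ν+n+1))` of the first kind, as a
function on the Riemann surface of the logarithm: `besselJ ν l` is `J_ν (z)` at the point `z = exp l`
with `log z = l`. The reciprocal `1/Γ` is the entire function vanishing at `0, -1, -2, …`, in
agreement with the convention for `Complex.Gamma`. -/
def besselJ (ν l : ℂ) : ℂ :=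
  ∑' n : ℕ, (-1) ^ n / (n.factorial : ℂ) * (Complex.Gamma (ν + n + 1))⁻¹ *
    Complex.exp ((ν + 2 * n) * (l - Real.log 2))

/-- `J_{μ+d} (z) J_{μ-d} (z̄)` at `z = exp l`, where `log z̄` is the conjugate of `log z = l`. -/
def prodJ (μ : ℂ) (d : ℤ) (l : ℂ) : ℂ :=
  besselJ (μ + d) l * besselJ (μ - d) ((starRingEnd ℂ) l)

/-- `(z/2)^{μ+d} (z̄/2)^{μ-d} / (Γ(μ+d+1) Γ(μ-d+1))` at `z = exp l`. -/
def prodP (μ : ℂ) (d : ℤ) (l : ℂ) : ℂ :=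
  Complex.exp ((μ + d) * (l - Real.log 2)) *
    Complex.exp ((μ - d) * ((starRingEnd ℂ) l - Real.log 2)) *
    ((Complex.Gamma (μ + d + 1))⁻¹ * (Complex.Gamma (μ - d + 1))⁻¹)

lemma besselJ_add_int_mul_pi (ν l : ℂ) (k : ℤ) :
    besselJ ν (l + k * (Real.pi * Complex.I)) =
      Complex.exp (ν * (k * (Real.pi * Complex.I))) * besselJ ν l := by
  unfold besselJ
  rw [← tsum_mul_left]
  refine tsum_congr fun n => ?_
  have h : Complex.exp ((ν + 2 * n) * (l + k * (Real.pi * Complex.I) - Real.log 2)) =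
      Complex.exp (ν * (k * (Real.pi * Complex.I))) *
        Complex.exp ((ν + 2 * n) * (l - Real.log 2)) := by
    rw [← Complex.exp_add, Complex.exp_eq_exp_iff_exists_int]
    exact ⟨n * k, by push_cast; ring⟩
  rw [h]; ring

/-- `prodJ` does not depend on the choice of the argument of `z` modulo `π`. -/
lemma prodJ_add_int_mul_pi (μ : ℂ) (d : ℤ) (l : ℂ) (k : ℤ) :
    prodJ μ d (l + k * (Real.pi * Complex.I)) = prodJ μ d l := by
  have hc : (starRingEnd ℂ) (l + k * (Real.pi * Complex.I)) =
      (starRingEnd ℂ) l + ((-k : ℤ) : ℂ) * (Real.pi * Complex.I) := by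
    simp
  have h1 : Complex.exp ((μ + d) * (k * (Real.pi * Complex.I))) *
      Complex.exp ((μ - d) * (((-k : ℤ) : ℂ) * (Real.pi * Complex.I))) = 1 := by
    rw [← Complex.exp_add, Complex.exp_eq_one_iff]
    exact ⟨d * k, by push_cast; ring⟩
  unfold prodJ
  rw [hc, besselJ_add_int_mul_pi, besselJ_add_int_mul_pi]
  linear_combination (besselJ (μ + d) l * besselJ (μ - d) ((starRingEnd ℂ) l)) * h1

/-- The function `J_{μ,d} (z) = J_{μ+d} (z) J_{μ-d} (z̄)` on `ℂ ∖ {0}`. -/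
def J (μ : ℂ) (d : ℤ) (z : ℂ) : ℂ := prodJ μ d (Complex.log z)

/-- The function `P_{μ,d} (z)` on `ℂ ∖ {0}`, the leading term of `J_{μ,d} (z)` at `0`. -/
def P (μ : ℂ) (d : ℤ) (z : ℂ) : ℂ := prodP μ d (Complex.log z)

/-- `(J_{-μ,-d} (4πz) - J_{μ,d} (4πz)) / sin (πμ)`, for `sin (πμ) ≠ 0`. -/
def quotJ (μ : ℂ) (d : ℤ) (z : ℂ) : ℂ :=
  (J (-μ) (-d) (4 * Real.pi * z) - J μ d (4 * Real.pi * z)) / Complex.sin (Real.pi * μ)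

/-- `(P_{-μ,-d} (4πz) - P_{μ,d} (4πz)) / sin (πμ)`, for `sin (πμ) ≠ 0`. -/
def quotP (μ : ℂ) (d : ℤ) (z : ℂ) : ℂ :=
  (P (-μ) (-d) (4 * Real.pi * z) - P μ d (4 * Real.pi * z)) / Complex.sin (Real.pi * μ)

open Classical in
/-- The Bessel function over the complex numbers, with the limit in the order when `μ ∈ ℤ`. -/
def boldJ (μ : ℂ) (d : ℤ) (z : ℂ) : ℂ :=
  if Complex.sin (Real.pi * μ) = 0 then limUnder (𝓝[≠] μ) (fun s => quotJ s d z)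
  else quotJ μ d z

open Classical in
/-- The regularizing term, with the limit in the order when `μ` is an integer (for `|Re μ| < 1`
this is only the case `μ = 0`). -/
def boldR (μ : ℂ) (d : ℤ) (z : ℂ) : ℂ :=
  if Complex.sin (Real.pi * μ) = 0 then limUnder (𝓝[≠] μ) (fun s => quotP s d z)
  else quotP μ d z

/-- The regularized Bessel function. -/
def boldM (μ : ℂ) (d : ℤ) (z : ℂ) : ℂ := boldJ μ d z - boldR μ d z

/-- The integrand `M_{μ,d} (x e^{iφ}) e (-2 x y cos (φ + θ)) / x` in polar coordinates. -/
def integrand (μ : ℂ) (d : ℤ) (y θ x φ : ℝ) : ℂ :=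
  boldM μ d (x * Complex.exp (φ * Complex.I)) * e (-2 * x * y * Real.cos (φ + θ)) / x

/-- The improper integral `∫_0^{2π} ∫_0^∞ f (x, φ) dx dφ` converges to `L` as a double integral:
`f` is integrable on every bounded disc `0 < x ≤ T`, and the integrals over these discs tend to `L`
as `T → ∞`. -/
def ConvergesAsDoubleIntegral (f : ℝ → ℝ → ℂ) (L : ℂ) : Prop :=
  (∀ T : ℝ, 0 < T →
    IntegrableOn (fun p : ℝ × ℝ => f p.1 p.2) (Ioc 0 T ×ˢ Ioc 0 (2 * Real.pi))) ∧
  Tendsto (fun T : ℝ => ∫ p in Ioc (0 : ℝ) T ×ˢ Ioc (0 : ℝ) (2 * Real.pi), f p.1 p.2)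
    atTop (𝓝 L)

/-- The integral `∫_0^{2π} (∫_0^∞ f (x, φ) dx) dφ` converges to `L` as an iterated integral: for
almost every `φ` the inner integral converges (absolutely at `0`, possibly conditionally at `∞`),
its value is an integrable function of `φ`, and the integral of that function is `L`. -/
def ConvergesAsIteratedIntegral (f : ℝ → ℝ → ℂ) (L : ℂ) : Prop :=
  ∃ g : ℝ → ℂ,
    (∀ᵐ φ ∂(volume.restrict (Ioc (0 : ℝ) (2 * Real.pi))),
      (∀ T : ℝ, 0 < T → IntegrableOn (fun x => f x φ) (Ioc 0 T)) ∧
      Tendsto (fun T : ℝ => ∫ x in Ioc (0 : ℝ) T, f x φ) atTop (𝓝 (g φ))) ∧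
    IntegrableOn g (Ioc 0 (2 * Real.pi)) ∧
    ∫ φ in Ioc (0 : ℝ) (2 * Real.pi), g φ = L

/-- `Y = |z + √(z² - 4)| / 2`, where `r` is the value of the square root. -/
def Y (z r : ℂ) : ℝ := ‖z + r‖ / 2

/-- `E = (z + √(z² - 4)) / |z + √(z² - 4)|`, where `r` is the value of the square root. -/
def E (z r : ℂ) : ℂ := (z + r) / (‖z + r‖ : ℝ)

/-- The closed form of the Fourier transform at `z = y e^{iθ}`, for `μ² ≠ d²`; `r` is the value
of `√(z² - 4)`. -/
def closedForm (μ : ℂ) (d : ℤ) (y θ : ℝ) (r : ℂ) : ℂ :=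
  let z : ℂ := y * Complex.exp (θ * Complex.I)
  let A : ℂ := (Y z r : ℂ) ^ (2 * μ) * E z r ^ (2 * d)
  let B : ℂ := (y : ℂ) ^ (2 * μ) * Complex.exp (2 * Complex.I * d * θ)
  1 / ((d : ℂ) ^ 2 - μ ^ 2) * ((A - B) + (1 / A - 1 / B))

end

end ComplexBessel

namespace ComplexBessel

noncomputable section

/-! The proof rests on an absolutely convergent integral for the regularized Bessel function. With
`w = exp (t + iω)`, `Z = 4πz` and `phase ζ = e^{i Re ζ} - 1`, `boldM_eq` says that `π² M(z)` is the
integral of `|w|^{2μ} (w/|w|)^{2d} phase(Zw) phase(Z/w)` over `dt dω`. Subtracting 1 from each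
exponential makes one factor decay like `e^{-|t|}`, which beats the character exactly when `|Re μ| <
1/2`.

To prove this, cut at `|w| = 1`; the map `w ↦ 1/w` exchanges the two halves and turns `(μ, d)` into
`(-μ, -d)`. For `|w| < 1` expand `phase(Zw)` in powers of `Zw` and its conjugate. Every term is an
incomplete Mellin transform of an angular mode of `phase`, and `outerMode_eq` writes it as the
complete transform, continued analytically, plus a sum over poles. The complete transforms are Gamma
quotients which add up to `J - P` (`hasSum_mellinPart`), the subtraction of `P` being due to the
missing constant term of `phase`. The pole sums form a double series antisymmetric under exchange of
the halves (`poleTerm_swap`), so they cancel.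

In the Fourier integral the product of the two phases and the character is a sum of four
exponentials with signs `+, -, -, +`, with frequencies `w + 1/w - u`, `w - u`, `1/w - u`, `-u` for
`u = y e^{iθ}`. The radial integral up to `T` is thus a combination of values of `∫_0^z (e^{iτ} -
1)/τ dτ`, which behaves like `-log |z|` plus a constant and a jump in the sign of `z`. A Hölder-type
bound uniform in `T` (`exists_norm_expInt_sub_le`) gives a dominating function
(`exists_dominating`), hence convergence in both senses to the same value.

Averaging that limit over `φ` removes the sign terms and leaves `log |w - w₁| - log |w - u| - log |w
- 1/u| + log |w - 1/w₁|`, where `w₁ + 1/w₁ = u` (`ae_integral_limInt`). The Fourier coefficients of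
`log |w - a|` on circles are multiples of `e^{-k|t - log |a||}`, or a maximum when `k = 0`, and
integration against `e^{2μt}` produces the factor `1/(d² - μ²)` and the character at `w₁`, `u` and
their inverses (`fourierValue_eq`). The case `μ = d = 0` follows by continuity in `μ`. -/

/-- The restriction of Lebesgue measure to the period `(0, 2π]`. -/
abbrev circ : Measure ℝ := volume.restrict (Ioc 0 (2 * Real.pi))

lemma circ_real_univ : circ.real univ = 2 * Real.pi := by
  simp [Measure.real, Real.pi_pos.le]

/-! ### The regularized exponential and its power series -/

/-- `exp (i Re ζ) - 1`. -/
def phase (ζ : ℂ) : ℂ := Complex.exp (Complex.I * (ζ.re : ℝ)) - 1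

lemma continuous_phase : Continuous phase := by
  unfold phase; fun_prop

lemma norm_phase_le_two (ζ : ℂ) : ‖phase ζ‖ ≤ 2 := by
  unfold phase
  refine (norm_sub_le _ _).trans ?_
  rw [mul_comm, Complex.norm_exp_ofReal_mul_I]
  norm_num

lemma norm_phase_le (ζ : ℂ) : ‖phase ζ‖ ≤ ‖ζ‖ :=
  Real.norm_exp_I_mul_ofReal_sub_one_le.trans (Complex.abs_re_le_norm ζ)

/-- The coefficients of the expansion of `phase ζ` in powers of `ζ` and its conjugate. -/
def coef (p : ℕ × ℕ) : ℂ :=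
  if p = 0 then 0 else (Complex.I / 2) ^ (p.1 + p.2) / (p.1.factorial * p.2.factorial)

lemma coef_zero : coef 0 = 0 := by simp [coef]

lemma hasSum_exp_series (z : ℂ) : HasSum (fun n : ℕ => z ^ n / n.factorial) (Complex.exp z) := by
  rw [Complex.exp_eq_exp_ℂ]
  exact NormedSpace.expSeries_div_hasSum_exp z

lemma summable_norm_exp_series (z : ℂ) : Summable (fun n : ℕ => ‖z ^ n / n.factorial‖) := by
  have := Real.summable_pow_div_factorial ‖z‖
  refine this.congr fun n => ?_
  simp

lemma summable_norm_coef (R : ℝ) : Summable fun p : ℕ × ℕ => ‖coef p‖ * R ^ (p.1 + p.2) := by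
  have h := (Real.summable_pow_div_factorial |R|).mul_of_nonneg
    (Real.summable_pow_div_factorial |R|)
    (fun n => by positivity) (fun n => by positivity)
  refine Summable.of_norm_bounded h fun p => ?_
  rw [norm_mul, norm_norm, norm_pow, Real.norm_eq_abs]
  have hc : ‖coef p‖ ≤ 1 / (p.1.factorial * p.2.factorial) := by
    unfold coef
    split_ifs
    · simp; positivity
    · rw [norm_div, norm_pow]
      simp only [norm_mul, Complex.norm_natCast]
      gcongr
      refine pow_le_one₀ (by positivity) ?_
      simp; norm_num
  calc ‖coef p‖ * |R| ^ (p.1 + p.2) ≤ 1 / (p.1.factorial * p.2.factorial) * |R| ^ (p.1 + p.2) := by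
        gcongr
    _ = _ := by rw [pow_add]; field_simp

/-- Since `Re ζ` is half the sum of `ζ` and its conjugate, `e^{i Re ζ}` is a product of two
exponential series. -/
lemma hasSum_phase (ζ : ℂ) :
    HasSum (fun p : ℕ × ℕ => coef p * (ζ ^ p.1 * (starRingEnd ℂ) ζ ^ p.2)) (phase ζ) := by
  set a := Complex.I * ζ / 2
  set b := Complex.I * (starRingEnd ℂ) ζ / 2
  have hs := summable_mul_of_summable_norm (summable_norm_exp_series a)
    (summable_norm_exp_series b)
  have h := hs.hasSum
  rw [← tsum_mul_tsum_of_summable_norm (summable_norm_exp_series a)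
    (summable_norm_exp_series b), (hasSum_exp_series a).tsum_eq, (hasSum_exp_series b).tsum_eq,
    ← Complex.exp_add] at h
  have hab : a + b = Complex.I * (ζ.re : ℝ) := by
    have := Complex.add_conj ζ
    simp only [a, b]
    push_cast at this
    linear_combination Complex.I / 2 * this
  rw [hab] at h
  -- The `-1` in `phase` deletes precisely the constant term. This missing term later becomes the
  -- subtraction of `P` from the Bessel product.
  have h2 := hasSum_ite_sub_hasSum h (0 : ℕ × ℕ)
  simp only [Prod.fst_zero, Prod.snd_zero, pow_zero, Nat.factorial_zero, Nat.cast_one, div_one,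
    mul_one] at h2
  refine h2.congr_fun ?_
  intro p
  by_cases hp : p = 0
  · simp [hp, coef_zero]
  · simp only [hp, if_false, coef, a, b]
    rw [pow_add]
    field_simp
    simp only [mul_pow, div_pow]
    ring

lemma integral_circ_exp (n : ℤ) :
    ∫ ω, Complex.exp (n * (ω : ℝ) * Complex.I) ∂circ = if n = 0 then 2 * Real.pi else 0 := by
  rw [← intervalIntegral.integral_of_le (by positivity)]
  split_ifs with h
  · simp [h]
  · have hc : (n : ℂ) * Complex.I ≠ 0 := by simp [h]
    have := integral_exp_mul_complex (a := 0) (b := 2 * Real.pi) hc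
    have e : ∀ ω : ℝ, Complex.exp (n * (ω : ℝ) * Complex.I) =
        Complex.exp (n * Complex.I * (ω : ℝ)) := fun ω => by congr 1; ring
    simp_rw [e, this]
    have h2 : (n : ℂ) * Complex.I * ((2 * Real.pi : ℝ) : ℂ) = n * (2 * Real.pi * Complex.I) := by
      push_cast; ring
    rw [h2, Complex.exp_int_mul_two_pi_mul_I]
    simp

/-! ### Gamma integrals in exponential coordinates -/

lemma integrable_of_norm_le_exp {E : Type*} [NormedAddCommGroup E] {f : ℝ → E} {C a b : ℝ}
    (hf : AEStronglyMeasurable f) (ha : 0 < a) (hb : 0 < b)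
    (h1 : ∀ t ≤ 0, ‖f t‖ ≤ C * Real.exp (a * t)) (h2 : ∀ t, 0 < t → ‖f t‖ ≤ C * Real.exp (-b * t)) :
    Integrable f := by
  rw [← integrableOn_univ, ← Iic_union_Ioi (a := (0 : ℝ))]
  refine IntegrableOn.union ?_ ?_
  · refine Integrable.mono' ((integrableOn_exp_mul_Iic ha 0).const_mul C) hf.restrict ?_
    exact (ae_restrict_iff' measurableSet_Iic).2 (ae_of_all _ fun t ht => h1 t ht)
  · refine Integrable.mono' ((integrableOn_exp_mul_Ioi (a := -b) (by linarith) 0).const_mul C)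
      hf.restrict ?_
    exact (ae_restrict_iff' measurableSet_Ioi).2 (ae_of_all _ fun t ht => h2 t ht)

lemma rexp_image_univ : Real.exp '' univ = Ioi 0 := by rw [image_univ, Real.range_exp]

/-- The substitution `τ = e^x` in Euler's integral; in these coordinates Mellin transforms become
Laplace transforms over the line, and dilations become translations. -/
lemma gamma_integrand_eq (β : ℂ) (x : ℝ) :
    |Real.exp x| • ((Real.exp (-(Real.exp x)) : ℂ) * (Real.exp x : ℂ) ^ (β - 1)) =
      Complex.exp (β * x) * Complex.exp (-Real.exp x) := by
  rw [abs_of_pos (Real.exp_pos x), Complex.real_smul, Complex.ofReal_exp x,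
    Complex.cpow_def_of_ne_zero (Complex.exp_ne_zero _), ← Complex.ofReal_exp x,
    ← Complex.ofReal_log (Real.exp_pos x).le, Real.log_exp, Complex.ofReal_exp x,
    Complex.ofReal_exp (-Real.exp x), Complex.ofReal_neg, Complex.ofReal_exp x,
    ← mul_assoc, mul_right_comm, ← Complex.exp_add]
  ring_nf

lemma integrable_exp_mul_exp_neg_exp {β : ℂ} (hβ : 0 < β.re) :
    Integrable fun x : ℝ => Complex.exp (β * x) * Complex.exp (-Real.exp x) := by
  have := (integrableOn_image_iff_integrableOn_abs_deriv_smul MeasurableSet.univ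
    (fun x _ => (Real.hasDerivAt_exp x).hasDerivWithinAt) Real.exp_injective.injOn
    (fun x => (Real.exp (-x) : ℂ) * (x : ℂ) ^ (β - 1))).1
    (by rw [rexp_image_univ]; exact Complex.GammaIntegral_convergent hβ)
  simp_rw [gamma_integrand_eq] at this
  simpa using this

lemma integral_exp_mul_exp_neg_exp {β : ℂ} (hβ : 0 < β.re) :
    ∫ x : ℝ, Complex.exp (β * x) * Complex.exp (-Real.exp x) = Complex.Gamma β := by
  have := (integral_image_eq_integral_abs_deriv_smul MeasurableSet.univ
    (fun x _ => (Real.hasDerivAt_exp x).hasDerivWithinAt) Real.exp_injective.injOn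
    (fun x => (Real.exp (-x) : ℂ) * (x : ℂ) ^ (β - 1)))
  rw [rexp_image_univ] at this
  simp_rw [gamma_integrand_eq] at this
  rw [Complex.Gamma_eq_integral hβ, Complex.GammaIntegral, this]
  simp

lemma norm_exp_neg_exp_sub_one_le (x : ℝ) :
    ‖Complex.exp (-Real.exp x) - 1‖ ≤ min 1 (Real.exp x) := by
  have h : Complex.exp (-Real.exp x) - 1 = ((Real.exp (-Real.exp x) - 1 : ℝ) : ℂ) := by
    push_cast; rfl
  rw [h, Complex.norm_real, Real.norm_eq_abs, abs_sub_comm, abs_of_nonneg]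
  · refine le_min ?_ ?_
    · linarith [Real.exp_pos (-Real.exp x)]
    · linarith [Real.add_one_le_exp (-Real.exp x)]
  · have : Real.exp (-Real.exp x) ≤ 1 := Real.exp_le_one_iff.2 (by linarith [Real.exp_pos x])
    linarith

lemma norm_cexp_mul_ofReal (β : ℂ) (x : ℝ) : ‖Complex.exp (β * x)‖ = Real.exp (β.re * x) := by
  rw [Complex.norm_exp]; simp

lemma norm_exp_mul_exp_neg_exp_sub_one_le (b : ℂ) (x : ℝ) :
    ‖Complex.exp (b * x) * (Complex.exp (-Real.exp x) - 1)‖ ≤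
      min (Real.exp (b.re * x)) (Real.exp ((b.re + 1) * x)) := by
  rw [norm_mul, norm_cexp_mul_ofReal]
  have := norm_exp_neg_exp_sub_one_le x
  rw [le_min_iff] at *
  have h0 := Real.exp_pos (b.re * x)
  refine ⟨by nlinarith, ?_⟩
  rw [add_mul, Real.exp_add, one_mul]
  exact mul_le_mul_of_nonneg_left this.2 h0.le

lemma integrable_exp_mul_exp_neg_exp_sub_one {b : ℂ} (h1 : -1 < b.re) (h2 : b.re < 0) :
    Integrable fun x : ℝ => Complex.exp (b * x) * (Complex.exp (-Real.exp x) - 1) := by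
  refine integrable_of_norm_le_exp (C := 1) (a := b.re + 1) (b := -b.re)
    (Continuous.aestronglyMeasurable (by fun_prop)) (by linarith) (by linarith) ?_ ?_
  · intro t _
    simpa using (norm_exp_mul_exp_neg_exp_sub_one_le b t).trans (min_le_right _ _)
  · intro t _
    simpa using (norm_exp_mul_exp_neg_exp_sub_one_le b t).trans (min_le_left _ _)

/-- The Cauchy–Saalschütz extension of Euler's integral to the next strip on the left. Integrating
by parts, the boundary terms vanish at both ends and what remains is `Γ(b + 1)/b`. -/
lemma integral_exp_mul_exp_neg_exp_sub_one {b : ℂ} (h1 : -1 < b.re) (h2 : b.re < 0) :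
    ∫ x : ℝ, Complex.exp (b * x) * (Complex.exp (-Real.exp x) - 1) = Complex.Gamma b := by
  have hb : b ≠ 0 := by rintro rfl; simp at h2
  have hd : ∀ x : ℝ, HasDerivAt
      (fun x : ℝ => Complex.exp (b * x) * (Complex.exp (-Real.exp x) - 1) / b)
      (Complex.exp (b * x) * (Complex.exp (-Real.exp x) - 1) -
        Complex.exp ((b + 1) * x) * Complex.exp (-Real.exp x) / b) x := by
    intro x
    have e1 : HasDerivAt (fun x : ℝ => Complex.exp (b * x)) (Complex.exp (b * x) * b) x := by
      simpa using ((hasDerivAt_id x).ofReal_comp.const_mul b).cexp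
    have e2 : HasDerivAt (fun x : ℝ => Complex.exp (-Real.exp x) - 1)
        (Complex.exp (-Real.exp x) * (-Real.exp x)) x := by
      simpa using ((Real.hasDerivAt_exp x).ofReal_comp.neg.cexp).sub_const (1 : ℂ)
    refine ((e1.mul e2).div_const b).congr_deriv ?_
    have : Complex.exp ((b + 1) * x) = Complex.exp (b * x) * Real.exp x := by
      rw [add_mul, Complex.exp_add]; simp
    rw [this]
    field_simp
    ring
  have i1 := integrable_exp_mul_exp_neg_exp_sub_one h1 h2
  have i2 := integrable_exp_mul_exp_neg_exp (β := b + 1) (by simp; linarith)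
  have key := integral_of_hasDerivAt_of_tendsto (m := 0) (n := 0) hd (i1.sub (i2.div_const b))
    ?_ ?_
  · rw [integral_sub i1 (i2.div_const b), integral_div, integral_exp_mul_exp_neg_exp
      (by simp; linarith), sub_zero, sub_eq_zero] at key
    rw [key, Complex.Gamma_add_one b hb]
    field_simp
  · rw [← zero_div b]
    refine Tendsto.div_const ?_ b
    refine squeeze_zero_norm
      (fun t => (norm_exp_mul_exp_neg_exp_sub_one_le b t).trans (min_le_right _ _)) ?_
    exact Real.tendsto_exp_atBot.comp (tendsto_id.const_mul_atBot (by linarith))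
  · rw [← zero_div b]
    refine Tendsto.div_const ?_ b
    refine squeeze_zero_norm
      (fun t => (norm_exp_mul_exp_neg_exp_sub_one_le b t).trans (min_le_left _ _)) ?_
    exact Real.tendsto_exp_atBot.comp (tendsto_id.const_mul_atTop_of_neg (by linarith))

/-! ### Angular modes of the phase -/

/-- The `k`-th Fourier mode of `phase` on the circle of radius `‖Z‖`. -/
def angMode (k : ℤ) (Z : ℂ) : ℂ :=
  ∫ ω, Complex.exp (k * (ω : ℝ) * Complex.I) * phase (Z * Complex.exp (-(ω : ℝ) * Complex.I)) ∂circ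

/-- The terms of the power series of `angMode`. -/
def mcoef (k : ℤ) (Z : ℂ) (p : ℕ × ℕ) : ℂ :=
  coef p * (Z ^ p.1 * (starRingEnd ℂ) Z ^ p.2) *
    (if k - ((p.1 : ℤ) - p.2) = 0 then 2 * Real.pi else 0 : ℝ)

lemma norm_mcoef_le (k : ℤ) (Z : ℂ) (p : ℕ × ℕ) :
    ‖mcoef k Z p‖ ≤ 2 * Real.pi * (‖coef p‖ * ‖Z‖ ^ (p.1 + p.2)) := by
  unfold mcoef
  have h : ‖((if k - ((p.1 : ℤ) - p.2) = 0 then 2 * Real.pi else 0 : ℝ) : ℂ)‖ ≤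
      2 * Real.pi := by
    split_ifs
    · simp [abs_of_pos Real.pi_pos]
    · simp; positivity
  rw [norm_mul, norm_mul, norm_mul, norm_pow, norm_pow, RCLike.norm_conj, ← pow_add, mul_comm]
  gcongr

lemma summable_norm_mcoef (k : ℤ) (Z : ℂ) : Summable fun p => ‖mcoef k Z p‖ :=
  Summable.of_nonneg_of_le (fun _ => norm_nonneg _) (norm_mcoef_le k Z)
    ((summable_norm_coef ‖Z‖).mul_left _)

lemma mcoef_zero (k : ℤ) (Z : ℂ) : mcoef k Z 0 = 0 := by simp [mcoef, coef_zero]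

lemma mcoef_mul_exp (k : ℤ) (Z : ℂ) (t : ℝ) (p : ℕ × ℕ) :
    mcoef k (Z * Real.exp t) p = mcoef k Z p * Complex.exp (((p.1 + p.2 : ℕ) : ℂ) * t) := by
  unfold mcoef
  rw [map_mul, Complex.conj_ofReal, mul_pow, mul_pow, Complex.exp_nat_mul, Complex.ofReal_exp,
    pow_add]
  ring

lemma norm_exp_int_mul (k : ℤ) (ω : ℝ) : ‖Complex.exp (k * (ω : ℂ) * Complex.I)‖ = 1 := by
  rw [← Complex.ofReal_intCast, ← Complex.ofReal_mul, Complex.norm_exp_ofReal_mul_I]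

lemma norm_exp_neg_mul_I (ω : ℝ) : ‖Complex.exp (-(ω : ℂ) * Complex.I)‖ = 1 := by
  rw [← Complex.ofReal_neg, Complex.norm_exp_ofReal_mul_I]

/-- The series of `phase` is integrated term by term. Orthogonality of the exponentials keeps only
the monomials with `p.1 - p.2 = k`, which is the indicator in `mcoef`. -/
lemma hasSum_angMode (k : ℤ) (Z : ℂ) : HasSum (mcoef k Z) (angMode k Z) := by
  have hterm : ∀ (p : ℕ × ℕ) (ω : ℝ), Complex.exp (k * (ω : ℂ) * Complex.I) *
      (coef p * ((Z * Complex.exp (-(ω : ℂ) * Complex.I)) ^ p.1 *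
        (starRingEnd ℂ) (Z * Complex.exp (-(ω : ℂ) * Complex.I)) ^ p.2)) =
      coef p * (Z ^ p.1 * (starRingEnd ℂ) Z ^ p.2) *
        Complex.exp (((k - ((p.1 : ℤ) - p.2) : ℤ) : ℂ) * (ω : ℂ) * Complex.I) := by
    intro p ω
    have e1 : (starRingEnd ℂ) (Complex.exp (-(ω : ℂ) * Complex.I)) =
        Complex.exp ((ω : ℂ) * Complex.I) := by
      rw [← Complex.exp_conj]; simp
    rw [map_mul, e1, mul_pow, mul_pow, ← Complex.exp_nat_mul, ← Complex.exp_nat_mul]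
    have e2 : Complex.exp (((k - ((p.1 : ℤ) - p.2) : ℤ) : ℂ) * (ω : ℂ) * Complex.I) =
        Complex.exp (k * (ω : ℂ) * Complex.I) * Complex.exp (p.1 * (-(ω : ℂ) * Complex.I)) *
          Complex.exp (p.2 * ((ω : ℂ) * Complex.I)) := by
      rw [← Complex.exp_add, ← Complex.exp_add]; congr 1; push_cast; ring
    rw [e2]; ring
  have key := hasSum_integral_of_summable_integral_norm (μ := circ)
    (F := fun (p : ℕ × ℕ) (ω : ℝ) => Complex.exp (k * (ω : ℂ) * Complex.I) *
      (coef p * ((Z * Complex.exp (-(ω : ℂ) * Complex.I)) ^ p.1 *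
        (starRingEnd ℂ) (Z * Complex.exp (-(ω : ℂ) * Complex.I)) ^ p.2))) ?_ ?_
  · have h1 : ∀ ω : ℝ, ∑' p : ℕ × ℕ, Complex.exp (k * (ω : ℂ) * Complex.I) *
        (coef p * ((Z * Complex.exp (-(ω : ℂ) * Complex.I)) ^ p.1 *
          (starRingEnd ℂ) (Z * Complex.exp (-(ω : ℂ) * Complex.I)) ^ p.2)) =
        Complex.exp (k * (ω : ℂ) * Complex.I) * phase (Z * Complex.exp (-(ω : ℂ) * Complex.I)) :=
      fun ω => by rw [tsum_mul_left, (hasSum_phase _).tsum_eq]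
    simp_rw [h1, hterm, integral_const_mul, integral_circ_exp] at key
    exact key
  · intro p
    simp_rw [hterm]
    exact (Continuous.integrableOn_Ioc (by fun_prop))
  · simp_rw [hterm]
    refine ((summable_norm_coef ‖Z‖).mul_left (2 * Real.pi)).congr fun p => ?_
    simp only [norm_mul, norm_exp_int_mul, norm_pow, RCLike.norm_conj, mul_one]
    rw [integral_const, circ_real_univ, pow_add]
    simp

lemma norm_integral_circ_le {f : ℝ → ℂ} {C : ℝ} (h : ∀ ω, ‖f ω‖ ≤ C) :
    ‖∫ ω, f ω ∂circ‖ ≤ 2 * Real.pi * C := by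
  refine (norm_integral_le_of_norm_le_const (ae_of_all _ h)).trans ?_
  rw [circ_real_univ, mul_comm]

lemma norm_angMode_le (k : ℤ) (Z : ℂ) : ‖angMode k Z‖ ≤ 2 * Real.pi * 2 := by
  refine norm_integral_circ_le fun ω => ?_
  rw [norm_mul, norm_exp_int_mul, one_mul]
  exact norm_phase_le_two _

lemma norm_angMode_le' (k : ℤ) (Z : ℂ) : ‖angMode k Z‖ ≤ 2 * Real.pi * ‖Z‖ := by
  refine norm_integral_circ_le fun ω => ?_
  rw [norm_mul, norm_exp_int_mul, one_mul]
  refine (norm_phase_le _).trans ?_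
  rw [norm_mul, norm_exp_neg_mul_I, mul_one]

lemma continuous_angMode (k : ℤ) : Continuous (angMode k) := by
  refine continuous_of_dominated (bound := fun _ => 2) (fun Z => ?_) (fun Z => ?_)
    (integrable_const _) (ae_of_all _ fun ω => ?_)
  · exact (Continuous.aestronglyMeasurable
      (by have := continuous_phase; fun_prop))
  · refine ae_of_all _ fun ω => ?_
    rw [norm_mul, norm_exp_int_mul, one_mul]
    exact norm_phase_le_two _
  · have := continuous_phase; fun_prop

/-- The coefficients are symmetric in the two exponents, so conjugating `Z` only reverses the mode.
It reduces negative modes to nonnegative ones. -/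
lemma angMode_conj (k : ℤ) (Z : ℂ) : angMode k ((starRingEnd ℂ) Z) = angMode (-k) Z := by
  refine (hasSum_angMode k _).unique ?_
  rw [← (Equiv.prodComm ℕ ℕ).hasSum_iff]
  refine (hasSum_angMode (-k) Z).congr_fun fun p => ?_
  simp only [mcoef, Function.comp, Equiv.prodComm_apply, Prod.fst_swap, Prod.snd_swap,
    Complex.conj_conj, coef, Prod.swap_eq_iff_eq_swap]
  have e : (k - ((p.2 : ℤ) - p.1) = 0) = (-k - ((p.1 : ℤ) - p.2) = 0) := by
    apply propext; constructor <;> intro h <;> linarith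
  have e2 : (p = Prod.swap 0) = (p = 0) := rfl
  simp only [e, e2]
  congr 1
  rw [mul_comm ((starRingEnd ℂ) Z ^ p.2), add_comm, mul_comm (p.2.factorial : ℂ)]

/-! ### Incomplete Mellin transforms in the strip `0 < Re s < 1` -/

/-- The incomplete Mellin transform of `angMode k` along the ray through `Z`. -/
def outerMode (s : ℂ) (k : ℤ) (Z : ℂ) : ℂ :=
  ∫ t in Ioi (0 : ℝ), Complex.exp (-s * t) * angMode k (Z * Real.exp t)

/-- The sum over the poles of the Mellin transform of `angMode k`. -/
def poleSum (s : ℂ) (k : ℤ) (Z : ℂ) : ℂ :=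
  ∑' p : ℕ × ℕ, mcoef k Z p / (s - ((p.1 + p.2 : ℕ) : ℂ))

lemma continuous_mellin_integrand (s : ℂ) (k : ℤ) (Z : ℂ) :
    Continuous fun t : ℝ => Complex.exp (-s * t) * angMode k (Z * Real.exp t) := by
  have := continuous_angMode k
  fun_prop

lemma norm_mellin_integrand_le (s : ℂ) (k : ℤ) (Z : ℂ) (t : ℝ) :
    ‖Complex.exp (-s * t) * angMode k (Z * Real.exp t)‖ ≤
      2 * Real.pi * 2 * Real.exp (-s.re * t) := by
  rw [norm_mul, norm_cexp_mul_ofReal, mul_comm, Complex.neg_re]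
  gcongr
  exact norm_angMode_le _ _

lemma norm_mellin_integrand_le' (s : ℂ) (k : ℤ) (Z : ℂ) (t : ℝ) :
    ‖Complex.exp (-s * t) * angMode k (Z * Real.exp t)‖ ≤
      2 * Real.pi * ‖Z‖ * Real.exp ((1 - s.re) * t) := by
  rw [norm_mul, norm_cexp_mul_ofReal, mul_comm, Complex.neg_re]
  have := norm_angMode_le' k (Z * Real.exp t)
  rw [norm_mul, Complex.norm_real, Real.norm_eq_abs, abs_of_pos (Real.exp_pos t)] at this
  calc _ ≤ 2 * Real.pi * (‖Z‖ * Real.exp t) * Real.exp (-s.re * t) := by gcongr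
    _ = _ := by rw [sub_mul, sub_eq_add_neg, Real.exp_add]; ring_nf

lemma integrableOn_mellin_integrand {s : ℂ} (hs : 0 < s.re) (k : ℤ) (Z : ℂ) :
    IntegrableOn (fun t : ℝ => Complex.exp (-s * t) * angMode k (Z * Real.exp t)) (Ioi 0) := by
  refine Integrable.mono' ((integrableOn_exp_mul_Ioi (a := -s.re) (by linarith) 0).const_mul
    (2 * Real.pi * 2)) (continuous_mellin_integrand s k Z).aestronglyMeasurable
    (ae_of_all _ fun t => norm_mellin_integrand_le s k Z t)

/-- Boundedness of the mode gives convergence at `+∞` for `Re s > 0`, and its linear vanishing at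
the origin gives convergence at `-∞` for `Re s < 1`. -/
lemma integrable_mellin_integrand {s : ℂ} (hs : 0 < s.re) (hs1 : s.re < 1) (k : ℤ) (Z : ℂ) :
    Integrable (fun t : ℝ => Complex.exp (-s * t) * angMode k (Z * Real.exp t)) := by
  refine integrable_of_norm_le_exp (C := max (2 * Real.pi * ‖Z‖) (2 * Real.pi * 2))
    (a := 1 - s.re) (b := s.re)
    (continuous_mellin_integrand s k Z).aestronglyMeasurable (by linarith) hs ?_ ?_
  · intro t _
    refine (norm_mellin_integrand_le' s k Z t).trans ?_
    gcongr
    exact le_max_left _ _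
  · intro t _
    refine (norm_mellin_integrand_le s k Z t).trans ?_
    gcongr
    exact le_max_right _ _

/-- On the half-line `t ≤ 0` the Mellin integral can be computed term by term. -/
lemma integral_Iic_mellin {s : ℂ} (hs1 : s.re < 1) (k : ℤ) (Z : ℂ) :
    ∫ t in Iic (0 : ℝ), Complex.exp (-s * t) * angMode k (Z * Real.exp t) = - poleSum s k Z := by
  have hterm : ∀ (p : ℕ × ℕ) (t : ℝ), Complex.exp (-s * t) * mcoef k (Z * Real.exp t) p =
      mcoef k Z p * Complex.exp ((((p.1 + p.2 : ℕ) : ℂ) - s) * t) := by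
    intro p t
    rw [mcoef_mul_exp, sub_mul, sub_eq_add_neg, Complex.exp_add]
    ring_nf
  have hre : ∀ p : ℕ × ℕ, p ≠ 0 → 1 - s.re ≤ ((((p.1 + p.2 : ℕ) : ℂ) - s)).re := by
    intro p hp
    have : 1 ≤ p.1 + p.2 := by
      by_contra h
      exact hp (Prod.ext (by simp; omega) (by simp; omega))
    have h2 : (1 : ℝ) ≤ ((p.1 + p.2 : ℕ) : ℝ) := by exact_mod_cast this
    simp only [Complex.sub_re, Complex.natCast_re]
    linarith
  have key := hasSum_integral_of_summable_integral_norm (μ := volume.restrict (Iic (0 : ℝ)))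
    (F := fun (p : ℕ × ℕ) (t : ℝ) => Complex.exp (-s * t) * mcoef k (Z * Real.exp t) p) ?_ ?_
  · have e : ∀ t : ℝ, ∑' p, Complex.exp (-s * t) * mcoef k (Z * Real.exp t) p =
        Complex.exp (-s * t) * angMode k (Z * Real.exp t) := fun t => by
      rw [tsum_mul_left, (hasSum_angMode k _).tsum_eq]
    simp_rw [e] at key
    rw [← key.tsum_eq, poleSum, ← tsum_neg]
    refine tsum_congr fun p => ?_
    simp_rw [hterm]
    by_cases hp : p = 0
    · simp [hp, mcoef_zero]
    · rw [integral_const_mul, integral_exp_mul_complex_Iic (by linarith [hre p hp]), ← div_neg,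
        neg_sub]
      simp [div_eq_mul_inv]
  · intro p
    simp_rw [hterm]
    by_cases hp : p = 0
    · simp [hp, mcoef_zero]
    · exact (integrableOn_exp_mul_complex_Iic (by linarith [hre p hp]) 0).const_mul _
  · simp_rw [hterm]
    refine Summable.of_nonneg_of_le (fun p => integral_nonneg fun t => norm_nonneg _) (fun p => ?_)
      ((summable_norm_mcoef k Z).mul_right (1 - s.re)⁻¹)
    by_cases hp : p = 0
    · simp [hp, mcoef_zero]
    · simp_rw [norm_mul, norm_cexp_mul_ofReal]
      have h1 := hre p hp
      have h2 : 0 < (((p.1 + p.2 : ℕ) : ℂ) - s).re := by linarith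
      rw [integral_const_mul, integral_exp_mul_Iic h2]
      simp only [mul_zero, Real.exp_zero, one_div]
      gcongr

/-- The half-line `t > 0` is the whole line minus `t ≤ 0`, where the power series integrates to
minus the pole sum. -/
lemma outerMode_eq_of_re_lt_one {s : ℂ} (hs : 0 < s.re) (hs1 : s.re < 1) (k : ℤ) (Z : ℂ) :
    outerMode s k Z =
      (∫ t : ℝ, Complex.exp (-s * t) * angMode k (Z * Real.exp t)) + poleSum s k Z := by
  have h := integrable_mellin_integrand hs hs1 k Z
  rw [← intervalIntegral.integral_Iic_add_Ioi h.integrableOn h.integrableOn (b := 0),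
    integral_Iic_mellin hs1]
  unfold outerMode
  ring

/-! ### The complete Mellin transform through Gaussian integrals -/

lemma integral_norm_exp_mul_exp_neg_exp {β : ℂ} (hβ : 0 < β.re) :
    ∫ x : ℝ, ‖Complex.exp (β * x) * Complex.exp (-Real.exp x)‖ = Real.Gamma β.re := by
  have e : ∀ x : ℝ, ((‖Complex.exp (β * x) * Complex.exp (-Real.exp x)‖ : ℝ) : ℂ) =
      Complex.exp ((β.re : ℂ) * x) * Complex.exp (-Real.exp x) := by
    intro x
    rw [norm_mul, norm_cexp_mul_ofReal, ← Complex.ofReal_neg, ← Complex.ofReal_exp,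
      Complex.norm_real, Real.norm_of_nonneg (Real.exp_pos _).le]
    push_cast; rfl
  have h := integral_exp_mul_exp_neg_exp (β := (β.re : ℂ)) (by simpa)
  simp_rw [← e] at h
  rw [integral_complex_ofReal, Complex.Gamma_ofReal] at h
  exact_mod_cast h

lemma integral_comp_add_two_mul {E : Type*} [NormedAddCommGroup E] [NormedSpace ℝ E] (F : ℝ → E)
    (y : ℝ) : ∫ t : ℝ, F (y + 2 * t) = (2 : ℝ)⁻¹ • ∫ x, F x := by
  rw [Measure.integral_comp_mul_left (fun x => F (y + x)) 2, integral_add_left_eq_self]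
  norm_num

lemma integrable_comp_add_two_mul {E : Type*} [NormedAddCommGroup E] {F : ℝ → E}
    (hF : Integrable F) (y : ℝ) : Integrable fun t : ℝ => F (y + 2 * t) :=
  (hF.comp_add_left y).comp_mul_left' two_ne_zero

lemma moment_integrand_eq (m : ℕ) (y t : ℝ) :
    Complex.exp ((2 * m + 2) * t) * Complex.exp (-Real.exp (y + 2 * t)) =
      Complex.exp (-((m + 1) * y)) * (Complex.exp ((m + 1 : ℂ) * (y + 2 * t : ℝ)) *
        Complex.exp (-Real.exp (y + 2 * t))) := by
  have : Complex.exp ((2 * m + 2) * t) =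
      Complex.exp (-((m + 1) * y)) * Complex.exp ((m + 1 : ℂ) * (y + 2 * t : ℝ)) := by
    rw [← Complex.exp_add]; congr 1; push_cast; ring
  rw [this, mul_assoc]

lemma integral_moment (m : ℕ) (y : ℝ) :
    ∫ t : ℝ, Complex.exp ((2 * m + 2) * t) * Complex.exp (-Real.exp (y + 2 * t)) =
      Complex.exp (-((m + 1) * y)) * m.factorial / 2 := by
  simp_rw [moment_integrand_eq]
  rw [integral_const_mul, integral_comp_add_two_mul (fun x : ℝ =>
    Complex.exp ((m + 1 : ℂ) * x) * Complex.exp (-Real.exp x)) y,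
    integral_exp_mul_exp_neg_exp (by simp; positivity), Complex.Gamma_nat_eq_factorial]
  rw [Complex.real_smul]; push_cast; ring

lemma integrable_moment (m : ℕ) (y : ℝ) : Integrable fun t : ℝ =>
    Complex.exp ((2 * m + 2) * t) * Complex.exp (-Real.exp (y + 2 * t)) := by
  simp_rw [moment_integrand_eq]
  exact (integrable_comp_add_two_mul (integrable_exp_mul_exp_neg_exp
    (β := m + 1) (by simp; positivity)) y).const_mul _

lemma integral_norm_moment (m : ℕ) (y : ℝ) :
    ∫ t : ℝ, ‖Complex.exp ((2 * m + 2) * t) * Complex.exp (-Real.exp (y + 2 * t))‖ =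
      ‖Complex.exp (-((m + 1) * y))‖ * m.factorial / 2 := by
  simp_rw [moment_integrand_eq, norm_mul _ (_ * _)]
  rw [integral_const_mul, integral_comp_add_two_mul (fun x : ℝ =>
    ‖Complex.exp ((m + 1 : ℂ) * x) * Complex.exp (-Real.exp x)‖) y,
    integral_norm_exp_mul_exp_neg_exp (by simp; positivity)]
  have : ((m : ℂ) + 1).re = m + 1 := by simp
  rw [this, Real.Gamma_nat_eq_factorial, smul_eq_mul]
  ring

lemma hasSum_angMode_nat (n : ℕ) (Z : ℂ) (t : ℝ) :
    HasSum (fun q : ℕ => mcoef n Z (q + n, q) * Complex.exp (((q + n + q : ℕ) : ℂ) * t))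
      (angMode n (Z * Real.exp t)) := by
  have hi : Function.Injective fun q : ℕ => (q + n, q) := fun a b h => (Prod.ext_iff.1 h).2
  have := (hi.hasSum_iff (f := mcoef n (Z * Real.exp t)) (a := angMode n (Z * Real.exp t)) ?_).2
    (hasSum_angMode n _)
  · refine this.congr_fun fun q => ?_
    simp only [Function.comp, mcoef_mul_exp]
  · intro p hp
    have : ¬ ((n : ℤ) - ((p.1 : ℤ) - p.2) = 0) := by
      intro h
      exact hp ⟨p.2, Prod.ext (by simp; omega) rfl⟩
    simp [mcoef, this]

/-- `log (‖Z‖² / 4)` for `Z = exp l`. -/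
def logQuarter (l : ℂ) : ℝ := 2 * l.re - 2 * Real.log 2

lemma neg_exp_logQuarter (l : ℂ) : -(Real.exp (logQuarter l) : ℂ) =
    (Complex.I / 2) ^ 2 * (Complex.exp l * (starRingEnd ℂ) (Complex.exp l)) := by
  have h4 : Real.exp (2 * Real.log 2) = 4 := by
    rw [two_mul, Real.exp_add, Real.exp_log two_pos]; norm_num
  rw [← Complex.exp_conj, ← Complex.exp_add, Complex.add_conj, div_pow, Complex.I_sq, logQuarter,
    Real.exp_sub, h4]
  push_cast
  ring

/-- The Gaussian moment `(n + q)!` cancels one of the two factorials in the Bessel-type coefficient,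
so that an ordinary exponential series is left. -/
lemma mcoef_nat_mul_factorial {n q : ℕ} (h : (q + n, q) ≠ (0, 0)) (l : ℂ) (y : ℝ) :
    mcoef n (Complex.exp l) (q + n, q) *
      (Complex.exp (-(((n + q : ℕ) + 1) * y)) * (n + q).factorial / 2) =
    Real.pi * (Complex.I * Complex.exp l / 2) ^ n * Complex.exp (-((n + 1) * y)) *
      ((-(Real.exp (logQuarter l - y) : ℂ)) ^ q / q.factorial) := by
  have h0 : (n : ℤ) - (((q + n : ℕ) : ℤ) - q) = 0 := by push_cast; ring
  have h1 : ((q + n, q) : ℕ × ℕ) ≠ 0 := h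
  have hf : ((n + q).factorial : ℂ) ≠ 0 := by exact_mod_cast (n + q).factorial_ne_zero
  have hf2 : (q.factorial : ℂ) ≠ 0 := by exact_mod_cast q.factorial_ne_zero
  have e1 : -(Real.exp (logQuarter l - y) : ℂ) = (Complex.I / 2) ^ 2 *
      (Complex.exp l * (starRingEnd ℂ) (Complex.exp l)) * Complex.exp (-y) := by
    rw [← neg_exp_logQuarter, sub_eq_add_neg, Real.exp_add]; push_cast; ring
  have e2 : Complex.exp (-(((n + q : ℕ) + 1) * y)) =
      Complex.exp (-((n + 1) * y)) * Complex.exp (-y) ^ q := by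
    rw [← Complex.exp_nat_mul, ← Complex.exp_add]; congr 1; push_cast; ring
  simp only [mcoef, coef, h1, if_false, h0, if_true]
  rw [e1, e2, add_comm q n]
  push_cast
  field_simp
  rw [show (n + q + q) = n + 2 * q by ring]
  simp only [mul_pow, div_pow, pow_add, pow_mul]
  ring

/-- Weber's integral: a Bessel function integrated against a Gaussian gives a Gaussian. For `n = 0`
the series of the mode lacks its constant term, whence the subtracted 1. -/
lemma integral_gauss_angMode (n : ℕ) (l : ℂ) (y : ℝ) :
    ∫ t : ℝ, Complex.exp ((n + 2) * t) * Complex.exp (-Real.exp (y + 2 * t)) *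
      angMode n (Complex.exp l * Real.exp t) =
    Real.pi * (Complex.I * Complex.exp l / 2) ^ n * Complex.exp (-((n + 1) * y)) *
      (Complex.exp (-Real.exp (logQuarter l - y)) - if n = 0 then 1 else 0) := by
  set Z := Complex.exp l
  set X := Real.pi * (Complex.I * Z / 2) ^ n * Complex.exp (-((n + 1) * y))
  set w : ℂ := -(Real.exp (logQuarter l - y) : ℂ)
  have hterm : ∀ (q : ℕ) (t : ℝ), Complex.exp ((n + 2) * t) *
      Complex.exp (-Real.exp (y + 2 * t)) *
        (mcoef n Z (q + n, q) * Complex.exp (((q + n + q : ℕ) : ℂ) * t)) =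
      mcoef n Z (q + n, q) * (Complex.exp ((2 * (n + q : ℕ) + 2) * t) *
        Complex.exp (-Real.exp (y + 2 * t))) := by
    intro q t
    have : Complex.exp ((2 * (n + q : ℕ) + 2) * t) =
        Complex.exp ((n + 2) * t) * Complex.exp (((q + n + q : ℕ) : ℂ) * t) := by
      rw [← Complex.exp_add]; congr 1; push_cast; ring
    rw [this]; ring
  have hval : ∀ q : ℕ, mcoef n Z (q + n, q) *
      (Complex.exp (-(((n + q : ℕ) + 1) * y)) * (n + q).factorial / 2) =
      if (q + n, q) = (0, 0) then 0 else X * (w ^ q / q.factorial) := by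
    intro q
    split_ifs with h
    · rw [h]
      rw [show ((0, 0) : ℕ × ℕ) = 0 from rfl, mcoef_zero, zero_mul]
    · exact mcoef_nat_mul_factorial h l y
  have key := hasSum_integral_of_summable_integral_norm (μ := (volume : Measure ℝ))
    (F := fun (q : ℕ) (t : ℝ) => Complex.exp ((n + 2) * t) *
      Complex.exp (-Real.exp (y + 2 * t)) *
        (mcoef n Z (q + n, q) * Complex.exp (((q + n + q : ℕ) : ℂ) * t))) ?_ ?_
  · have e : ∀ t : ℝ, ∑' q : ℕ, Complex.exp ((n + 2) * t) *
        Complex.exp (-Real.exp (y + 2 * t)) *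
          (mcoef n Z (q + n, q) * Complex.exp (((q + n + q : ℕ) : ℂ) * t)) =
        Complex.exp ((n + 2) * t) * Complex.exp (-Real.exp (y + 2 * t)) *
          angMode n (Z * Real.exp t) := fun t => by
      rw [tsum_mul_left, (hasSum_angMode_nat n Z t).tsum_eq]
    simp_rw [e, hterm, integral_const_mul, integral_moment, hval] at key
    refine key.unique ?_
    have hs : HasSum (fun q : ℕ => X * (w ^ q / q.factorial)) (X * Complex.exp w) :=
      (hasSum_exp_series w).mul_left X
    by_cases hn : n = 0
    · have := hasSum_ite_sub_hasSum hs 0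
      simp only [pow_zero, Nat.factorial_zero, Nat.cast_one, div_one] at this
      rw [if_pos hn, mul_sub]
      refine this.congr_fun fun q => ?_
      simp [hn]
    · rw [if_neg hn, sub_zero]
      refine hs.congr_fun fun q => ?_
      simp [hn]
  · intro q
    simp_rw [hterm]
    exact (integrable_moment _ y).const_mul _
  · simp_rw [hterm, norm_mul (mcoef _ _ _), integral_const_mul, integral_norm_moment]
    refine Summable.of_nonneg_of_le (fun q => by positivity) (fun q => ?_)
      ((summable_norm_exp_series w).mul_left ‖X‖)
    have : ‖mcoef n Z (q + n, q)‖ * (‖Complex.exp (-(((n + q : ℕ) + 1) * y))‖ *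
        (n + q).factorial / 2) = ‖mcoef n Z (q + n, q) *
      (Complex.exp (-(((n + q : ℕ) + 1) * y)) * (n + q).factorial / 2)‖ := by
      rw [norm_mul, norm_div, norm_mul]; simp
    rw [this, hval]
    split_ifs
    · simp; positivity
    · rw [norm_mul]

/-- The Mellin transform of `angMode n`, by writing a power of `r` as an integral of Gaussians. -/
lemma integral_mellin_nat {s : ℂ} (hs : 0 < s.re) (hs1 : s.re < 1) (n : ℕ) (l : ℂ) :
    (∫ t : ℝ, Complex.exp (-s * t) * angMode n (Complex.exp l * Real.exp t)) *
      Complex.Gamma (1 + (s + n) / 2) =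
    Real.pi * (Complex.I * Complex.exp l / 2) ^ n * Complex.exp ((s - n) / 2 * logQuarter l) *
      -- The argument of this Gamma function comes from a second Euler integral, over the Gaussian
      -- scale `y`.
      Complex.Gamma ((n - s) / 2) := by
  -- With this `β` the power of `e^t` in `e^{-st} e^{β(y + 2t)}` is `n + 2`, free of `s`, as Weber's
  -- integral requires.
  set β : ℂ := 1 + (s + n) / 2
  have hβ : 0 < β.re := by simp [β]; positivity
  set κ : ℝ → ℂ := fun x => Complex.exp (β * x) * Complex.exp (-Real.exp x) with hκ
  set H : ℝ → ℂ := fun t => Complex.exp (-s * t) * angMode n (Complex.exp l * Real.exp t) with hH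
  have iκ : Integrable κ := integrable_exp_mul_exp_neg_exp hβ
  have iH : Integrable H := integrable_mellin_integrand hs hs1 n _
  have cκ : Continuous κ := by fun_prop
  have cH : Continuous H := continuous_mellin_integrand s n _
  have hint : Integrable (Function.uncurry fun t y => H t * κ (y + 2 * t))
      ((volume : Measure ℝ).prod volume) := by
    rw [integrable_prod_iff (Continuous.aestronglyMeasurable (by fun_prop))]
    refine ⟨ae_of_all _ fun t => ?_, ?_⟩
    · exact (iκ.comp_add_right (2 * t)).const_mul (H t)
    · simp only [Function.uncurry, norm_mul]
      have : ∀ t : ℝ, ∫ y, ‖H t‖ * ‖κ (y + 2 * t)‖ = ‖H t‖ * ∫ y, ‖κ y‖ := fun t => by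
        rw [integral_const_mul, integral_add_right_eq_self (fun y => ‖κ y‖)]
      simp_rw [this]
      exact iH.norm.mul_const _
  -- Integrating `H t * κ (y + 2t)` over `y` first gives the Mellin transform times `Γ(β)`;
  -- integrating over `t` first gives Weber's integral and then an Euler integral in `y`.
  have swap := integral_integral_swap hint
  have left : ∀ t, ∫ y, H t * κ (y + 2 * t) = H t * Complex.Gamma β := fun t => by
    rw [integral_const_mul, integral_add_right_eq_self κ, hκ, integral_exp_mul_exp_neg_exp hβ]
  set δ : ℂ := if n = 0 then 1 else 0 with hδ
  set b : ℂ := (n - s) / 2 with hb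
  have right : ∀ y : ℝ, ∫ t, H t * κ (y + 2 * t) =
      Real.pi * (Complex.I * Complex.exp l / 2) ^ n * Complex.exp ((s - n) / 2 * logQuarter l) *
        (Complex.exp (b * (logQuarter l - y : ℝ)) *
          (Complex.exp (-Real.exp (logQuarter l - y)) - δ)) := by
    intro y
    have e : ∀ t : ℝ, H t * κ (y + 2 * t) = Complex.exp (β * y) *
        (Complex.exp ((n + 2) * t) * Complex.exp (-Real.exp (y + 2 * t)) *
          angMode n (Complex.exp l * Real.exp t)) := by
      intro t
      have : Complex.exp (-s * t) * Complex.exp (β * (y + 2 * t : ℝ)) =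
          Complex.exp (β * y) * Complex.exp ((n + 2) * t) := by
        rw [← Complex.exp_add, ← Complex.exp_add]; congr 1; simp only [β]; push_cast; ring
      simp only [hH, hκ]
      linear_combination (angMode n (Complex.exp l * Real.exp t) *
        Complex.exp (-Real.exp (y + 2 * t))) * this
    simp_rw [e, integral_const_mul, integral_gauss_angMode]
    have : Complex.exp (β * y) * Complex.exp (-((n + 1) * y)) =
        Complex.exp ((s - n) / 2 * logQuarter l) * Complex.exp (b * (logQuarter l - y : ℝ)) := by
      rw [← Complex.exp_add, ← Complex.exp_add]; congr 1; simp only [β, b]; push_cast; ring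
    linear_combination (Real.pi * (Complex.I * Complex.exp l / 2) ^ n *
      (Complex.exp (-Real.exp (logQuarter l - y)) - δ)) * this
  simp_rw [left, right] at swap
  rw [integral_mul_const, integral_const_mul, integral_sub_left_eq_self (fun x : ℝ =>
    Complex.exp (b * x) * (Complex.exp (-Real.exp x) - δ))] at swap
  rw [swap]
  congr 1
  -- For `n = 0` the exponent `-s/2` has negative real part and the extended Euler integral applies;
  -- for `n ≥ 1` the real part is positive.
  by_cases hn : n = 0
  · simp only [hδ, hn, if_true]
    exact integral_exp_mul_exp_neg_exp_sub_one (by simp [hb, hn]; linarith)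
      (by simp [hb, hn]; linarith)
  · simp only [hδ, hn, if_false, sub_zero]
    refine integral_exp_mul_exp_neg_exp ?_
    have : (1 : ℝ) ≤ n := by exact_mod_cast Nat.one_le_iff_ne_zero.2 hn
    simp [hb]; linarith

/-! ### The Mellin transform in terms of reciprocal Gamma functions -/

/-- The Mellin transform of `angMode k` along the ray through `exp l`, continued analytically. -/
def mellinMode (s : ℂ) (k : ℤ) (l : ℂ) : ℂ :=
  Real.pi ^ 2 * Complex.I ^ k / Complex.sin (Real.pi * ((k - s) / 2)) *
    Complex.exp ((s + k) / 2 * (l - Real.log 2) + (s - k) / 2 * ((starRingEnd ℂ) l - Real.log 2)) *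
    ((Complex.Gamma (1 + (s - k) / 2))⁻¹ * (Complex.Gamma (1 + (s + k) / 2))⁻¹)

lemma mellinMode_neg_conj (s : ℂ) (k : ℤ) (l : ℂ) :
    mellinMode s (-k) ((starRingEnd ℂ) l) = mellinMode s k l := by
  have h1 : Complex.sin (Real.pi * (((-k : ℤ) - s) / 2)) =
      (-1) ^ k * Complex.sin (Real.pi * ((k - s) / 2)) := by
    have := Complex.sin_antiperiodic.sub_int_mul_eq (x := Real.pi * ((k - s) / 2)) k
    rw [Int.cast_negOnePow] at this
    rw [← this]; congr 1; push_cast; ring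
  have h2 : Complex.I ^ (-k) = (-1) ^ k * Complex.I ^ k := by
    rw [zpow_neg, ← inv_zpow, Complex.inv_I, ← mul_zpow]; simp
  have h3 : ((-1 : ℂ) ^ k) ≠ 0 := zpow_ne_zero _ (by norm_num)
  unfold mellinMode
  rw [h1, h2, Complex.conj_conj]
  have e1 : Real.pi ^ 2 * ((-1 : ℂ) ^ k * Complex.I ^ k) /
      ((-1) ^ k * Complex.sin (Real.pi * ((k - s) / 2))) =
      Real.pi ^ 2 * Complex.I ^ k / Complex.sin (Real.pi * ((k - s) / 2)) := by
    rw [mul_left_comm, mul_div_mul_left _ _ h3]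
  rw [e1]
  push_cast
  have e2 : (s + -(k : ℂ)) = s - k := by ring
  have e3 : (s - -(k : ℂ)) = s + k := by ring
  rw [e2, e3, mul_comm (Complex.Gamma (1 + (s + k) / 2))⁻¹, add_comm ((s - k) / 2 * _)]

lemma sin_pi_mul_ne_zero {z : ℂ} (h : ∀ n : ℤ, z ≠ n) : Complex.sin (Real.pi * z) ≠ 0 := by
  intro h0
  obtain ⟨n, hn⟩ := Complex.sin_eq_zero_iff.1 h0
  have hpi : (Real.pi : ℂ) ≠ 0 := by exact_mod_cast Real.pi_ne_zero
  refine h n (mul_left_cancel₀ hpi ?_)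
  rw [hn, mul_comm]

lemma sin_half_ne_zero {s : ℂ} (h : ∀ n : ℤ, s ≠ n) (k : ℤ) :
    Complex.sin (Real.pi * ((k - s) / 2)) ≠ 0 := by
  refine sin_pi_mul_ne_zero fun n hn => h (k - 2 * n) ?_
  push_cast
  linear_combination -2 * hn

/-- The reflection formula, used to trade the remaining Gamma factor for an entire reciprocal and a
sine, whose zeros account for all the poles in `s`. -/
lemma Gamma_eq_inv_sin {z : ℂ} (h : ∀ n : ℤ, z ≠ n) :
    Complex.Gamma z = Real.pi / Complex.sin (Real.pi * z) * (Complex.Gamma (1 - z))⁻¹ := by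
  have hs := sin_pi_mul_ne_zero h
  have hpi : (Real.pi : ℂ) ≠ 0 := by exact_mod_cast Real.pi_ne_zero
  have h1 := Complex.Gamma_mul_Gamma_one_sub z
  have h2 : Complex.Gamma (1 - z) ≠ 0 := by
    intro h0
    rw [h0, mul_zero, eq_comm, div_eq_zero_iff] at h1
    tauto
  rw [← h1]
  field_simp

lemma ne_intCast_of_re {s : ℂ} (hs : 0 < s.re) (hs1 : s.re < 1) (n : ℤ) : s ≠ n := by
  rintro rfl
  simp only [Complex.intCast_re] at hs hs1
  have h1 : 0 < n := by exact_mod_cast hs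
  have h2 : n < 1 := by exact_mod_cast hs1
  omega

lemma outerMode_nat_base {s : ℂ} (hs : 0 < s.re) (hs1 : s.re < 1) (n : ℕ) (l : ℂ) :
    ∫ t : ℝ, Complex.exp (-s * t) * angMode n (Complex.exp l * Real.exp t) = mellinMode s n l := by
  have hz : ∀ m : ℤ, ((n : ℂ) - s) / 2 ≠ m := by
    intro m hm
    refine ne_intCast_of_re hs hs1 (n - 2 * m) ?_
    push_cast
    linear_combination -2 * hm
  have h := integral_mellin_nat hs hs1 n l
  rw [Gamma_eq_inv_sin hz] at h
  have hG : Complex.Gamma (1 + (s + n) / 2) ≠ 0 :=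
    Complex.Gamma_ne_zero_of_re_pos (by simp; positivity)
  rw [← eq_div_iff hG] at h
  rw [h]
  unfold mellinMode
  have e1 : (Complex.I * Complex.exp l / 2) ^ n * Complex.exp ((s - n) / 2 * logQuarter l) =
      Complex.I ^ n * Complex.exp ((s + n) / 2 * (l - Real.log 2) +
        (s - n) / 2 * ((starRingEnd ℂ) l - Real.log 2)) := by
    have h2 : Complex.I * Complex.exp l / 2 = Complex.I * Complex.exp (l - Real.log 2) := by
      rw [Complex.exp_sub, ← Complex.ofReal_exp, Real.exp_log two_pos]
      push_cast; ring
    rw [h2, mul_pow, mul_assoc, ← Complex.exp_nat_mul, ← Complex.exp_add]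
    congr 2
    have := Complex.add_conj l
    push_cast at this
    simp only [logQuarter]
    push_cast
    linear_combination (-(s - n) / 2) * this
  have e2 : 1 - ((n : ℂ) - s) / 2 = 1 + (s - n) / 2 := by ring
  rw [e2]
  simp only [Int.cast_natCast, zpow_natCast]
  rw [div_eq_mul_inv _ (Complex.Gamma (1 + (s + n) / 2))]
  linear_combination (Real.pi * (Real.pi / Complex.sin (Real.pi * ((n - s) / 2)) *
    (Complex.Gamma (1 + (s - n) / 2))⁻¹) * (Complex.Gamma (1 + (s + n) / 2))⁻¹) * e1

lemma outerMode_eq_base {s : ℂ} (hs : 0 < s.re) (hs1 : s.re < 1) (k : ℤ) (l : ℂ) :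
    outerMode s k (Complex.exp l) = mellinMode s k l + poleSum s k (Complex.exp l) := by
  rw [outerMode_eq_of_re_lt_one hs hs1]
  congr 1
  obtain ⟨n, rfl | rfl⟩ := k.eq_nat_or_neg
  · exact outerMode_nat_base hs hs1 n l
  · rw [← mellinMode_neg_conj, neg_neg, ← outerMode_nat_base hs hs1]
    congr 1
    funext t
    rw [← angMode_conj, map_mul, Complex.conj_ofReal, Complex.exp_conj]

/-! ### Analytic continuation in `s` -/

/-- The right half-plane without the integers. -/
def puncturedHalfPlane : Set ℂ := {s | 0 < s.re ∧ ∀ n : ℤ, s ≠ n}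

lemma isOpen_puncturedHalfPlane : IsOpen puncturedHalfPlane := by
  have h1 : IsOpen {s : ℂ | 0 < s.re} := isOpen_lt continuous_const Complex.continuous_re
  have h2 := h1.inter (Complex.isClosed_range_intCast).isOpen_compl
  convert h2 using 1
  ext s
  simp only [puncturedHalfPlane, mem_ofPred_eq, mem_inter_iff, mem_compl_iff, mem_range, not_exists]
  refine and_congr_right fun _ => forall_congr' fun n => ?_
  exact ⟨fun h h2 => h h2.symm, fun h h2 => h h2.symm⟩

/-- The set is the union over `n` of the two open quarter-planes joined through the strip `n < Re s
< n + 1`. All these pieces contain `1 + i`. -/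
lemma isPreconnected_puncturedHalfPlane : IsPreconnected puncturedHalfPlane := by
  have cre : ∀ a : ℝ, Convex ℝ {s : ℂ | a < s.re} := fun a =>
    convex_halfSpace_re_gt a
  have cre' : ∀ a : ℝ, Convex ℝ {s : ℂ | s.re < a} := fun a => convex_halfSpace_re_lt a
  set A : Set ℂ := {s | 0 < s.re} ∩ {s | 0 < s.im}
  set B : Set ℂ := {s | 0 < s.re} ∩ {s | s.im < 0}
  set V : ℕ → Set ℂ := fun n => {s | (n : ℝ) < s.re} ∩ {s | s.re < n + 1}
  have hA : IsPreconnected A := ((cre 0).inter (convex_halfSpace_im_gt 0)).isPreconnected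
  have hB : IsPreconnected B := ((cre 0).inter (convex_halfSpace_im_lt 0)).isPreconnected
  have hV : ∀ n, IsPreconnected (V n) := fun n => ((cre n).inter (cre' (n + 1))).isPreconnected
  have hW : ∀ n, IsPreconnected (A ∪ V n ∪ B) := by
    intro n
    have hn : (0 : ℝ) ≤ n := n.cast_nonneg
    have h1 : IsPreconnected (A ∪ V n) := by
      refine hA.union' ⟨⟨n + 1 / 2, 1⟩, ⟨?_, ?_⟩, ?_, ?_⟩ (hV n)
      all_goals simp only [mem_ofPred_eq]
      all_goals linarith
    refine h1.union' ⟨⟨n + 1 / 2, -1⟩, Or.inr ⟨?_, ?_⟩, ?_, ?_⟩ hB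
    all_goals simp only [mem_ofPred_eq]
    all_goals linarith
  have hU : puncturedHalfPlane = ⋃ n, (A ∪ V n ∪ B) := by
    ext s
    simp only [puncturedHalfPlane, mem_ofPred_eq, mem_iUnion, mem_union, A, B, V, mem_inter_iff]
    constructor
    · rintro ⟨h0, h⟩
      rcases lt_trichotomy s.im 0 with him | him | him
      · exact ⟨0, Or.inr ⟨h0, him⟩⟩
      · refine ⟨⌊s.re⌋₊, Or.inl (Or.inr ⟨?_, Nat.lt_floor_add_one _⟩)⟩
        refine lt_of_le_of_ne (Nat.floor_le h0.le) fun he => h ⌊s.re⌋₊ ?_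
        apply Complex.ext
        · simpa using he.symm
        · simpa using him
      · exact ⟨0, Or.inl (Or.inl ⟨h0, him⟩)⟩
    · rintro ⟨n, (⟨h0, him⟩ | ⟨h1, h2⟩) | ⟨h0, him⟩⟩
      · refine ⟨h0, fun m hm => ?_⟩
        rw [hm] at him; simp at him
      · refine ⟨lt_of_le_of_lt n.cast_nonneg h1, fun m hm => ?_⟩
        rw [hm, Complex.intCast_re] at h1 h2
        have h3 : (n : ℤ) < m := by exact_mod_cast h1
        have h4 : m < (n : ℤ) + 1 := by exact_mod_cast h2
        omega
      · refine ⟨h0, fun m hm => ?_⟩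
        rw [hm] at him; simp at him
  rw [hU]
  refine isPreconnected_iUnion ⟨⟨1, 1⟩, mem_iInter.2 fun n => Or.inl (Or.inl ⟨?_, ?_⟩)⟩ hW
  all_goals simp

/-- The mode is bounded, so near `s₀` the derivative of the integrand is dominated by `t e^{-δt}`
with `δ = Re s₀ / 2`. -/
lemma differentiableAt_outerMode {s₀ : ℂ} (hs : 0 < s₀.re) (k : ℤ) (Z : ℂ) :
    DifferentiableAt ℂ (fun s => outerMode s k Z) s₀ := by
  set δ := s₀.re / 2 with hδ
  have hδ0 : 0 < δ := by positivity
  have hnb : {s : ℂ | δ < s.re} ∈ 𝓝 s₀ :=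
    (isOpen_lt continuous_const Complex.continuous_re).mem_nhds (by simp [hδ]; linarith)
  have cang := continuous_angMode k
  have hbi : IntegrableOn (fun t : ℝ => 2 * Real.pi * 2 * (t * Real.exp (-δ * t))) (Ioi 0) := by
    refine Integrable.const_mul ?_ _
    have := integrableOn_rpow_mul_exp_neg_mul_rpow (s := 1) (p := 1) (b := δ) (by norm_num)
      one_pos hδ0
    simpa [IntegrableOn] using this
  refine (hasDerivAt_integral_of_dominated_loc_of_deriv_le (μ := volume.restrict (Ioi (0 : ℝ)))
    (F := fun s t => Complex.exp (-s * t) * angMode k (Z * Real.exp t))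
    (F' := fun s t => Complex.exp (-s * t) * -t * angMode k (Z * Real.exp t))
    (bound := fun t => 2 * Real.pi * 2 * (t * Real.exp (-δ * t))) hnb
    (Eventually.of_forall fun s => (continuous_mellin_integrand s k Z).aestronglyMeasurable)
    (integrableOn_mellin_integrand hs k Z) (Continuous.aestronglyMeasurable (by fun_prop)) ?_ hbi
    ?_).2.differentiableAt
  · refine (ae_restrict_iff' measurableSet_Ioi).2 (ae_of_all _ fun t ht s hs => ?_)
    have ht : 0 < t := ht
    have hs : δ < s.re := hs
    rw [norm_mul, norm_mul, norm_cexp_mul_ofReal, norm_neg, Complex.norm_real,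
      Real.norm_of_nonneg ht.le, Complex.neg_re, mul_comm, mul_comm t]
    have : Real.exp (-s.re * t) ≤ Real.exp (-δ * t) := Real.exp_le_exp.2 (by nlinarith)
    have := norm_angMode_le k (Z * Real.exp t)
    gcongr
  · refine ae_of_all _ fun t s _ => ?_
    refine HasDerivAt.mul_const ?_ _
    simpa using ((hasDerivAt_id s).neg.mul_const (t : ℂ)).cexp

/-- Near a point off the integers all denominators are bounded below by one constant, so the series
converges uniformly there. -/
lemma differentiableAt_poleSum {s₀ : ℂ} (hs : ∀ n : ℤ, s₀ ≠ n) (k : ℤ) (Z : ℂ) :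
    DifferentiableAt ℂ (fun s => poleSum s k Z) s₀ := by
  obtain ⟨δ, hδ, hball⟩ := Metric.isOpen_iff.1 (Complex.isClosed_range_intCast).isOpen_compl s₀
    (by rintro ⟨n, hn⟩; exact hs n hn.symm)
  have hd : ∀ s ∈ Metric.ball s₀ (δ / 2), ∀ n : ℕ, δ / 2 ≤ ‖s - n‖ := by
    intro s hsb n
    by_contra! h
    have h1 : (n : ℂ) ∈ Metric.ball s₀ δ := by
      rw [Metric.mem_ball] at hsb ⊢
      have := dist_triangle (n : ℂ) s s₀
      rw [dist_comm (n : ℂ) s, dist_eq_norm s (n : ℂ)] at this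
      linarith
    exact hball h1 ⟨n, by simp⟩
  have := Complex.differentiableOn_tsum_of_summable_norm
    (F := fun (p : ℕ × ℕ) (s : ℂ) => mcoef k Z p / (s - ((p.1 + p.2 : ℕ) : ℂ)))
    (u := fun p => ‖mcoef k Z p‖ * (δ / 2)⁻¹) (U := Metric.ball s₀ (δ / 2)) ((summable_norm_mcoef k Z).mul_right _)
    (fun p s hsb => ?_) Metric.isOpen_ball (fun p s hsb => ?_)
  · exact this.differentiableAt (Metric.ball_mem_nhds _ (by positivity))
  · have hne : s - ((p.1 + p.2 : ℕ) : ℂ) ≠ 0 := by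
      rw [← norm_pos_iff]; linarith [hd s hsb (p.1 + p.2)]
    have h1 : DifferentiableAt ℂ (fun s : ℂ => s - ((p.1 + p.2 : ℕ) : ℂ)) s := by fun_prop
    exact ((differentiableAt_const (mcoef k Z p)).div h1 hne).differentiableWithinAt
  · rw [norm_div, div_eq_mul_inv]
    gcongr
    exact hd s hsb _

lemma differentiable_inv_Gamma_comp {f : ℂ → ℂ} (hf : Differentiable ℂ f) :
    Differentiable ℂ fun s => (Complex.Gamma (f s))⁻¹ :=
  Complex.differentiable_one_div_Gamma.comp hf

lemma differentiableAt_mellinMode {s : ℂ} (hs : ∀ n : ℤ, s ≠ n) (k : ℤ) (l : ℂ) :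
    DifferentiableAt ℂ (fun s => mellinMode s k l) s := by
  unfold mellinMode
  have h1 : DifferentiableAt ℂ (fun s : ℂ => (Complex.Gamma (1 + (s - k) / 2))⁻¹) s :=
    (differentiable_inv_Gamma_comp (by fun_prop)) s
  have h2 : DifferentiableAt ℂ (fun s : ℂ => (Complex.Gamma (1 + (s + k) / 2))⁻¹) s :=
    (differentiable_inv_Gamma_comp (by fun_prop)) s
  refine DifferentiableAt.mul (DifferentiableAt.mul ?_ (by fun_prop)) (h1.mul h2)
  exact DifferentiableAt.div (by fun_prop)
    (Complex.differentiable_sin.comp (by fun_prop) s) (sin_half_ne_zero hs k)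

/-- The incomplete Mellin transform is the complete one plus the sum over the poles. -/
theorem outerMode_eq {s : ℂ} (hs : 0 < s.re) (hsn : ∀ n : ℤ, s ≠ n) (k : ℤ) (l : ℂ) :
    outerMode s k (Complex.exp l) = mellinMode s k l + poleSum s k (Complex.exp l) := by
  have hop := isOpen_puncturedHalfPlane
  have h1 : AnalyticOnNhd ℂ (fun s => outerMode s k (Complex.exp l)) puncturedHalfPlane :=
    DifferentiableOn.analyticOnNhd
      (fun z hz => (differentiableAt_outerMode hz.1 k _).differentiableWithinAt) hop
  have h2 : AnalyticOnNhd ℂ (fun s => mellinMode s k l + poleSum s k (Complex.exp l))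
      puncturedHalfPlane :=
    DifferentiableOn.analyticOnNhd (fun z hz => ((differentiableAt_mellinMode hz.2 k l).add
      (differentiableAt_poleSum hz.2 k _)).differentiableWithinAt) hop
  have hz : (1 / 2 : ℂ) ∈ puncturedHalfPlane :=
    ⟨by norm_num, ne_intCast_of_re (by norm_num) (by norm_num)⟩
  -- Identity theorem: both sides agree near `1/2`, where the complete Mellin integral converges.
  refine h1.eqOn_of_preconnected_of_eventuallyEq h2 isPreconnected_puncturedHalfPlane hz ?_ ⟨hs, hsn⟩
  have ho : IsOpen {s : ℂ | 0 < s.re ∧ s.re < 1} :=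
    (isOpen_lt continuous_const Complex.continuous_re).inter
      (isOpen_lt Complex.continuous_re continuous_const)
  filter_upwards [ho.mem_nhds (show (1 / 2 : ℂ) ∈ _ from ⟨by norm_num, by norm_num⟩)] with s h
  exact outerMode_eq_base h.1 h.2 k l

/-! ### The absolutely convergent kernel integral -/

/-- The measure `dt dω` on the parameters of `w = exp (t + iω)`. -/
abbrev ann : Measure (ℝ × ℝ) := (volume : Measure ℝ).prod circ

/-- `exp (t + iω)`. -/
def wexp (p : ℝ × ℝ) : ℂ := Complex.exp (p.1 + p.2 * Complex.I)

/-- The character `|w|^{2μ} (w/|w|)^{2d}` at `w = exp (t + iω)`. -/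
def chi (μ : ℂ) (d : ℤ) (p : ℝ × ℝ) : ℂ := Complex.exp (2 * μ * p.1 + 2 * d * p.2 * Complex.I)

/-- `phase (Z w) * phase (Z / w)` at `w = exp (t + iω)`. -/
def phasePair (Z : ℂ) (p : ℝ × ℝ) : ℂ := phase (Z * wexp p) * phase (Z * wexp (-p))

lemma continuous_wexp : Continuous wexp := by unfold wexp; fun_prop

lemma continuous_chi (μ : ℂ) (d : ℤ) : Continuous (chi μ d) := by unfold chi; fun_prop

lemma continuous_phasePair (Z : ℂ) : Continuous (phasePair Z) :=
  (continuous_phase.comp (continuous_const.mul continuous_wexp)).mul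
    (continuous_phase.comp (continuous_const.mul (continuous_wexp.comp continuous_neg)))

lemma norm_wexp (p : ℝ × ℝ) : ‖wexp p‖ = Real.exp p.1 := by
  simp [wexp, Complex.norm_exp]

lemma wexp_ne_zero (p : ℝ × ℝ) : wexp p ≠ 0 := Complex.exp_ne_zero _

lemma wexp_neg (p : ℝ × ℝ) : wexp (-p) = (wexp p)⁻¹ := by
  rw [wexp, wexp, ← Complex.exp_neg]
  congr 1
  simp only [Prod.fst_neg, Prod.snd_neg, Complex.ofReal_neg]
  ring

lemma norm_chi (μ : ℂ) (d : ℤ) (p : ℝ × ℝ) : ‖chi μ d p‖ = Real.exp (2 * μ.re * p.1) := by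
  simp [chi, Complex.norm_exp]

lemma norm_chi_le (μ : ℂ) (d : ℤ) (p : ℝ × ℝ) :
    ‖chi μ d p‖ ≤ Real.exp (2 * |μ.re| * |p.1|) := by
  rw [norm_chi, Real.exp_le_exp, mul_assoc, mul_assoc, ← abs_mul]
  linarith [le_abs_self (μ.re * p.1)]

/-- Bound the phase of the larger argument by 2 and that of the smaller one by its modulus. The
resulting decay is what makes `|Re μ| < 1/2` the natural condition. -/
lemma norm_phasePair_le (Z : ℂ) (p : ℝ × ℝ) :
    ‖phasePair Z p‖ ≤ 2 * ‖Z‖ * Real.exp (-|p.1|) := by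
  rw [phasePair, norm_mul]
  rcases le_total 0 p.1 with h | h
  · rw [abs_of_nonneg h]
    have h1 := norm_phase_le_two (Z * wexp p)
    have h2 := norm_phase_le (Z * wexp (-p))
    rw [norm_mul, norm_wexp] at h2
    calc _ ≤ 2 * (‖Z‖ * Real.exp (-p.1)) := by gcongr; exact h2
      _ = _ := by ring
  · rw [abs_of_nonpos h, neg_neg]
    have h1 := norm_phase_le_two (Z * wexp (-p))
    have h2 := norm_phase_le (Z * wexp p)
    rw [norm_mul, norm_wexp] at h2
    calc _ ≤ (‖Z‖ * Real.exp p.1) * 2 := by gcongr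
      _ = _ := by ring

lemma integrable_exp_neg_mul_abs {c : ℝ} (hc : 0 < c) : Integrable fun t : ℝ => Real.exp (-c * |t|) := by
  refine integrable_of_norm_le_exp (C := 1) (a := c) (b := c)
    (Continuous.aestronglyMeasurable (by fun_prop)) hc hc ?_ ?_
  · intro t ht; rw [abs_of_nonpos ht, Real.norm_of_nonneg (Real.exp_pos _).le]; simp
  · intro t ht; rw [abs_of_pos ht, Real.norm_of_nonneg (Real.exp_pos _).le]; simp

lemma integrable_ann_comp_fst {f : ℝ → ℝ} (hf : Integrable f) :
    Integrable (fun p : ℝ × ℝ => f p.1) ann := by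
  simpa using hf.mul_prod (integrable_const (μ := circ) (1 : ℝ))

lemma integrable_ann_exp {c : ℝ} (hc : 0 < c) :
    Integrable (fun p : ℝ × ℝ => Real.exp (-c * |p.1|)) ann :=
  integrable_ann_comp_fst (integrable_exp_neg_mul_abs hc)

lemma norm_chi_mul_phasePair_le (μ : ℂ) (d : ℤ) (Z : ℂ) (p : ℝ × ℝ) :
    ‖chi μ d p * phasePair Z p‖ ≤ 2 * ‖Z‖ * Real.exp (-(1 - 2 * |μ.re|) * |p.1|) := by
  rw [norm_mul]
  calc _ ≤ Real.exp (2 * |μ.re| * |p.1|) * (2 * ‖Z‖ * Real.exp (-|p.1|)) := by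
        gcongr
        · exact norm_chi_le _ _ _
        · exact norm_phasePair_le _ _
    _ = 2 * ‖Z‖ * (Real.exp (2 * |μ.re| * |p.1|) * Real.exp (-|p.1|)) := by ring
    _ = _ := by rw [← Real.exp_add]; ring_nf

lemma integrable_chi_mul_phasePair {μ : ℂ} (hμ : |μ.re| < 1 / 2) (d : ℤ) (Z : ℂ) :
    Integrable (fun p => chi μ d p * phasePair Z p) ann := by
  refine Integrable.mono' ((integrable_ann_exp (c := 1 - 2 * |μ.re|) (by linarith)).const_mul
    (2 * ‖Z‖)) ?_ (ae_of_all _ (norm_chi_mul_phasePair_le μ d Z))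
  exact ((continuous_chi μ d).mul (continuous_phasePair Z)).aestronglyMeasurable

/-- The integral representing the regularized Bessel function, up to the factor `π²`. -/
def kernelInt (μ : ℂ) (d : ℤ) (Z : ℂ) : ℂ := ∫ p, chi μ d p * phasePair Z p ∂ann

lemma integral_circ_comp_neg {E : Type*} [NormedAddCommGroup E] [NormedSpace ℝ E] {f : ℝ → E}
    (hf : Function.Periodic f (2 * Real.pi)) : ∫ ω, f (-ω) ∂circ = ∫ ω, f ω ∂circ := by
  have h2 : (0 : ℝ) ≤ 2 * Real.pi := by positivity
  rw [← intervalIntegral.integral_of_le h2, ← intervalIntegral.integral_of_le h2,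
    intervalIntegral.integral_comp_neg, neg_zero]
  have := hf.intervalIntegral_add_eq (-(2 * Real.pi)) 0
  simpa using this

/-- The part of `kernelInt` over the disc `‖w‖ < 1`. -/
def halfInt (μ : ℂ) (d : ℤ) (Z : ℂ) : ℂ :=
  ∫ t in Ioi (0 : ℝ), ∫ ω, chi μ d (-t, ω) * phasePair Z (-t, ω) ∂circ

/-- The substitution `w ↦ 1/w` preserves the pair of phases and inverts the character, so the part
over `|w| > 1` is the inner part with `(-μ, -d)`. -/
lemma kernelInt_eq_add {μ : ℂ} (hμ : |μ.re| < 1 / 2) (d : ℤ) (Z : ℂ) :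
    kernelInt μ d Z = halfInt μ d Z + halfInt (-μ) (-d) Z := by
  have hi := integrable_chi_mul_phasePair hμ d Z
  have hl := hi.integral_prod_left
  unfold kernelInt
  rw [integral_prod _ hi, ← intervalIntegral.integral_Iic_add_Ioi hl.integrableOn hl.integrableOn
    (b := 0)]
  congr 1
  · unfold halfInt
    have := integral_comp_neg_Iic (0 : ℝ)
      (fun t => ∫ ω, chi μ d (-t, ω) * phasePair Z (-t, ω) ∂circ)
    simpa using this
  · unfold halfInt
    refine setIntegral_congr_fun measurableSet_Ioi fun t _ => ?_
    have hper : Function.Periodic (fun ω => chi μ d (t, ω) * phasePair Z (t, ω)) (2 * Real.pi) := by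
      intro ω
      have h1 : chi μ d (t, ω + 2 * Real.pi) = chi μ d (t, ω) := by
        unfold chi
        rw [Complex.exp_eq_exp_iff_exists_int]
        exact ⟨2 * d, by push_cast; ring⟩
      have h2 : wexp (t, ω + 2 * Real.pi) = wexp (t, ω) := by
        unfold wexp
        rw [Complex.exp_eq_exp_iff_exists_int]
        exact ⟨1, by push_cast; ring⟩
      simp only [h1, phasePair, wexp_neg, h2]
    rw [← integral_circ_comp_neg hper]
    congr 1
    funext ω
    have h1 : chi μ d (t, -ω) = chi (-μ) (-d) (-t, ω) := by
      unfold chi; congr 1; push_cast; ring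
    simp only [h1, phasePair, Prod.neg_mk, neg_neg]
    ring

/-! ### Expansion of the half integrals into incomplete Mellin transforms -/

/-- The terms of the double power series of `phase Z`. -/
def cterm (Z : ℂ) (p : ℕ × ℕ) : ℂ := coef p * (Z ^ p.1 * (starRingEnd ℂ) Z ^ p.2)

lemma cterm_zero (Z : ℂ) : cterm Z 0 = 0 := by simp [cterm, coef_zero]

lemma norm_cterm (Z : ℂ) (p : ℕ × ℕ) : ‖cterm Z p‖ = ‖coef p‖ * ‖Z‖ ^ (p.1 + p.2) := by
  rw [cterm, norm_mul, norm_mul, norm_pow, norm_pow, RCLike.norm_conj, pow_add]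

lemma summable_norm_cterm (Z : ℂ) : Summable fun p => ‖cterm Z p‖ := by
  simp_rw [norm_cterm]; exact summable_norm_coef _

lemma cterm_mul_wexp (Z : ℂ) (t ω : ℝ) (p : ℕ × ℕ) : cterm (Z * wexp (-t, ω)) p =
    cterm Z p * (Complex.exp (-((p.1 + p.2 : ℕ) : ℂ) * t) *
      Complex.exp ((((p.1 : ℤ) - p.2 : ℤ) : ℂ) * ω * Complex.I)) := by
  have e : Complex.exp (-((p.1 + p.2 : ℕ) : ℂ) * t) *
      Complex.exp ((((p.1 : ℤ) - p.2 : ℤ) : ℂ) * ω * Complex.I) =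
      wexp (-t, ω) ^ p.1 * (starRingEnd ℂ) (wexp (-t, ω)) ^ p.2 := by
    rw [wexp, ← Complex.exp_conj, ← Complex.exp_nat_mul, ← Complex.exp_nat_mul, ← Complex.exp_add,
      ← Complex.exp_add]
    congr 1
    simp
    ring
  rw [e, cterm, cterm, map_mul, mul_pow, mul_pow]
  ring

/-- Only the phase of the small argument `Zw` is expanded; the other is left intact. A monomial
shifts the angular frequency `2d` by `p.1 - p.2`. -/
lemma hasSum_halfInt_inner (d : ℤ) (Z : ℂ) (t : ℝ) :
    HasSum (fun p : ℕ × ℕ => cterm Z p * (Complex.exp (-((p.1 + p.2 : ℕ) : ℂ) * t) *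
      angMode (2 * d + (p.1 - p.2)) (Z * Real.exp t)))
    (∫ ω : ℝ, Complex.exp (2 * d * ω * Complex.I) * phasePair Z (-t, ω) ∂circ) := by
  have cph := continuous_phase
  have hw : ∀ ω : ℝ, Z * wexp (-(-t, ω)) =
      Z * Real.exp t * Complex.exp (-(ω : ℝ) * Complex.I) := by
    intro ω
    rw [mul_assoc, wexp, Complex.ofReal_exp, ← Complex.exp_add]
    simp
  have hterm : ∀ (p : ℕ × ℕ) (ω : ℝ), Complex.exp (2 * d * ω * Complex.I) *
      (cterm (Z * wexp (-t, ω)) p * phase (Z * wexp (-(-t, ω)))) =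
      cterm Z p * Complex.exp (-((p.1 + p.2 : ℕ) : ℂ) * t) *
        (Complex.exp (((2 * d + (p.1 - p.2) : ℤ) : ℂ) * ω * Complex.I) *
          phase (Z * Real.exp t * Complex.exp (-(ω : ℝ) * Complex.I))) := by
    intro p ω
    have e : Complex.exp (((2 * d + (p.1 - p.2) : ℤ) : ℂ) * ω * Complex.I) =
        Complex.exp (2 * d * ω * Complex.I) *
          Complex.exp ((((p.1 : ℤ) - p.2 : ℤ) : ℂ) * ω * Complex.I) := by
      rw [← Complex.exp_add]; congr 1; push_cast; ring
    rw [cterm_mul_wexp, hw, e]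
    ring
  have key := hasSum_integral_of_summable_integral_norm (μ := circ)
    (F := fun (p : ℕ × ℕ) (ω : ℝ) => Complex.exp (2 * d * ω * Complex.I) *
      (cterm (Z * wexp (-t, ω)) p * phase (Z * wexp (-(-t, ω))))) ?_ ?_
  · have e : ∀ ω : ℝ, ∑' p, Complex.exp (2 * d * ω * Complex.I) *
        (cterm (Z * wexp (-t, ω)) p * phase (Z * wexp (-(-t, ω)))) =
        Complex.exp (2 * d * ω * Complex.I) * phasePair Z (-t, ω) := fun ω => by
      rw [tsum_mul_left, tsum_mul_right, phasePair]
      unfold cterm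
      rw [(hasSum_phase _).tsum_eq]
    simp_rw [e, hterm, integral_const_mul] at key
    refine key.congr_fun fun p => ?_
    rw [angMode, mul_assoc]
  · intro p
    simp_rw [hterm]
    exact Continuous.integrableOn_Ioc (by fun_prop)
  · refine Summable.of_nonneg_of_le (fun p => integral_nonneg fun _ => norm_nonneg _) (fun p => ?_)
      ((summable_norm_cterm (Z * wexp (-t, 0))).mul_right (2 * (2 * Real.pi)))
    have hb : ∀ ω : ℝ, ‖Complex.exp (2 * d * ω * Complex.I) *
        (cterm (Z * wexp (-t, ω)) p * phase (Z * wexp (-(-t, ω))))‖ ≤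
        ‖cterm (Z * wexp (-t, 0)) p‖ * 2 := by
      intro ω
      have e : Complex.exp (2 * d * ω * Complex.I) =
          Complex.exp ((2 * d : ℤ) * (ω : ℂ) * Complex.I) := by push_cast; rfl
      rw [norm_mul, e, norm_exp_int_mul, one_mul, norm_mul, norm_cterm, norm_cterm, norm_mul,
        norm_mul, norm_wexp, norm_wexp]
      gcongr
      exact norm_phase_le_two _
    refine (integral_mono_of_nonneg (ae_of_all _ fun _ => norm_nonneg _) (integrable_const _)
      (ae_of_all _ hb)).trans ?_
    rw [integral_const, circ_real_univ, smul_eq_mul]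
    exact le_of_eq (by ring)

lemma re_pos_of_ne_zero {μ : ℂ} {p : ℕ × ℕ} (hp : p ≠ 0) :
    1 - 2 * |μ.re| ≤ (2 * μ + ((p.1 + p.2 : ℕ) : ℂ)).re := by
  have : 1 ≤ p.1 + p.2 := by
    by_contra h
    exact hp (Prod.ext (by simp; omega) (by simp; omega))
  have h2 : (1 : ℝ) ≤ ((p.1 + p.2 : ℕ) : ℝ) := by exact_mod_cast this
  have h3 : (2 * μ + ((p.1 + p.2 : ℕ) : ℂ)).re = 2 * μ.re + ((p.1 + p.2 : ℕ) : ℝ) := by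
    simp
  rw [h3]
  linarith [neg_abs_le μ.re]

/-- The monomial of degree `p.1 + p.2` moves the Mellin variable from `2μ` to `2μ + p.1 + p.2`. As
the term `p = 0` is absent, the real part stays at least `1 - 2|Re μ|`, uniformly positive, which
permits termwise integration. -/
lemma hasSum_halfInt {μ : ℂ} (hμ : |μ.re| < 1 / 2) (d : ℤ) (Z : ℂ) :
    HasSum (fun p : ℕ × ℕ => cterm Z p *
      outerMode (2 * μ + ((p.1 + p.2 : ℕ) : ℂ)) (2 * d + (p.1 - p.2)) Z) (halfInt μ d Z) := by
  have hterm : ∀ (p : ℕ × ℕ) (t : ℝ), Complex.exp (-(2 * μ) * t) * (cterm Z p *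
      (Complex.exp (-((p.1 + p.2 : ℕ) : ℂ) * t) *
        angMode (2 * d + (p.1 - p.2)) (Z * Real.exp t))) =
      cterm Z p * (Complex.exp (-(2 * μ + ((p.1 + p.2 : ℕ) : ℂ)) * t) *
        angMode (2 * d + (p.1 - p.2)) (Z * Real.exp t)) := by
    intro p t
    have : Complex.exp (-(2 * μ + ((p.1 + p.2 : ℕ) : ℂ)) * t) =
        Complex.exp (-(2 * μ) * t) * Complex.exp (-((p.1 + p.2 : ℕ) : ℂ) * t) := by
      rw [← Complex.exp_add]; congr 1; ring
    rw [this]; ring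
  have key := hasSum_integral_of_summable_integral_norm (μ := volume.restrict (Ioi (0 : ℝ)))
    (F := fun (p : ℕ × ℕ) (t : ℝ) => Complex.exp (-(2 * μ) * t) * (cterm Z p *
      (Complex.exp (-((p.1 + p.2 : ℕ) : ℂ) * t) *
        angMode (2 * d + (p.1 - p.2)) (Z * Real.exp t)))) ?_ ?_
  · have e : ∀ t : ℝ, ∑' p : ℕ × ℕ, Complex.exp (-(2 * μ) * t) * (cterm Z p *
        (Complex.exp (-((p.1 + p.2 : ℕ) : ℂ) * t) *
          angMode (2 * d + (p.1 - p.2)) (Z * Real.exp t))) =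
        ∫ ω, chi μ d (-t, ω) * phasePair Z (-t, ω) ∂circ := by
      intro t
      rw [tsum_mul_left, (hasSum_halfInt_inner d Z t).tsum_eq, ← integral_const_mul]
      congr 1
      funext ω
      rw [← mul_assoc, ← Complex.exp_add]
      congr 2
      push_cast
      ring
    simp_rw [e, hterm, integral_const_mul] at key
    exact key
  · intro p
    simp_rw [hterm]
    by_cases hp : p = 0
    · simp [hp, cterm_zero]
    · exact (integrableOn_mellin_integrand (by linarith [re_pos_of_ne_zero (μ := μ) hp]) _ _).const_mul _
  · simp_rw [hterm]
    refine Summable.of_nonneg_of_le (fun p => integral_nonneg fun _ => norm_nonneg _) (fun p => ?_)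
      ((summable_norm_cterm Z).mul_right (2 * Real.pi * 2 * (1 - 2 * |μ.re|)⁻¹))
    by_cases hp : p = 0
    · simp [hp, cterm_zero]
    · have h1 := re_pos_of_ne_zero (μ := μ) hp
      set s := 2 * μ + ((p.1 + p.2 : ℕ) : ℂ)
      have h2 : 0 < s.re := by linarith
      simp_rw [norm_mul (cterm Z p)]
      rw [integral_const_mul]
      gcongr
      calc ∫ t in Ioi (0 : ℝ), ‖Complex.exp (-s * t) * angMode (2 * d + (p.1 - p.2))
            (Z * Real.exp t)‖ ≤ ∫ t in Ioi (0 : ℝ), 2 * Real.pi * 2 * Real.exp (-s.re * t) := by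
            refine integral_mono_of_nonneg (ae_of_all _ fun _ => norm_nonneg _) ?_
              (ae_of_all _ fun t => norm_mellin_integrand_le s _ Z t)
            exact (integrableOn_exp_mul_Ioi (a := -s.re) (by linarith) 0).const_mul _
        _ = 2 * Real.pi * 2 * s.re⁻¹ := by
            rw [integral_const_mul, integral_exp_mul_Ioi (by linarith)]
            simp
        _ ≤ _ := by
            gcongr
            linarith

/-! ### The double series over the poles and its antisymmetry -/

lemma exists_pos_le_norm_sub_int {s : ℂ} (hs : ∀ n : ℤ, s ≠ n) :
    ∃ δ : ℝ, 0 < δ ∧ ∀ n : ℤ, δ ≤ ‖s - n‖ := by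
  obtain ⟨δ, hδ, hball⟩ := Metric.isOpen_iff.1 (Complex.isClosed_range_intCast).isOpen_compl s
    (by rintro ⟨n, hn⟩; exact hs n hn.symm)
  refine ⟨δ, hδ, fun n => ?_⟩
  by_contra! h
  refine hball (a := (n : ℂ)) ?_ ⟨n, rfl⟩
  rw [Metric.mem_ball, dist_comm, dist_eq_norm]
  exact h

/-- The terms of the sum over the poles in the expansion of `halfInt`. -/
def poleTerm (μ : ℂ) (d : ℤ) (Z : ℂ) (x : (ℕ × ℕ) × (ℕ × ℕ)) : ℂ :=
  cterm Z x.1 * (mcoef (2 * d + (x.1.1 - x.1.2)) Z x.2 /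
    (2 * μ + ((x.1.1 + x.1.2 : ℕ) : ℂ) - ((x.2.1 + x.2.2 : ℕ) : ℂ)))

/-- Exchanging the two pairs of exponents preserves the coefficients and the frequency constraint,
while the denominator changes sign. This is why the pole contributions of the two halves cancel. -/
lemma poleTerm_swap (μ : ℂ) (d : ℤ) (Z : ℂ) (x : (ℕ × ℕ) × (ℕ × ℕ)) :
    poleTerm (-μ) (-d) Z x.swap = -poleTerm μ d Z x := by
  obtain ⟨p, q⟩ := x
  simp only [poleTerm, mcoef, Prod.swap_prod_mk]
  have h1 : (2 * -d + ((q.1 : ℤ) - q.2) - ((p.1 : ℤ) - p.2) = 0) =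
      (2 * d + ((p.1 : ℤ) - p.2) - ((q.1 : ℤ) - q.2) = 0) := by
    apply propext; constructor <;> intro h <;> linarith
  have h2 : 2 * -μ + ((q.1 + q.2 : ℕ) : ℂ) - ((p.1 + p.2 : ℕ) : ℂ) =
      -(2 * μ + ((p.1 + p.2 : ℕ) : ℂ) - ((q.1 + q.2 : ℕ) : ℂ)) := by ring
  simp only [h1, h2, div_neg, cterm]
  ring

lemma two_mul_ne_int {μ : ℂ} (hμ : |μ.re| < 1 / 2) (h0 : μ ≠ 0) (n : ℤ) : 2 * μ ≠ n := by
  intro h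
  have hre : 2 * μ.re = n := by simpa using congrArg Complex.re h
  have h1 := abs_lt.1 hμ
  have h2 : (n : ℝ) < 1 := by linarith
  have h3 : (-1 : ℝ) < n := by linarith
  have h4 : n < 1 := by exact_mod_cast h2
  have h5 : -1 < n := by exact_mod_cast h3
  have : n = 0 := by omega
  rw [this] at h
  simp at h
  exact h0 h

/-- The denominators are `2μ` minus integers, hence bounded below. Absolute convergence is needed
because the antisymmetry rearranges the double series. -/
lemma summable_poleTerm {μ : ℂ} (hμ : ∀ n : ℤ, 2 * μ ≠ n) (d : ℤ) (Z : ℂ) :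
    Summable (poleTerm μ d Z) := by
  obtain ⟨δ, hδ, h⟩ := exists_pos_le_norm_sub_int hμ
  have hs := (summable_norm_cterm Z).mul_of_nonneg ((summable_norm_cterm Z).mul_right
    (2 * Real.pi * δ⁻¹)) (fun _ => norm_nonneg _) (fun _ => by positivity)
  refine Summable.of_norm_bounded hs fun x => ?_
  rw [poleTerm, norm_mul, norm_div, div_eq_mul_inv]
  have h1 : ‖mcoef (2 * d + (x.1.1 - x.1.2)) Z x.2‖ ≤ ‖cterm Z x.2‖ * (2 * Real.pi) := by
    rw [norm_cterm, mul_comm _ (2 * Real.pi)]; exact norm_mcoef_le _ _ _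
  have h2 : δ ≤ ‖2 * μ + ((x.1.1 + x.1.2 : ℕ) : ℂ) - ((x.2.1 + x.2.2 : ℕ) : ℂ)‖ := by
    convert h ((x.2.1 + x.2.2 : ℕ) - (x.1.1 + x.1.2 : ℕ)) using 2
    push_cast; ring
  calc _ ≤ ‖cterm Z x.1‖ * (‖cterm Z x.2‖ * (2 * Real.pi) * δ⁻¹) := by gcongr
    _ = _ := by ring

lemma tsum_poleTerm_neg (μ : ℂ) (d : ℤ) (Z : ℂ) :
    ∑' x, poleTerm (-μ) (-d) Z x = -∑' x, poleTerm μ d Z x := by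
  rw [← (Equiv.prodComm (ℕ × ℕ) (ℕ × ℕ)).tsum_eq, ← tsum_neg]
  exact tsum_congr fun x => poleTerm_swap μ d Z x

lemma hasSum_poleSum {μ : ℂ} (hμ : ∀ n : ℤ, 2 * μ ≠ n) (d : ℤ) (Z : ℂ) :
    HasSum (fun p : ℕ × ℕ => cterm Z p *
      poleSum (2 * μ + ((p.1 + p.2 : ℕ) : ℂ)) (2 * d + (p.1 - p.2)) Z)
      (∑' x, poleTerm μ d Z x) := by
  have hs := summable_poleTerm hμ d Z
  refine (hs.hasSum.prod_fiberwise fun p => (hs.prod_factor p).hasSum).congr_fun fun p => ?_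
  simp only [poleTerm, tsum_mul_left, poleSum]

/-! ### Identification with Bessel products; the integral representation -/

/-- The summands of `besselJ`. -/
def besselTerm (ν l : ℂ) (n : ℕ) : ℂ :=
  (-1) ^ n / (n.factorial : ℂ) * (Complex.Gamma (ν + n + 1))⁻¹ *
    Complex.exp ((ν + 2 * n) * (l - Real.log 2))

/-- Ratio test; for nonintegral `ν` no reciprocal Gamma value vanishes, so the ratios are defined.
-/
lemma summable_norm_besselTerm {ν : ℂ} (hν : ∀ n : ℤ, ν ≠ n) (l : ℂ) :
    Summable fun n => ‖besselTerm ν l n‖ := by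
  have hadd : ∀ n : ℕ, ν + n + 1 ≠ 0 := fun n h => hν (-(n + 1)) (by
    push_cast; linear_combination h)
  have hG : ∀ n : ℕ, Complex.Gamma (ν + n + 1) ≠ 0 := fun n =>
    Complex.Gamma_ne_zero fun m h => hν (-(m + n + 1)) (by push_cast; linear_combination h)
  have hne : ∀ n, ‖besselTerm ν l n‖ ≠ 0 := fun n => by
    rw [norm_ne_zero_iff, besselTerm]
    have : (n.factorial : ℂ) ≠ 0 := by exact_mod_cast n.factorial_ne_zero
    have h1 : ((-1 : ℂ) ^ n) ≠ 0 := pow_ne_zero _ (by norm_num)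
    exact mul_ne_zero (mul_ne_zero (div_ne_zero h1 this) (inv_ne_zero (hG n))) (Complex.exp_ne_zero _)
  have hratio : ∀ n : ℕ, besselTerm ν l (n + 1) =
      besselTerm ν l n * (-Complex.exp (2 * (l - Real.log 2)) / ((n + 1) * (ν + n + 1))) := by
    intro n
    have e1 : Complex.Gamma (ν + (n + 1 : ℕ) + 1) =
        (ν + n + 1) * Complex.Gamma (ν + n + 1) := by
      rw [← Complex.Gamma_add_one _ (hadd n)]; congr 1; push_cast; ring
    have e2 : Complex.exp ((ν + 2 * (n + 1 : ℕ)) * (l - Real.log 2)) =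
        Complex.exp ((ν + 2 * n) * (l - Real.log 2)) * Complex.exp (2 * (l - Real.log 2)) := by
      rw [← Complex.exp_add]; congr 1; push_cast; ring
    have h1 := hadd n
    have h2 := hG n
    have h3 : (n.factorial : ℂ) ≠ 0 := by exact_mod_cast n.factorial_ne_zero
    have h4 : (n + 1 : ℂ) ≠ 0 := by exact_mod_cast n.succ_ne_zero
    rw [besselTerm, besselTerm, e1, e2, Nat.factorial_succ, pow_succ]
    push_cast
    field_simp
  refine summable_of_ratio_test_tendsto_lt_one (l := 0) one_pos (Eventually.of_forall hne) ?_
  have hlim : Tendsto (fun n : ℕ => ‖Complex.exp (2 * (l - Real.log 2))‖ *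
      (((n : ℝ) + 1)⁻¹ * ‖ν + n + 1‖⁻¹)) atTop (𝓝 (‖Complex.exp (2 * (l - Real.log 2))‖ * (0 * 0))) := by
    refine Tendsto.const_mul _ (Tendsto.mul ?_ ?_)
    · exact tendsto_inv_atTop_zero.comp (tendsto_atTop_add_const_right _ _ tendsto_natCast_atTop_atTop)
    · refine tendsto_inv_atTop_zero.comp ?_
      refine tendsto_atTop_mono (f := fun n : ℕ => (n : ℝ) + (1 + ν.re)) (fun n => ?_)
        (tendsto_atTop_add_const_right _ _ tendsto_natCast_atTop_atTop)
      refine le_trans (le_of_eq ?_) (Complex.re_le_norm _)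
      simp; ring
  rw [mul_zero, mul_zero] at hlim
  refine hlim.congr fun n => ?_
  have h := hne n
  rw [norm_norm, norm_norm, hratio, norm_mul, mul_div_cancel_left₀ _ h, norm_div, norm_neg, norm_mul,
    div_eq_mul_inv, mul_inv]
  congr 3
  rw [← Nat.cast_succ, ← Nat.cast_succ, Complex.norm_natCast]

lemma hasSum_prodJ {μ : ℂ} (hμ : ∀ n : ℤ, μ ≠ n) (d : ℤ) (l : ℂ) :
    HasSum (fun p : ℕ × ℕ => besselTerm (μ + d) l p.1 *
      besselTerm (μ - d) ((starRingEnd ℂ) l) p.2) (prodJ μ d l) := by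
  have h1 := summable_norm_besselTerm (ν := μ + d)
    (fun n h => hμ (n - d) (by push_cast; linear_combination h)) l
  have h2 := summable_norm_besselTerm (ν := μ - d)
    (fun n h => hμ (n + d) (by push_cast; linear_combination h)) ((starRingEnd ℂ) l)
  have := (summable_mul_of_summable_norm h1 h2).hasSum
  rwa [← tsum_mul_tsum_of_summable_norm h1 h2] at this

/-- With `s = 2μ + m + n` and `k = 2d + m - n` one has `(s + k)/2 = μ + d + m` and `(s - k)/2 = μ -
d + n`. The Gamma factors are therefore those of the two Bessel series, and the sine is `±sin(πμ)`.
-/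
lemma cterm_mul_mellinMode {μ : ℂ} (d : ℤ) (l : ℂ) {p : ℕ × ℕ}
    (hp : p ≠ 0) : cterm (Complex.exp l) p *
      mellinMode (2 * μ + ((p.1 + p.2 : ℕ) : ℂ)) (2 * d + (p.1 - p.2)) l =
    -(Real.pi ^ 2 / Complex.sin (Real.pi * μ)) * (besselTerm (μ + d) l p.1 *
      besselTerm (μ - d) ((starRingEnd ℂ) l) p.2) := by
  obtain ⟨m, n⟩ := p
  simp only [cterm, coef, hp, if_false, mellinMode, besselTerm]
  set a := l - Real.log 2 with ha
  set b := (starRingEnd ℂ) l - Real.log 2 with hb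
  have h2 : Complex.exp ((Real.log 2 : ℝ) : ℂ) = 2 := by
    rw [← Complex.ofReal_exp, Real.exp_log two_pos]; norm_num
  have e1 : Complex.exp l = 2 * Complex.exp a := by
    rw [← h2, ← Complex.exp_add]; congr 1; rw [ha]; ring
  have e2 : (starRingEnd ℂ) (Complex.exp l) = 2 * Complex.exp b := by
    rw [← Complex.exp_conj, ← h2, ← Complex.exp_add]; congr 1; rw [hb]; ring
  have e3 : Complex.exp ((μ + d + 2 * m) * a) * Complex.exp ((μ - d + 2 * n) * b) =
      Complex.exp a ^ m * Complex.exp b ^ n * Complex.exp ((μ + d + m) * a + (μ - d + n) * b) := by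
    rw [← Complex.exp_nat_mul, ← Complex.exp_nat_mul, ← Complex.exp_add, ← Complex.exp_add,
      ← Complex.exp_add]
    congr 1; ring
  have e4 : (2 * μ + ((m + n : ℕ) : ℂ) + ((2 * d + (m - n) : ℤ) : ℂ)) / 2 = μ + d + m := by
    push_cast; ring
  have e5 : (2 * μ + ((m + n : ℕ) : ℂ) - ((2 * d + (m - n) : ℤ) : ℂ)) / 2 = μ - d + n := by
    push_cast; ring
  have hm1 : ∀ k : ℕ, ((-1 : ℂ) ^ k) * (-1) ^ k = 1 := fun k => by
    rw [← mul_pow]; norm_num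
  have hz : ((-1 : ℂ) ^ d) ≠ 0 := zpow_ne_zero _ (by norm_num)
  have e6 : Complex.sin (Real.pi * (((2 * d + (m - n) : ℤ) -
      (2 * μ + ((m + n : ℕ) : ℂ))) / 2)) = -((-1) ^ d * (-1) ^ n * Complex.sin (Real.pi * μ)) := by
    have := Complex.sin_antiperiodic.sub_int_mul_eq (x := Real.pi * μ) (d - n)
    rw [Int.cast_negOnePow, zpow_sub₀ (by norm_num), zpow_natCast] at this
    have hdiv : ((-1 : ℂ) ^ d / (-1) ^ n) = (-1) ^ d * (-1) ^ n := by
      rw [div_eq_iff (pow_ne_zero _ (by norm_num)), mul_assoc, hm1, mul_one]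
    rw [hdiv] at this
    rw [← this, ← Complex.sin_neg]
    congr 1
    push_cast; ring
  have e7 : Complex.I ^ (2 * d + ((m : ℤ) - n)) * Complex.I ^ (m + n) =
      (-1) ^ d * (-1) ^ m := by
    rw [← zpow_natCast, ← zpow_add₀ Complex.I_ne_zero]
    have : 2 * d + ((m : ℤ) - n) + ((m + n : ℕ) : ℤ) = 2 * (d + m) := by push_cast; ring
    rw [this, zpow_mul, show (Complex.I ^ (2 : ℤ)) = -1 by
      rw [show (2 : ℤ) = ((2 : ℕ) : ℤ) from rfl, zpow_natCast, Complex.I_sq],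
      zpow_add₀ (by norm_num), zpow_natCast]
  have e8 : 1 + (μ - d + n) = μ - d + n + 1 := by ring
  have e9 : 1 + (μ + d + m) = μ + d + m + 1 := by ring
  have e10 : ((-1 : ℂ) ^ d * (-1) ^ m) / -((-1) ^ d * (-1) ^ n * Complex.sin (Real.pi * μ)) =
      -(((-1) ^ m * (-1) ^ n) / Complex.sin (Real.pi * μ)) := by
    rw [div_neg, mul_assoc, mul_div_mul_left _ _ hz]
    congr 1
    have hn : ((-1 : ℂ) ^ n) ≠ 0 := pow_ne_zero _ (by norm_num)
    rw [← mul_div_mul_left _ _ hn, ← mul_assoc, hm1, one_mul, mul_comm ((-1 : ℂ) ^ m)]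
  rw [e4, e5, e6, e8, e9, e2, e1]
  have e11 : (Complex.I / 2) ^ (m + n) * ((2 * Complex.exp a) ^ m * (2 * Complex.exp b) ^ n) =
      Complex.I ^ (m + n) * (Complex.exp a ^ m * Complex.exp b ^ n) := by
    rw [div_pow, mul_pow, mul_pow, pow_add 2]
    field_simp
  generalize Complex.exp ((μ + d + m) * a + (μ - d + n) * b) = X at *
  generalize (Complex.Gamma (μ + d + m + 1))⁻¹ = G1 at *
  generalize (Complex.Gamma (μ - d + n + 1))⁻¹ = G2 at *
  rw [div_mul_eq_mul_div, e11]
  have step : Complex.I ^ (m + n) * (Complex.exp a ^ m * Complex.exp b ^ n) /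
      (m.factorial * n.factorial) * (Real.pi ^ 2 * Complex.I ^ (2 * d + ((m : ℤ) - n)) /
      -((-1) ^ d * (-1) ^ n * Complex.sin (Real.pi * μ)) * X * (G2 * G1)) =
      (Complex.I ^ (2 * d + ((m : ℤ) - n)) * Complex.I ^ (m + n)) /
      -((-1) ^ d * (-1) ^ n * Complex.sin (Real.pi * μ)) * ((Complex.exp a ^ m * Complex.exp b ^ n *
      X) * (G1 * G2) * Real.pi ^ 2 / (m.factorial * n.factorial)) := by ring
  rw [step, e7, e10, ← e3]
  ring

/-- The product of the two Bessel series without its term at `(0, 0)`; that term is the leading term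
`prodP`, so the regularization is automatic. -/
lemma hasSum_mellinPart {μ : ℂ} (hμ : ∀ n : ℤ, μ ≠ n) (d : ℤ) (l : ℂ) :
    HasSum (fun p : ℕ × ℕ => cterm (Complex.exp l) p *
      mellinMode (2 * μ + ((p.1 + p.2 : ℕ) : ℂ)) (2 * d + (p.1 - p.2)) l)
      (-(Real.pi ^ 2 / Complex.sin (Real.pi * μ)) * (prodJ μ d l - prodP μ d l)) := by
  have h := (hasSum_ite_sub_hasSum (hasSum_prodJ hμ d l) 0).mul_left
    (-(Real.pi ^ 2 / Complex.sin (Real.pi * μ)))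
  have h0 : besselTerm (μ + d) l 0 * besselTerm (μ - d) ((starRingEnd ℂ) l) 0 = prodP μ d l := by
    simp only [besselTerm, prodP]
    simp
    ring
  simp only [Prod.fst_zero, Prod.snd_zero, h0] at h
  refine h.congr_fun fun p => ?_
  by_cases hp : p = 0
  · simp [hp, cterm_zero]
  · rw [if_neg hp, cterm_mul_mellinMode d l hp]

lemma halfInt_eq {μ : ℂ} (hμ : |μ.re| < 1 / 2) (h0 : μ ≠ 0) (d : ℤ) (l : ℂ) :
    halfInt μ d (Complex.exp l) =
      -(Real.pi ^ 2 / Complex.sin (Real.pi * μ)) * (prodJ μ d l - prodP μ d l) +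
        ∑' x, poleTerm μ d (Complex.exp l) x := by
  have h2 := two_mul_ne_int hμ h0
  have h1 : ∀ n : ℤ, μ ≠ n := fun n h => h2 (2 * n) (by rw [h]; push_cast; ring)
  refine (hasSum_halfInt hμ d _).unique ?_
  refine ((hasSum_mellinPart h1 d l).add (hasSum_poleSum h2 d _)).congr_fun fun p => ?_
  by_cases hp : p = 0
  · simp [hp, cterm_zero]
  · rw [outerMode_eq (by linarith [re_pos_of_ne_zero (μ := μ) hp]), mul_add]
    intro n hn
    refine h2 (n - (p.1 + p.2 : ℕ)) ?_
    push_cast at hn ⊢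
    linear_combination hn

lemma kernelInt_exp {μ : ℂ} (hμ : |μ.re| < 1 / 2) (h0 : μ ≠ 0) (d : ℤ) (l : ℂ) :
    kernelInt μ d (Complex.exp l) = Real.pi ^ 2 / Complex.sin (Real.pi * μ) *
      ((prodJ (-μ) (-d) l - prodJ μ d l) - (prodP (-μ) (-d) l - prodP μ d l)) := by
  rw [kernelInt_eq_add hμ, halfInt_eq hμ h0, halfInt_eq (by simpa using hμ) (neg_ne_zero.2 h0),
    tsum_poleTerm_neg, mul_neg, Complex.sin_neg]
  ring

lemma quotJ_sub_quotP {μ : ℂ} (hμ : |μ.re| < 1 / 2) (h0 : μ ≠ 0) (d : ℤ) {z : ℂ} (hz : z ≠ 0) :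
    quotJ μ d z - quotP μ d z = kernelInt μ d (4 * Real.pi * z) / Real.pi ^ 2 := by
  have hpi : (Real.pi : ℂ) ≠ 0 := by exact_mod_cast Real.pi_ne_zero
  have hZ : 4 * Real.pi * z ≠ 0 := by simp [hpi, hz]
  conv_rhs => rw [← Complex.exp_log hZ]
  rw [kernelInt_exp hμ h0]
  unfold quotJ quotP J P
  field_simp

/-- Supplies the limit `μ → 0`, where the closed expression is of the form `0/0` but the integral is
regular. -/
lemma continuousAt_kernelInt {μ : ℂ} (hμ : |μ.re| < 1 / 2) (d : ℤ) (Z : ℂ) :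
    ContinuousAt (fun s => kernelInt s d Z) μ := by
  obtain ⟨c, hc1, hc2⟩ := exists_between hμ
  have hev : ∀ᶠ s : ℂ in 𝓝 μ, |s.re| < c :=
    (isOpen_lt (continuous_abs.comp Complex.continuous_re) continuous_const).mem_nhds hc1
  refine continuousAt_of_dominated (bound := fun p : ℝ × ℝ => 2 * ‖Z‖ * Real.exp (-(1 - 2 * c) * |p.1|))
    ?_ ?_ ((integrable_ann_exp (by linarith)).const_mul _) ?_
  · exact Eventually.of_forall fun s =>
      ((continuous_chi s d).mul (continuous_phasePair Z)).aestronglyMeasurable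
  · filter_upwards [hev] with s hs
    refine ae_of_all _ fun p => (norm_chi_mul_phasePair_le s d Z p).trans ?_
    gcongr
  · refine ae_of_all _ fun p => ContinuousAt.mul ?_ continuousAt_const
    unfold chi
    fun_prop

/-- The numerator is entire in the order and vanishes at `0`: for `d = 0` the two terms agree, and
for `d ≠ 0` each contains the reciprocal of Gamma at a pole. -/
lemma tendsto_quotP_zero (d : ℤ) (z : ℂ) : ∃ c, Tendsto (fun s => quotP s d z) (𝓝[≠] 0) (𝓝 c) := by
  set l := Complex.log (4 * Real.pi * z) with hl
  set N : ℂ → ℂ := fun s => prodP (-s) (-d) l - prodP s d l with hN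
  have hdiff : Differentiable ℂ N := by
    have g1 : Differentiable ℂ fun s : ℂ => (Complex.Gamma (-s + (-d : ℤ) + 1))⁻¹ :=
      differentiable_inv_Gamma_comp (by fun_prop)
    have g2 : Differentiable ℂ fun s : ℂ => (Complex.Gamma (-s - (-d : ℤ) + 1))⁻¹ :=
      differentiable_inv_Gamma_comp (by fun_prop)
    have g3 : Differentiable ℂ fun s : ℂ => (Complex.Gamma (s + d + 1))⁻¹ :=
      differentiable_inv_Gamma_comp (by fun_prop)
    have g4 : Differentiable ℂ fun s : ℂ => (Complex.Gamma (s - d + 1))⁻¹ :=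
      differentiable_inv_Gamma_comp (by fun_prop)
    simp only [hN, prodP]
    exact ((Differentiable.mul (by fun_prop) (by fun_prop)).mul (g1.mul g2)).sub
      ((Differentiable.mul (by fun_prop) (by fun_prop)).mul (g3.mul g4))
  have h0 : N 0 = 0 := by
    simp only [hN, prodP]
    rcases lt_trichotomy d 0 with hd | hd | hd
    · have e : Complex.Gamma (0 + d + 1) = 0 := by
        have : (0 + d + 1 : ℂ) = -((-d - 1).toNat : ℂ) := by
          have h3 : ((-d - 1).toNat : ℤ) = -d - 1 := Int.toNat_of_nonneg (by omega)
          have h4 : ((-d - 1).toNat : ℂ) = -d - 1 := by exact_mod_cast h3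
          rw [h4]; ring
        rw [this, Complex.Gamma_neg_nat_eq_zero]
      have e' : (-0 - ((-d : ℤ) : ℂ) + 1) = 0 + d + 1 := by push_cast; ring
      rw [e', e]; simp
    · simp [hd]
    · have e : Complex.Gamma (0 - d + 1) = 0 := by
        have : (0 - d + 1 : ℂ) = -((d - 1).toNat : ℂ) := by
          have h3 : ((d - 1).toNat : ℤ) = d - 1 := Int.toNat_of_nonneg (by omega)
          have h4 : ((d - 1).toNat : ℂ) = d - 1 := by exact_mod_cast h3
          rw [h4]; ring
        rw [this, Complex.Gamma_neg_nat_eq_zero]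
      have e' : (-0 + ((-d : ℤ) : ℂ) + 1) = 0 - d + 1 := by push_cast; ring
      rw [e', e]; simp
  have hpi : (Real.pi : ℂ) ≠ 0 := by exact_mod_cast Real.pi_ne_zero
  have s1 := (hasDerivAt_iff_tendsto_slope.1 (hdiff 0).hasDerivAt)
  have hsin : HasDerivAt (fun s : ℂ => Complex.sin (Real.pi * s)) Real.pi 0 := by
    simpa using ((hasDerivAt_id (0 : ℂ)).const_mul (Real.pi : ℂ)).csin
  have s2 := hasDerivAt_iff_tendsto_slope.1 hsin
  -- The limit is the quotient of the slopes of numerator and sine at `0`.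
  refine ⟨deriv N 0 / Real.pi, (s1.div s2 hpi).congr' ?_⟩
  filter_upwards [self_mem_nhdsWithin] with s hs
  have hs : s ≠ 0 := hs
  simp only [Pi.div_apply, slope_def_field, h0, mul_zero, Complex.sin_zero, sub_zero]
  rw [div_div_div_cancel_right₀ hs]
  rfl

/-- The integral representation of the regularized Bessel function. -/
theorem boldM_eq {μ : ℂ} (hμ : |μ.re| < 1 / 2) (d : ℤ) {z : ℂ} (hz : z ≠ 0) :
    boldM μ d z = kernelInt μ d (4 * Real.pi * z) / Real.pi ^ 2 := by
  by_cases h0 : μ = 0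
  · subst h0
    obtain ⟨c, hc⟩ := tendsto_quotP_zero d z
    have hk : Tendsto (fun s => kernelInt s d (4 * Real.pi * z) / (Real.pi : ℂ) ^ 2) (𝓝[≠] 0)
        (𝓝 (kernelInt 0 d (4 * Real.pi * z) / (Real.pi : ℂ) ^ 2)) :=
      ((continuousAt_kernelInt hμ d _).tendsto.div_const _).mono_left nhdsWithin_le_nhds
    -- The existence of the limit of the Bessel quotient is deduced from those of the leading terms
    -- and of the integral.
    have hJ : Tendsto (fun s => quotJ s d z) (𝓝[≠] 0)
        (𝓝 (c + kernelInt 0 d (4 * Real.pi * z) / (Real.pi : ℂ) ^ 2)) := by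
      refine (hc.add hk).congr' ?_
      have hev : ∀ᶠ s : ℂ in 𝓝[≠] 0, |s.re| < 1 / 2 := nhdsWithin_le_nhds
        ((isOpen_lt (continuous_abs.comp Complex.continuous_re) continuous_const).mem_nhds hμ)
      filter_upwards [hev, self_mem_nhdsWithin] with s hs hs0
      rw [← quotJ_sub_quotP hs hs0 d hz]
      ring
    unfold boldM boldJ boldR
    simp only [mul_zero, Complex.sin_zero, if_true]
    rw [hc.limUnder_eq, hJ.limUnder_eq]
    ring
  · have h1 : Complex.sin (Real.pi * μ) ≠ 0 := sin_pi_mul_ne_zero fun n h =>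
      two_mul_ne_int hμ h0 (2 * n) (by rw [h]; push_cast; ring)
    unfold boldM boldJ boldR
    rw [if_neg h1, if_neg h1, quotJ_sub_quotP hμ h0 d hz]

/-! ### The exponential integral: asymptotics and a uniform bound -/

/-- The primitive `∫_0^z (e^{iτ} - 1)/τ dτ`. -/
def expInt (z : ℝ) : ℂ := ∫ τ in (0 : ℝ)..z, (Complex.exp (Complex.I * τ) - 1) / τ

lemma norm_expInt_integrand_le_one (τ : ℝ) : ‖(Complex.exp (Complex.I * τ) - 1) / (τ : ℂ)‖ ≤ 1 := by
  rw [norm_div, Complex.norm_real]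
  exact div_le_one_of_le₀ Real.norm_exp_I_mul_ofReal_sub_one_le (norm_nonneg _)

lemma norm_expInt_integrand_le (τ : ℝ) :
    ‖(Complex.exp (Complex.I * τ) - 1) / (τ : ℂ)‖ ≤ 2 * |τ|⁻¹ := by
  rw [norm_div, Complex.norm_real, div_eq_mul_inv, Real.norm_eq_abs]
  gcongr
  refine (norm_sub_le _ _).trans ?_
  rw [mul_comm, Complex.norm_exp_ofReal_mul_I]
  norm_num

lemma measurable_expInt_integrand :
    Measurable fun τ : ℝ => (Complex.exp (Complex.I * τ) - 1) / (τ : ℂ) := by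
  fun_prop

lemma intervalIntegrable_expInt (a b : ℝ) :
    IntervalIntegrable (fun τ : ℝ => (Complex.exp (Complex.I * τ) - 1) / (τ : ℂ)) volume a b :=
  (intervalIntegrable_const (c := (1 : ℝ))).mono_fun'
    measurable_expInt_integrand.aestronglyMeasurable (ae_of_all _ norm_expInt_integrand_le_one)

lemma expInt_sub (a b : ℝ) :
    expInt b - expInt a = ∫ τ in a..b, (Complex.exp (Complex.I * τ) - 1) / (τ : ℂ) :=
  intervalIntegral.integral_interval_sub_left (intervalIntegrable_expInt _ _)
    (intervalIntegrable_expInt _ _)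

lemma expInt_neg (z : ℝ) : expInt (-z) = (starRingEnd ℂ) (expInt z) := by
  have h1 := intervalIntegral.integral_comp_neg (a := z) (b := 0)
    (fun τ : ℝ => (Complex.exp (Complex.I * τ) - 1) / (τ : ℂ))
  rw [neg_zero] at h1
  have h2 : ∀ τ : ℝ, (Complex.exp (Complex.I * ((-τ : ℝ) : ℂ)) - 1) / ((-τ : ℝ) : ℂ) =
      -(starRingEnd ℂ) ((Complex.exp (Complex.I * τ) - 1) / (τ : ℂ)) := by
    intro τ
    rw [map_div₀, map_sub, map_one, Complex.conj_ofReal, ← Complex.exp_conj, map_mul,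
      Complex.conj_I, Complex.conj_ofReal]
    push_cast
    rw [div_neg, mul_neg, neg_mul]
  simp_rw [h2] at h1
  rw [expInt, ← h1, intervalIntegral.integral_symm, intervalIntegral.integral_neg, neg_neg, expInt]
  simp only [intervalIntegral, map_sub, integral_conj]

lemma hasDerivAt_expInt {z : ℝ} (hz : z ≠ 0) :
    HasDerivAt expInt ((Complex.exp (Complex.I * z) - 1) / z) z := by
  refine intervalIntegral.integral_hasDerivAt_right (intervalIntegrable_expInt 0 z)
    (measurable_expInt_integrand.stronglyMeasurable.stronglyMeasurableAtFilter) ?_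
  have : (z : ℂ) ≠ 0 := by exact_mod_cast hz
  exact ContinuousAt.div (by fun_prop) (by fun_prop) this

lemma continuous_expInt : Continuous expInt :=
  intervalIntegral.continuous_primitive (fun a b => intervalIntegrable_expInt a b) 0

lemma tendsto_expInt_add_log : ∃ c : ℂ, Tendsto (fun z : ℝ => expInt z + Real.log z) atTop (𝓝 c) := by
  -- The added term is the boundary term of an integration by parts in `∫ e^{iz}/z dz`; with it the
  -- derivative is `-i e^{iz}/z²`, integrable at infinity.
  set Q : ℝ → ℂ := fun z => expInt z + Real.log z + Complex.I * Complex.exp (Complex.I * z) / z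
  have hd : ∀ z ∈ Ioi (1 : ℝ), HasDerivAt Q (-Complex.I * Complex.exp (Complex.I * z) / z ^ 2) z := by
    intro z hz
    have hz0 : z ≠ 0 := by have : (1 : ℝ) < z := hz; positivity
    have hz1 : (z : ℂ) ≠ 0 := by exact_mod_cast hz0
    have h1 := hasDerivAt_expInt hz0
    have h2 := (Real.hasDerivAt_log hz0).ofReal_comp
    have h3 : HasDerivAt (fun z : ℝ => Complex.I * Complex.exp (Complex.I * z))
        (Complex.I * (Complex.exp (Complex.I * z) * Complex.I)) z := by
      have := (((hasDerivAt_id z).ofReal_comp.const_mul Complex.I).cexp).const_mul Complex.I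
      simpa using this
    have h4 : HasDerivAt (fun z : ℝ => (z : ℂ)) 1 z := by simpa using (hasDerivAt_id z).ofReal_comp
    refine ((h1.add h2).add (h3.div h4 hz1)).congr_deriv ?_
    push_cast
    field_simp
    linear_combination (Complex.exp (Complex.I * z) * z) * Complex.I_sq
  have hi : IntegrableOn (fun z : ℝ => -Complex.I * Complex.exp (Complex.I * z) / (z : ℂ) ^ 2)
      (Ioi 1) := by
    have h := integrableOn_Ioi_rpow_of_lt (a := -2) (by norm_num) (one_pos)
    refine Integrable.mono' h (Measurable.aestronglyMeasurable (by fun_prop)) ?_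
    refine (ae_restrict_iff' measurableSet_Ioi).2 (ae_of_all _ fun z hz => ?_)
    have hz : (1 : ℝ) < z := hz
    rw [norm_div, norm_mul, norm_neg, Complex.norm_I, mul_comm Complex.I,
      Complex.norm_exp_ofReal_mul_I, norm_pow, Complex.norm_real, Real.norm_of_nonneg (by linarith),
      Real.rpow_neg (by linarith)]
    norm_num
  have hl := tendsto_limUnder_of_hasDerivAt_of_integrableOn_Ioi hd hi
  have h0 : Tendsto (fun z : ℝ => Complex.I * Complex.exp (Complex.I * z) / z) atTop (𝓝 0) := by
    refine squeeze_zero_norm' (a := fun z : ℝ => z⁻¹) ?_ tendsto_inv_atTop_zero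
    filter_upwards [eventually_gt_atTop 0] with z hz
    rw [norm_div, norm_mul, Complex.norm_I, mul_comm Complex.I, Complex.norm_exp_ofReal_mul_I,
      Complex.norm_real, Real.norm_of_nonneg hz.le]
    simp
  refine ⟨_, (hl.sub h0).congr fun z => ?_⟩
  simp only [Q]; ring

/-- Values at `±z` are conjugate, so the constants at the two ends are conjugate as well; taking `κ`
to be the imaginary part makes both limits the same real number. -/
lemma exists_expInt_asymptotics : ∃ (c : ℂ) (κ : ℝ),
    Tendsto (fun z : ℝ => expInt z + Real.log |z| - κ * Complex.I * SignType.sign z) atTop (𝓝 c) ∧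
    Tendsto (fun z : ℝ => expInt z + Real.log |z| - κ * Complex.I * SignType.sign z) atBot (𝓝 c) := by
  obtain ⟨c, hc⟩ := tendsto_expInt_add_log
  have h1 : Tendsto (fun z : ℝ => expInt z + Real.log |z| - c.im * Complex.I * SignType.sign z)
      atTop (𝓝 c.re) := by
    have : (c.re : ℂ) = c - c.im * Complex.I := by
      apply Complex.ext <;> simp
    rw [this]
    refine (hc.sub_const _).congr' ?_
    filter_upwards [eventually_gt_atTop 0] with z hz
    rw [abs_of_pos hz, sign_pos hz]
    simp
  refine ⟨c.re, c.im, h1, ?_⟩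
  have h2 := ((Complex.continuous_conj.tendsto _).comp h1).comp tendsto_neg_atBot_atTop
  rw [Complex.conj_ofReal] at h2
  refine h2.congr fun z => ?_
  simp only [Function.comp, map_sub, map_add, map_mul, Complex.conj_ofReal, Complex.conj_I,
    ← expInt_neg, neg_neg, abs_neg, Left.sign_neg]
  rcases lt_trichotomy z 0 with h | h | h
  · simp [sign_neg h]
  · simp [h]
  · simp [sign_pos h]

/-- The logarithmic divergence is purely real, so the imaginary part stays bounded. -/
lemma exists_im_expInt_bound : ∃ M : ℝ, 0 < M ∧ ∀ z, |(expInt z).im| ≤ M := by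
  obtain ⟨c, hc⟩ := tendsto_expInt_add_log
  have him : Tendsto (fun z : ℝ => |(expInt z).im|) atTop (𝓝 |c.im|) := by
    refine ((continuous_abs.comp Complex.continuous_im).tendsto c |>.comp hc).congr fun z => ?_
    simp
  have hev := him.eventually_lt_const (lt_add_one |c.im|)
  obtain ⟨N, hN⟩ := eventually_atTop.1 hev
  obtain ⟨B, hB⟩ := (isCompact_Icc (a := (0 : ℝ)) (b := N)).exists_bound_of_continuousOn
    (f := fun z => (expInt z).im) (Complex.continuous_im.comp continuous_expInt).continuousOn
  have hpos : ∀ z : ℝ, 0 ≤ z → |(expInt z).im| ≤ |B| + |c.im| + 1 := by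
    intro z hz
    rcases le_total z N with h | h
    · have := hB z ⟨hz, h⟩
      rw [Real.norm_eq_abs] at this
      linarith [le_abs_self B, abs_nonneg c.im]
    · linarith [hN z h, abs_nonneg B]
  refine ⟨|B| + |c.im| + 1, by positivity, fun z => ?_⟩
  rcases le_total 0 z with h | h
  · exact hpos z h
  · have := hpos (-z) (by linarith)
    rwa [expInt_neg, Complex.conj_im, abs_neg] at this

lemma norm_expInt_sub_le_of_le {p q : ℝ} (hp : 0 < p) (hpq : p ≤ q) :
    ‖expInt q - expInt p‖ ≤ 2 * Real.log (q / p) := by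
  rw [expInt_sub]
  have h0 : (0 : ℝ) ∉ uIcc p q := by
    rw [uIcc_of_le hpq]; exact fun h => absurd h.1 (not_le.2 hp)
  rw [← integral_inv h0, ← intervalIntegral.integral_const_mul]
  refine intervalIntegral.norm_integral_le_of_norm_le hpq (ae_of_all _ fun τ hτ => ?_)
    ((intervalIntegrable_inv_iff.2 (Or.inr h0)).const_mul 2)
  have := norm_expInt_integrand_le τ
  rwa [abs_of_pos (hp.trans hτ.1)] at this

lemma norm_expInt_sub_le {p q : ℝ} (hp : 0 < p) (hq : 0 < q) :
    ‖expInt q - expInt p‖ ≤ 2 * |Real.log (q / p)| := by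
  rcases le_total p q with h | h
  · exact (norm_expInt_sub_le_of_le hp h).trans (by gcongr; exact le_abs_self _)
  · rw [norm_sub_rev]
    refine (norm_expInt_sub_le_of_le hq h).trans ?_
    rw [← inv_div, Real.log_inv]
    gcongr
    exact neg_le_abs _

/-- Combines `α log x ≤ x^α - 1` with the subadditivity of `x ↦ x^α` for `α ≤ 1`. -/
lemma log_div_le {p q α : ℝ} (hp : 0 < p) (hpq : p ≤ q) (hα : 0 < α) (hα1 : α ≤ 1) :
    Real.log (q / p) ≤ α⁻¹ * ((q - p) ^ α * p ^ (-α)) := by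
  have hx : 0 < q / p := by have := hp.trans_le hpq; positivity
  have h1 : α * Real.log (q / p) ≤ (q / p) ^ α - 1 := by
    rw [← Real.log_rpow hx]
    exact Real.log_le_sub_one_of_pos (by positivity)
  have h2 : q ^ α ≤ (q - p) ^ α + p ^ α := by
    have := Real.rpow_add_le_add_rpow (a := q - p) (b := p) (by linarith) hp.le hα.le hα1
    simpa using this
  have h3 : (q / p) ^ α - 1 ≤ (q - p) ^ α * p ^ (-α) := by
    rw [Real.div_rpow (hp.le.trans hpq) hp.le, Real.rpow_neg hp.le]
    have : 0 < p ^ α := by positivity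
    field_simp
    linarith
  rw [inv_mul_eq_div, le_div_iff₀ hα]
  linarith

lemma abs_log_div_le {p q α : ℝ} (hp : 0 < p) (hq : 0 < q) (hα : 0 < α) (hα1 : α ≤ 1) :
    |Real.log (q / p)| ≤ α⁻¹ * (|q - p| ^ α * (q ^ (-α) + p ^ (-α))) := by
  have hle : ∀ {p q : ℝ}, 0 < p → p ≤ q →
      |Real.log (q / p)| ≤ α⁻¹ * (|q - p| ^ α * (q ^ (-α) + p ^ (-α))) := by
    intro p q hp h
    have hq := hp.trans_le h
    rw [abs_of_nonneg (Real.log_nonneg ((one_le_div hp).2 h)), abs_of_nonneg (by linarith)]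
    refine (log_div_le hp h hα hα1).trans ?_
    have h1 : 0 ≤ (q - p) := by linarith
    gcongr
    have : 0 < q ^ (-α) := by positivity
    linarith
  rcases le_total p q with h | h
  · exact hle hp h
  · have := hle hq h
    rwa [abs_sub_comm, add_comm, ← inv_div q p, Real.log_inv, abs_neg] at this

/-- Uniform bound for the difference of two values of `expInt` under dilation. -/
lemma exists_norm_expInt_sub_le {α : ℝ} (hα : 0 < α) (hα1 : α ≤ 1) :
    ∃ C : ℝ, 0 < C ∧ ∀ T b d : ℝ, 0 < T → b ≠ 0 → d ≠ 0 →
      ‖expInt (b * T) - expInt (d * T)‖ ≤ C * (|b - d| ^ α * (|b| ^ (-α) + |d| ^ (-α))) := by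
  obtain ⟨M, hM, hb⟩ := exists_im_expInt_bound
  refine ⟨2 * α⁻¹ + 2 * M, by positivity, fun T b d hT hb0 hd0 => ?_⟩
  have hbp : 0 < |b| := abs_pos.2 hb0
  have hdp : 0 < |d| := abs_pos.2 hd0
  have hab : |(|b| - |d|)| ≤ |b - d| := abs_abs_sub_abs_le _ _
  set S := |b - d| ^ α * (|b| ^ (-α) + |d| ^ (-α)) with hS
  have hS0 : 0 ≤ S := by positivity
  -- For arguments of equal sign the integrand is at most `2/τ`, giving a logarithm of a ratio in
  -- which `T` cancels.
  have hpos : ‖expInt (|b| * T) - expInt (|d| * T)‖ ≤ 2 * α⁻¹ * S := by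
    refine (norm_expInt_sub_le (by positivity) (by positivity)).trans ?_
    rw [mul_div_mul_right _ _ hT.ne', mul_assoc]
    gcongr
    refine (abs_log_div_le hdp hbp hα hα1).trans ?_
    rw [hS]
    gcongr
  have hconj : ∀ x : ℝ, x < 0 → expInt (x * T) = (starRingEnd ℂ) (expInt (|x| * T)) := by
    intro x hx
    rw [← expInt_neg, abs_of_neg hx]; congr 1; ring
  have hjump : ∀ z : ℂ, ‖z - (starRingEnd ℂ) z‖ = 2 * |z.im| := by
    intro z
    rw [Complex.sub_conj]; simp
  -- For opposite signs one must also pass to a conjugate, which costs at most `2M`; but then `|d| ≤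
  -- |b - d|` forces `S ≥ 1`, so the cost is absorbed.
  have hopp : |d| ≤ |b - d| → 2 * M ≤ 2 * M * S := by
    intro h
    have h1 : 1 ≤ |b - d| ^ α * |d| ^ (-α) := by
      rw [Real.rpow_neg hdp.le, ← div_eq_mul_inv, one_le_div (by positivity)]
      gcongr
    have h2 : 0 ≤ |b - d| ^ α * |b| ^ (-α) := by positivity
    have h3 : 1 ≤ S := by rw [hS, mul_add]; linarith
    nlinarith
  have hM2 : 0 ≤ 2 * M * S := by positivity
  rcases lt_or_gt_of_ne hb0 with h1 | h1 <;> rcases lt_or_gt_of_ne hd0 with h2 | h2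
  · rw [hconj b h1, hconj d h2, ← map_sub, RCLike.norm_conj]
    linarith
  · have h3 := hopp (by rw [abs_of_pos h2, abs_of_neg (by linarith)]; linarith)
    rw [hconj b h1]
    rw [abs_of_pos h2] at hpos
    have h4 := norm_add_le (-(expInt (|b| * T) - (starRingEnd ℂ) (expInt (|b| * T))))
      (expInt (|b| * T) - expInt (d * T))
    rw [norm_neg, hjump] at h4
    have h5 := hb (|b| * T)
    have h6 : -(expInt (|b| * T) - (starRingEnd ℂ) (expInt (|b| * T))) +
      (expInt (|b| * T) - expInt (d * T)) = (starRingEnd ℂ) (expInt (|b| * T)) - expInt (d * T) := by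
      ring
    rw [h6] at h4
    linarith
  · have h3 := hopp (by rw [abs_of_neg h2, abs_of_pos (by linarith)]; linarith)
    rw [hconj d h2]
    rw [abs_of_pos h1] at hpos
    have h4 := norm_add_le (expInt (b * T) - expInt (|d| * T))
      (expInt (|d| * T) - (starRingEnd ℂ) (expInt (|d| * T)))
    rw [hjump, sub_add_sub_cancel] at h4
    have h5 := hb (|d| * T)
    linarith
  · rw [abs_of_pos h1, abs_of_pos h2] at hpos
    linarith

/-! ### Negative powers of linear forms on the circle and in the plane -/

lemma intervalIntegrable_abs_sin_rpow {α : ℝ} (h0 : 0 ≤ α) (h1 : α < 1) (a b : ℝ) :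
    IntervalIntegrable (fun x => |Real.sin x| ^ (-α)) volume a b := by
  have hmeas : Measurable fun x => |Real.sin x| ^ (-α) := by fun_prop
  have i1 : IntervalIntegrable (fun x => |Real.sin x| ^ (-α)) volume 0 (Real.pi / 2) := by
    have hi := ((intervalIntegral.intervalIntegrable_rpow' (a := 0) (b := Real.pi / 2)
      (r := -α) (by linarith)).const_mul ((2 / Real.pi) ^ (-α)))
    refine hi.mono_fun' hmeas.aestronglyMeasurable ?_
    refine (ae_restrict_iff' measurableSet_uIoc).2 (ae_of_all _ fun x hx => ?_)
    rw [uIoc_of_le (by positivity)] at hx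
    have hx0 : 0 < x := hx.1
    have hs := Real.mul_le_sin hx0.le hx.2
    have hp : 0 < 2 / Real.pi * x := by positivity
    beta_reduce
    rw [Real.norm_of_nonneg (by positivity), abs_of_pos (by linarith),
      ← Real.mul_rpow (by positivity) hx0.le]
    exact Real.rpow_le_rpow_of_nonpos hp hs (by linarith)
  have i2 : IntervalIntegrable (fun x => |Real.sin x| ^ (-α)) volume (Real.pi / 2) Real.pi := by
    have := i1.comp_sub_left Real.pi
    simp only [Real.sin_pi_sub, sub_zero] at this
    have e : Real.pi - Real.pi / 2 = Real.pi / 2 := by ring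
    rw [e] at this
    exact this.symm
  have hper : Function.Periodic (fun x => |Real.sin x| ^ (-α)) Real.pi := fun x => by
    simp [Real.sin_add_pi]
  refine hper.intervalIntegrable Real.pi_ne_zero (t := 0) ?_ a b
  rw [zero_add]
  exact i1.trans i2

lemma integrable_circ_iff {E : Type*} [NormedAddCommGroup E] {f : ℝ → E} :
    Integrable f circ ↔ IntervalIntegrable f volume 0 (2 * Real.pi) :=
  (intervalIntegrable_iff_integrableOn_Ioc_of_le (by positivity)).symm

lemma integral_circ_eq {E : Type*} [NormedAddCommGroup E] [NormedSpace ℝ E] (f : ℝ → E) :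
    ∫ ω, f ω ∂circ = ∫ ω in (0 : ℝ)..2 * Real.pi, f ω :=
  (intervalIntegral.integral_of_le (by positivity)).symm

lemma integral_circ_comp_add {E : Type*} [NormedAddCommGroup E] [NormedSpace ℝ E] {f : ℝ → E}
    (hf : Function.Periodic f (2 * Real.pi)) (c : ℝ) : ∫ ω, f (ω + c) ∂circ = ∫ ω, f ω ∂circ := by
  rw [integral_circ_eq, integral_circ_eq, intervalIntegral.integral_comp_add_right, zero_add,
    add_comm, hf.intervalIntegral_add_eq c 0, zero_add]

lemma integrable_circ_comp_add {E : Type*} [NormedAddCommGroup E] {f : ℝ → E}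
    (hf : ∀ a b, IntervalIntegrable f volume a b) (c : ℝ) :
    Integrable (fun ω => f (ω + c)) circ := by
  rw [integrable_circ_iff]
  have := (hf c (2 * Real.pi + c)).comp_add_right c
  simpa using this

lemma integrable_abs_sin_rpow {α : ℝ} (h0 : 0 ≤ α) (h1 : α < 1) (c : ℝ) :
    Integrable (fun ω => |Real.sin (ω + c)| ^ (-α)) circ :=
  integrable_circ_comp_add (intervalIntegrable_abs_sin_rpow h0 h1) c

lemma integral_abs_sin_rpow (α c : ℝ) :
    ∫ ω, |Real.sin (ω + c)| ^ (-α) ∂circ = ∫ ω, |Real.sin ω| ^ (-α) ∂circ :=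
  integral_circ_comp_add (f := fun ω => |Real.sin ω| ^ (-α))
    (fun x => by simp [Real.sin_add_two_pi]) c

lemma ae_sin_add_ne_zero (c : ℝ) : ∀ᵐ ω ∂circ, Real.sin (ω + c) ≠ 0 := by
  have : (range fun n : ℤ => n * Real.pi - c).Countable := countable_range _
  filter_upwards [this.ae_notMem circ] with ω hω h
  obtain ⟨n, hn⟩ := Real.sin_eq_zero_iff.1 h
  exact hω ⟨n, by simp only; linarith⟩

/-- The real linear form `ζ ↦ 4π Re (e^{iφ} ζ)`. -/
def lin (φ : ℝ) (ζ : ℂ) : ℝ := 4 * Real.pi * (Complex.exp (φ * Complex.I) * ζ).re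

lemma lin_add (φ : ℝ) (ζ η : ℂ) : lin φ (ζ + η) = lin φ ζ + lin φ η := by
  simp only [lin, mul_add, Complex.add_re]

lemma lin_sub (φ : ℝ) (ζ η : ℂ) : lin φ (ζ - η) = lin φ ζ - lin φ η := by
  simp only [lin, mul_sub, Complex.sub_re]

lemma lin_neg (φ : ℝ) (ζ : ℂ) : lin φ (-ζ) = -lin φ ζ := by
  simp only [lin, mul_neg, Complex.neg_re]

lemma lin_eq_sin (φ : ℝ) (ζ : ℂ) :
    lin φ ζ = 4 * Real.pi * ‖ζ‖ * Real.sin (φ + (ζ.arg + Real.pi / 2)) := by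
  rw [← add_assoc, Real.sin_add_pi_div_two, Real.cos_add, lin, Complex.mul_re,
    Complex.exp_ofReal_mul_I_re, Complex.exp_ofReal_mul_I_im, ← Complex.norm_mul_cos_arg ζ,
    ← Complex.norm_mul_sin_arg ζ]
  ring

lemma abs_lin_le (φ : ℝ) (ζ : ℂ) : |lin φ ζ| ≤ 4 * Real.pi * ‖ζ‖ := by
  rw [lin_eq_sin, abs_mul, abs_of_nonneg (by positivity)]
  exact mul_le_of_le_one_right (by positivity) (Real.abs_sin_le_one _)

lemma continuous_lin : Continuous fun x : ℝ × ℂ => lin x.1 x.2 := by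
  unfold lin; fun_prop

lemma ae_lin_ne_zero {ζ : ℂ} (hζ : ζ ≠ 0) : ∀ᵐ φ ∂circ, lin φ ζ ≠ 0 := by
  filter_upwards [ae_sin_add_ne_zero (ζ.arg + Real.pi / 2)] with φ hφ
  rw [lin_eq_sin]
  have := norm_pos_iff.2 hζ
  have := Real.pi_pos
  exact mul_ne_zero (by positivity) hφ

lemma abs_lin_rpow (φ : ℝ) (ζ : ℂ) (α : ℝ) : |lin φ ζ| ^ (-α) =
    (4 * Real.pi * ‖ζ‖) ^ (-α) * |Real.sin (φ + (ζ.arg + Real.pi / 2))| ^ (-α) := by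
  rw [lin_eq_sin, abs_mul, abs_of_nonneg (by positivity), Real.mul_rpow (by positivity) (abs_nonneg _)]

lemma integrable_abs_lin_rpow {α : ℝ} (h0 : 0 ≤ α) (h1 : α < 1) (ζ : ℂ) :
    Integrable (fun φ => |lin φ ζ| ^ (-α)) circ := by
  simp_rw [abs_lin_rpow]
  exact (integrable_abs_sin_rpow h0 h1 _).const_mul _

lemma integral_abs_lin_rpow (α : ℝ) (ζ : ℂ) : ∫ φ, |lin φ ζ| ^ (-α) ∂circ =
    (4 * Real.pi) ^ (-α) * (∫ ω, |Real.sin ω| ^ (-α) ∂circ) * ‖ζ‖ ^ (-α) := by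
  simp_rw [abs_lin_rpow]
  rw [integral_const_mul, integral_abs_sin_rpow, Real.mul_rpow (by positivity) (norm_nonneg _)]
  ring

/-- The average of `|lin φ ζ|^{-α}` over `φ` is a constant times `‖ζ‖^{-α}`, so Tonelli's theorem
removes the angular variable. -/
lemma integrable_prod_abs_lin_rpow {ν : Measure (ℝ × ℝ)} [SFinite ν] {h : ℝ × ℝ → ℝ}
    {ζ : ℝ × ℝ → ℂ} {α : ℝ} (h0 : 0 ≤ α) (h1 : α < 1) (hh : Measurable h) (hζ : Measurable ζ)
    (hi : Integrable (fun p => h p * ‖ζ p‖ ^ (-α)) ν) :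
    Integrable (fun x : (ℝ × ℝ) × ℝ => h x.1 * |lin x.2 (ζ x.1)| ^ (-α)) (ν.prod circ) := by
  have hm : Measurable fun x : (ℝ × ℝ) × ℝ => h x.1 * |lin x.2 (ζ x.1)| ^ (-α) := by
    have : Measurable fun x : (ℝ × ℝ) × ℝ => lin x.2 (ζ x.1) :=
      continuous_lin.measurable.comp (measurable_snd.prodMk (hζ.comp measurable_fst))
    exact (hh.comp measurable_fst).mul ((this.abs).pow_const _)
  rw [integrable_prod_iff hm.aestronglyMeasurable]
  refine ⟨ae_of_all _ fun p => (integrable_abs_lin_rpow h0 h1 (ζ p)).const_mul (h p), ?_⟩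
  have e : ∀ p : ℝ × ℝ, ∫ φ, ‖h p * |lin φ (ζ p)| ^ (-α)‖ ∂circ =
      (4 * Real.pi) ^ (-α) * (∫ ω, |Real.sin ω| ^ (-α) ∂circ) * ‖h p * ‖ζ p‖ ^ (-α)‖ := by
    intro p
    have e1 : ∀ φ, ‖h p * |lin φ (ζ p)| ^ (-α)‖ = |h p| * |lin φ (ζ p)| ^ (-α) := fun φ => by
      rw [norm_mul, Real.norm_eq_abs, Real.norm_of_nonneg (by positivity)]
    simp_rw [e1]
    rw [integral_const_mul, integral_abs_lin_rpow, norm_mul, Real.norm_eq_abs,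
      Real.norm_of_nonneg (by positivity)]
    ring
  simp_rw [e]
  exact hi.norm.const_mul _

/-- The left side is the distance from `a` to the line through `0` and `wexp p`, read off as an
imaginary part after rotation. -/
lemma le_norm_wexp_sub (p : ℝ × ℝ) (a : ℂ) : ‖a‖ * |Real.sin (p.2 + -a.arg)| ≤ ‖wexp p - a‖ := by
  have h1 : ‖Complex.exp (-(p.2 : ℂ) * Complex.I) * (wexp p - a)‖ = ‖wexp p - a‖ := by
    rw [norm_mul, norm_exp_neg_mul_I, one_mul]
  rw [← h1]
  refine le_trans (le_of_eq ?_) (Complex.abs_im_le_norm _)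
  have h2 : Complex.exp (-(p.2 : ℂ) * Complex.I) * wexp p = Real.exp p.1 := by
    rw [wexp, ← Complex.exp_add, Complex.ofReal_exp]; congr 1; ring
  rw [mul_sub, h2, ← Complex.ofReal_neg, Complex.sub_im, Complex.ofReal_im, Complex.mul_im,
    Complex.exp_ofReal_mul_I_re, Complex.exp_ofReal_mul_I_im, zero_sub, abs_neg,
    ← Complex.norm_mul_cos_arg a, ← Complex.norm_mul_sin_arg a, Real.sin_add, Real.cos_neg,
    Real.sin_neg, Real.cos_neg, Real.sin_neg, ← abs_of_nonneg (norm_nonneg a), ← abs_mul,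
    abs_of_nonneg (norm_nonneg a), ← abs_neg]
  congr 1; ring

lemma ae_ann_fst_ne (c : ℝ) : ∀ᵐ p ∂ann, p.1 ≠ c :=
  Measure.quasiMeasurePreserving_fst.ae (Measure.ae_ne volume c)

lemma ae_wexp_ne (a : ℂ) : ∀ᵐ p ∂ann, wexp p - a ≠ 0 := by
  filter_upwards [ae_ann_fst_ne (Real.log ‖a‖)] with p hp h
  rw [sub_eq_zero] at h
  rw [← h, norm_wexp, Real.log_exp] at hp
  exact hp rfl

/-- The strip `|t| ≤ t₀`. -/
def strip (t₀ : ℝ) : Set (ℝ × ℝ) := {p | |p.1| ≤ t₀}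

lemma measurableSet_strip (t₀ : ℝ) : MeasurableSet (strip t₀) :=
  measurableSet_le (by fun_prop) measurable_const

lemma ann_restrict_strip (t₀ : ℝ) :
    ann.restrict (strip t₀) = (volume.restrict (Icc (-t₀) t₀)).prod circ := by
  have : strip t₀ = Icc (-t₀) t₀ ×ˢ univ := by
    ext p; simp [strip, abs_le]
  rw [this, ← Measure.prod_restrict, Measure.restrict_univ]

lemma integrableOn_strip_comp_snd {f : ℝ → ℝ} (hf : Integrable f circ) (t₀ : ℝ) :
    IntegrableOn (fun p : ℝ × ℝ => f p.2) (strip t₀) ann := by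
  rw [IntegrableOn, ann_restrict_strip]
  simpa using (integrable_const (μ := volume.restrict (Icc (-t₀) t₀)) (1 : ℝ)).mul_prod hf

lemma integrableOn_strip_norm_rpow {α : ℝ} (h0 : 0 ≤ α) (h1 : α < 1) {a : ℂ} (ha : a ≠ 0) (t₀ : ℝ) :
    IntegrableOn (fun p => ‖wexp p - a‖ ^ (-α)) (strip t₀) ann := by
  have hm : Measurable fun p => ‖wexp p - a‖ ^ (-α) := by
    have := continuous_wexp
    exact (Continuous.measurable (by fun_prop : Continuous fun p => ‖wexp p - a‖)).pow_const _
  have hi := (integrableOn_strip_comp_snd (integrable_abs_sin_rpow h0 h1 (-a.arg)) t₀).const_mul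
    (‖a‖ ^ (-α))
  refine Integrable.mono' hi hm.aestronglyMeasurable ?_
  have hs : ∀ᵐ p ∂ann, Real.sin (p.2 + -a.arg) ≠ 0 :=
    Measure.quasiMeasurePreserving_snd.ae (ae_sin_add_ne_zero (-a.arg))
  filter_upwards [ae_restrict_of_ae hs] with p hp
  have hn := norm_pos_iff.2 ha
  have hpos : 0 < ‖a‖ * |Real.sin (p.2 + -a.arg)| := mul_pos hn (abs_pos.2 hp)
  rw [Real.norm_of_nonneg (by positivity), ← Real.mul_rpow hn.le (abs_nonneg _)]
  exact Real.rpow_le_rpow_of_nonpos hpos (le_norm_wexp_sub p a) (by linarith)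

/-! ### The four frequencies and domination of the truncated integrals -/

/-- The four frequencies `w + 1/w - u`, `w - u`, `1/w - u`, `-u` of the Fourier integral. -/
def freq (u : ℂ) (j : Fin 4) (p : ℝ × ℝ) : ℂ :=
  ![wexp p + (wexp p)⁻¹ - u, wexp p - u, (wexp p)⁻¹ - u, -u] j

lemma measurable_freq (u : ℂ) (j : Fin 4) : Measurable (freq u j) := by
  have := continuous_wexp.measurable
  fin_cases j
  · exact (by fun_prop : Measurable fun p => wexp p + (wexp p)⁻¹ - u)
  · exact (by fun_prop : Measurable fun p => wexp p - u)
  · exact (by fun_prop : Measurable fun p => (wexp p)⁻¹ - u)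
  · exact measurable_const

/-- The radial integral `∫_0^T` of the phases with signs `+, -, -, +`. -/
def cutInt (u : ℂ) (T φ : ℝ) (p : ℝ × ℝ) : ℂ :=
  expInt (lin φ (freq u 0 p) * T) - expInt (lin φ (freq u 1 p) * T) -
    expInt (lin φ (freq u 2 p) * T) + expInt (lin φ (freq u 3 p) * T)

lemma freq_zero_sub_one (u : ℂ) (p : ℝ × ℝ) : freq u 0 p - freq u 1 p = (wexp p)⁻¹ := by
  simp [freq]
lemma freq_two_sub_three (u : ℂ) (p : ℝ × ℝ) : freq u 2 p - freq u 3 p = (wexp p)⁻¹ := by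
  simp [freq]
lemma freq_zero_sub_two (u : ℂ) (p : ℝ × ℝ) : freq u 0 p - freq u 2 p = wexp p := by
  simp [freq]
lemma freq_one_sub_three (u : ℂ) (p : ℝ × ℝ) : freq u 1 p - freq u 3 p = wexp p := by
  simp [freq]

lemma norm_wexp_inv (p : ℝ × ℝ) : ‖(wexp p)⁻¹‖ = Real.exp (-p.1) := by
  rw [norm_inv, norm_wexp, Real.exp_neg]

/-- The four terms can be grouped in pairs whose frequencies differ by `w`, or in pairs differing by
`1/w`. Taking the smaller difference, of modulus `e^{-|t|}`, produces the decay in `t`. -/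
lemma exists_norm_cutInt_le (u : ℂ) {α : ℝ} (hα : 0 < α) (hα1 : α ≤ 1) :
    ∃ C : ℝ, 0 < C ∧ ∀ T φ p, 0 < T → (∀ j, lin φ (freq u j p) ≠ 0) →
      ‖cutInt u T φ p‖ ≤
        C * (Real.exp (-α * |p.1|) * ∑ j, |lin φ (freq u j p)| ^ (-α)) := by
  obtain ⟨C, hC, h⟩ := exists_norm_expInt_sub_le hα hα1
  refine ⟨C * (4 * Real.pi) ^ α, by positivity, fun T φ p hT hne => ?_⟩
  have key : ∀ (x : ℝ) (ζ : ℂ), ‖ζ‖ = Real.exp (-|x|) →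
      |lin φ ζ| ^ α ≤ (4 * Real.pi) ^ α * Real.exp (-α * |x|) := by
    intro x ζ hζ
    have h1 := abs_lin_le φ ζ
    rw [hζ] at h1
    calc |lin φ ζ| ^ α ≤ (4 * Real.pi * Real.exp (-|x|)) ^ α :=
          Real.rpow_le_rpow (abs_nonneg _) h1 hα.le
      _ = _ := by
          rw [Real.mul_rpow (by positivity) (Real.exp_pos _).le, ← Real.exp_mul]
          ring_nf
  have pair : ∀ (i j k l : Fin 4) (ζ : ℂ), ‖ζ‖ = Real.exp (-|p.1|) →
      freq u i p - freq u j p = ζ → freq u k p - freq u l p = ζ →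
      ‖(expInt (lin φ (freq u i p) * T) - expInt (lin φ (freq u j p) * T)) -
        (expInt (lin φ (freq u k p) * T) - expInt (lin φ (freq u l p) * T))‖ ≤
      C * (4 * Real.pi) ^ α * (Real.exp (-α * |p.1|) * (|lin φ (freq u i p)| ^ (-α) +
        |lin φ (freq u j p)| ^ (-α) + |lin φ (freq u k p)| ^ (-α) +
        |lin φ (freq u l p)| ^ (-α))) := by
    intro i j k l ζ hζ h1 h2
    have b1 := h T _ _ hT (hne i) (hne j)
    have b2 := h T _ _ hT (hne k) (hne l)
    rw [← lin_sub, h1] at b1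
    rw [← lin_sub, h2] at b2
    have hk := key p.1 ζ hζ
    refine (norm_sub_le _ _).trans ((add_le_add b1 b2).trans ?_)
    rw [← mul_add, ← mul_add, mul_assoc C, ← mul_assoc ((4 * Real.pi) ^ α), ← add_assoc]
    gcongr
  rw [Fin.sum_univ_four]
  rcases le_total 0 p.1 with ht | ht
  · have hz : ‖(wexp p)⁻¹‖ = Real.exp (-|p.1|) := by rw [norm_wexp_inv, abs_of_nonneg ht]
    have := pair 0 1 2 3 _ hz (freq_zero_sub_one u p) (freq_two_sub_three u p)
    refine le_trans (le_of_eq ?_) this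
    unfold cutInt
    congr 1; ring
  · have hz : ‖wexp p‖ = Real.exp (-|p.1|) := by rw [norm_wexp, abs_of_nonpos ht, neg_neg]
    have := pair 0 2 1 3 _ hz (freq_zero_sub_two u p) (freq_one_sub_three u p)
    refine le_trans (le_of_eq ?_) (this.trans (le_of_eq ?_))
    · unfold cutInt
      congr 1; ring
    · ring

lemma wexp_inv_sub (u : ℂ) (hu : u ≠ 0) (p : ℝ × ℝ) :
    (wexp p)⁻¹ - u = -u * (wexp p)⁻¹ * (wexp p - u⁻¹) := by
  have := wexp_ne_zero p
  field_simp
  ring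

lemma wexp_add_inv_sub {u w₁ : ℂ} (hw : w₁ ≠ 0) (hu : w₁ + w₁⁻¹ = u) (p : ℝ × ℝ) :
    wexp p + (wexp p)⁻¹ - u = (wexp p)⁻¹ * (wexp p - w₁) * (wexp p - w₁⁻¹) := by
  have := wexp_ne_zero p
  rw [← hu]
  field_simp
  ring

lemma ae_freq_ne_zero {u w₁ : ℂ} (hu0 : u ≠ 0) (hw : w₁ ≠ 0) (hu : w₁ + w₁⁻¹ = u) :
    ∀ᵐ p ∂ann, ∀ j, freq u j p ≠ 0 := by
  filter_upwards [ae_wexp_ne w₁, ae_wexp_ne w₁⁻¹, ae_wexp_ne u, ae_wexp_ne u⁻¹] with p h1 h2 h3 h4 j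
  have hp := inv_ne_zero (wexp_ne_zero p)
  fin_cases j
  · simp only [freq, Matrix.cons_val_zero, Fin.zero_eta]
    rw [wexp_add_inv_sub hw hu]
    exact mul_ne_zero (mul_ne_zero hp h1) h2
  · simpa [freq] using h3
  · have : (wexp p)⁻¹ - u ≠ 0 := by
      rw [wexp_inv_sub u hu0]
      exact mul_ne_zero (mul_ne_zero (neg_ne_zero.2 hu0) hp) h4
    simpa [freq] using this
  · simpa [freq] using hu0

lemma measurableSet_lin_freq_ne_zero (u : ℂ) :
    MeasurableSet {x : (ℝ × ℝ) × ℝ | ∀ j, lin x.2 (freq u j x.1) ≠ 0} := by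
  have h : ∀ j, Measurable fun x : (ℝ × ℝ) × ℝ => lin x.2 (freq u j x.1) := fun j =>
    continuous_lin.measurable.comp (measurable_snd.prodMk ((measurable_freq u j).comp measurable_fst))
  have : {x : (ℝ × ℝ) × ℝ | ∀ j, lin x.2 (freq u j x.1) ≠ 0} =
      ⋂ j, {x : (ℝ × ℝ) × ℝ | lin x.2 (freq u j x.1) = 0}ᶜ := by ext; simp
  rw [this]
  exact MeasurableSet.iInter fun j => (measurableSet_eq_fun (h j) measurable_const).compl

lemma ae_lin_freq_ne_zero {u w₁ : ℂ} (hu0 : u ≠ 0) (hw : w₁ ≠ 0) (hu : w₁ + w₁⁻¹ = u) :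
    ∀ᵐ x ∂ann.prod circ, ∀ j, lin x.2 (freq u j x.1) ≠ 0 := by
  rw [Measure.ae_prod_iff_ae_ae (measurableSet_lin_freq_ne_zero u)]
  filter_upwards [ae_freq_ne_zero hu0 hw hu] with p hp
  rw [ae_all_iff]
  exact fun j => ae_lin_ne_zero (hp j)

lemma integrableOn_strip_weight {f : ℝ × ℝ → ℝ} {t₀ : ℝ} (hf : IntegrableOn f (strip t₀) ann)
    {g : ℝ × ℝ → ℝ} (hg : Measurable g) {C : ℝ} (hb : ∀ p ∈ strip t₀, |g p| ≤ C) :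
    IntegrableOn (fun p => g p * f p) (strip t₀) ann :=
  Integrable.bdd_mul hf hg.aestronglyMeasurable
    ((ae_restrict_iff' (measurableSet_strip t₀)).2 (ae_of_all _ hb))

/-- The zeros `w₁` and `1/w₁` of the first frequency merge when `u = ±2`. The exponent `1/4` leaves
room for this: the product of two such powers is bounded by the sum of the powers with exponent
`1/2`, which are still integrable. -/
lemma integrableOn_strip_freq {u w₁ : ℂ} (hu0 : u ≠ 0) (hw : w₁ ≠ 0) (hu : w₁ + w₁⁻¹ = u)
    (t₀ : ℝ) (j : Fin 4) :
    IntegrableOn (fun p => ‖freq u j p‖ ^ (-(1 / 4) : ℝ)) (strip t₀) ann := by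
  have hinv : ∀ p : ℝ × ℝ, ‖(wexp p)⁻¹‖ ^ (-(1 / 4) : ℝ) = Real.exp (p.1 / 4) := fun p => by
    rw [norm_wexp_inv, ← Real.exp_mul]; ring_nf
  have hbd : ∀ p ∈ strip t₀, |Real.exp (p.1 / 4)| ≤ Real.exp (t₀ / 4) := fun p hp => by
    rw [abs_of_pos (Real.exp_pos _), Real.exp_le_exp]
    have : |p.1| ≤ t₀ := hp
    linarith [le_abs_self p.1]
  have hme : Measurable fun p : ℝ × ℝ => Real.exp (p.1 / 4) := by fun_prop
  fin_cases j
  · have h1 := integrableOn_strip_norm_rpow (α := 1 / 2) (by norm_num) (by norm_num) hw t₀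
    have h2 := integrableOn_strip_norm_rpow (α := 1 / 2) (by norm_num) (by norm_num)
      (inv_ne_zero hw) t₀
    refine Integrable.mono' (integrableOn_strip_weight (h1.add h2) hme hbd)
      (((measurable_freq u 0).norm.pow_const _).aestronglyMeasurable) (ae_of_all _ fun p => ?_)
    have hsq : ∀ x : ℝ, 0 ≤ x → x ^ (-(1 / 2) : ℝ) = (x ^ (-(1 / 4) : ℝ)) ^ 2 := fun x hx => by
      rw [← Real.rpow_mul_natCast hx]; norm_num
    simp only [freq, Matrix.cons_val_zero, Fin.zero_eta, Pi.add_apply]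
    rw [wexp_add_inv_sub hw hu, norm_mul, norm_mul, Real.mul_rpow (by positivity) (norm_nonneg _),
      Real.mul_rpow (norm_nonneg _) (norm_nonneg _), hinv, Real.norm_of_nonneg (by positivity),
      mul_assoc, hsq _ (norm_nonneg _), hsq _ (norm_nonneg _)]
    gcongr
    have h3 := sq_nonneg (‖wexp p - w₁‖ ^ (-(1 / 4) : ℝ) - ‖wexp p - w₁⁻¹‖ ^ (-(1 / 4) : ℝ))
    have h4 : 0 ≤ ‖wexp p - w₁‖ ^ (-(1 / 4) : ℝ) * ‖wexp p - w₁⁻¹‖ ^ (-(1 / 4) : ℝ) := by positivity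
    linarith
  · simpa [freq] using integrableOn_strip_norm_rpow (α := 1 / 4) (by norm_num) (by norm_num) hu0 t₀
  · have h := integrableOn_strip_weight ((integrableOn_strip_norm_rpow (α := 1 / 4) (by norm_num)
      (by norm_num) (inv_ne_zero hu0) t₀).const_mul (‖u‖ ^ (-(1 / 4) : ℝ))) hme hbd
    refine h.congr_fun (fun p _ => ?_) (measurableSet_strip t₀)
    have e : freq u 2 p = -u * (wexp p)⁻¹ * (wexp p - u⁻¹) := by
      rw [← wexp_inv_sub u hu0]; simp [freq]
    simp only [Fin.reduceFinMk]
    rw [e, norm_mul, norm_mul, norm_neg, Real.mul_rpow (by positivity) (norm_nonneg _),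
      Real.mul_rpow (norm_nonneg _) (norm_nonneg _), hinv]
    ring
  · simpa [freq] using integrableOn_strip_comp_snd (integrable_const (‖u‖ ^ (-(1 / 4) : ℝ))) t₀

/-- Once `‖w‖` or its inverse is at least `X`, the large one exceeds `‖u‖` by at least 2 and the
small one is at most both `1` and `‖u‖/2`, so no frequency is close to zero. -/
lemma exists_le_norm_freq {u : ℂ} (hu0 : u ≠ 0) :
    ∃ t₀ c : ℝ, 0 < c ∧ ∀ p ∉ strip t₀, ∀ j, c ≤ ‖freq u j p‖ := by
  have hn := norm_pos_iff.2 hu0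
  set X := 2 + ‖u‖ + 2 / ‖u‖ with hX
  have hX0 : 0 < X := by positivity
  have hX2 : 2 ≤ X := by have : 0 < 2 / ‖u‖ := by positivity
                         linarith
  have hX1 : 2 + ‖u‖ ≤ X := by have : 0 < 2 / ‖u‖ := by positivity
                               linarith
  have hX3 : X⁻¹ ≤ ‖u‖ / 2 := by
    rw [← inv_div]
    exact inv_anti₀ (by positivity) (by linarith)
  refine ⟨Real.log X, min 1 (‖u‖ / 2), by positivity, fun p hp j => ?_⟩
  have hp : Real.log X < |p.1| := not_le.1 hp
  have hl : 0 < Real.log X := Real.log_pos (by linarith)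
  have hsmall : min 1 (‖u‖ / 2) ≤ ‖u‖ / 2 := min_le_right _ _
  have hone : min 1 (‖u‖ / 2) ≤ 1 := min_le_left _ _
  have tri : ∀ a b : ℂ, ‖a‖ - ‖b‖ ≤ ‖a - b‖ := norm_sub_norm_le
  have hXinv1 : X⁻¹ ≤ 1 := inv_le_one_of_one_le₀ (by linarith)
  have big : ∀ a : ℂ, X ≤ ‖a‖ → min 1 (‖u‖ / 2) ≤ ‖a - u‖ := fun a ha => by
    linarith [tri a u]
  have small : ∀ a : ℂ, ‖a‖ ≤ X⁻¹ → min 1 (‖u‖ / 2) ≤ ‖a - u‖ := fun a ha => by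
    rw [norm_sub_rev]; linarith [tri u a]
  have both : ∀ a b : ℂ, X ≤ ‖a‖ → ‖b‖ ≤ X⁻¹ → min 1 (‖u‖ / 2) ≤ ‖a + b - u‖ := fun a b ha hb => by
    have e : a + b - u = a - (u - b) := by ring
    rw [e]
    linarith [tri a (u - b), norm_sub_le u b]
  have hD : min 1 (‖u‖ / 2) ≤ ‖-u‖ := by rw [norm_neg]; linarith
  rcases lt_or_ge 0 p.1 with ht | ht
  · rw [abs_of_pos ht] at hp
    have hw : X ≤ ‖wexp p‖ := by
      rw [norm_wexp, ← Real.exp_log hX0]; exact Real.exp_le_exp.2 hp.le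
    have hwi : ‖(wexp p)⁻¹‖ ≤ X⁻¹ := by
      rw [norm_inv]; exact inv_anti₀ hX0 hw
    fin_cases j
    · exact both _ _ hw hwi
    · exact big _ hw
    · exact small _ hwi
    · exact hD
  · rw [abs_of_nonpos ht] at hp
    have hw : X ≤ ‖(wexp p)⁻¹‖ := by
      rw [norm_wexp_inv, ← Real.exp_log hX0]; exact Real.exp_le_exp.2 hp.le
    have hwi : ‖wexp p‖ ≤ X⁻¹ := by
      rw [norm_inv] at hw
      rw [← inv_inv ‖wexp p‖]
      exact inv_anti₀ hX0 hw
    fin_cases j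
    · have := both _ _ hw hwi
      rw [add_comm] at this
      exact this
    · exact small _ hwi
    · exact big _ hw
    · exact hD

/-- The truncated radial integrals are dominated by an integrable function, with a weight. -/
lemma exists_dominating {u w₁ : ℂ} (hu0 : u ≠ 0) (hw : w₁ ≠ 0) (hu : w₁ + w₁⁻¹ = u) {σ : ℝ}
    (h0 : 0 ≤ σ) (h1 : σ < 1 / 2) :
    ∃ B : (ℝ × ℝ) × ℝ → ℝ, Integrable B (ann.prod circ) ∧
      ∀ᵐ x ∂ann.prod circ, ∀ T, 0 < T →
        Real.exp (2 * σ * |x.1.1|) * ‖cutInt u T x.2 x.1‖ ≤ B x := by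
  -- The midpoint of `2σ` and `1`: large enough for the decay `e^{-α|t|}` to beat the weight outside
  -- the strip, and below 1 for integrability in `φ`. Inside the strip decay is irrelevant and the
  -- exponent `1/4` is used.
  set α := (1 + 2 * σ) / 2 with hα
  obtain ⟨C₁, hC₁, hb₁⟩ := exists_norm_cutInt_le u (α := 1 / 4) (by norm_num) (by norm_num)
  obtain ⟨C₂, hC₂, hb₂⟩ := exists_norm_cutInt_le u (α := α) (by linarith) (by linarith)
  obtain ⟨t₀, c, hc, hfar⟩ := exists_le_norm_freq hu0
  set b : ℝ → ℝ → (ℝ × ℝ) × ℝ → ℝ := fun C a x => C * ∑ j, Real.exp ((2 * σ - a) * |x.1.1|) *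
    |lin x.2 (freq u j x.1)| ^ (-a) with hb
  have hme : ∀ a : ℝ, Measurable fun p : ℝ × ℝ => Real.exp ((2 * σ - a) * |p.1|) := fun a => by
    fun_prop
  have prodset : ∀ s : Set (ℝ × ℝ), (ann.prod circ).restrict (s ×ˢ univ) =
      (ann.restrict s).prod circ := fun s => by
    rw [← Measure.prod_restrict, Measure.restrict_univ]
  set S : Set ((ℝ × ℝ) × ℝ) := strip t₀ ×ˢ univ with hS
  have hSm : MeasurableSet S := (measurableSet_strip t₀).prod MeasurableSet.univ
  have hSc : Sᶜ = (strip t₀)ᶜ ×ˢ univ := by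
    ext x; simp [hS]
  have i1 : IntegrableOn (b C₁ (1 / 4)) S (ann.prod circ) := by
    rw [IntegrableOn, prodset]
    refine Integrable.const_mul (integrable_finsetSum _ fun j _ => ?_) _
    refine integrable_prod_abs_lin_rpow (by norm_num) (by norm_num) (hme _) (measurable_freq u j) ?_
    refine integrableOn_strip_weight (integrableOn_strip_freq hu0 hw hu t₀ j) (hme _)
      (C := Real.exp (|2 * σ - 1 / 4| * t₀)) fun p hp => ?_
    have hp : |p.1| ≤ t₀ := hp
    rw [abs_of_pos (Real.exp_pos _), Real.exp_le_exp]
    calc (2 * σ - 1 / 4) * |p.1| ≤ |2 * σ - 1 / 4| * |p.1| := by gcongr; exact le_abs_self _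
      _ ≤ _ := by gcongr
  have i2 : IntegrableOn (b C₂ α) Sᶜ (ann.prod circ) := by
    rw [hSc, IntegrableOn, prodset]
    refine Integrable.const_mul (integrable_finsetSum _ fun j _ => ?_) _
    refine integrable_prod_abs_lin_rpow (by linarith) (by linarith) (hme _) (measurable_freq u j) ?_
    have hi := ((integrable_ann_exp (c := α - 2 * σ) (by linarith)).mul_const
      (c ^ (-α))).integrableOn (s := (strip t₀)ᶜ)
    refine Integrable.mono' hi (((hme _).mul ((measurable_freq u j).norm.pow_const _)).aestronglyMeasurable)
      ((ae_restrict_iff' (measurableSet_strip t₀).compl).2 (ae_of_all _ fun p hp => ?_))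
    rw [Real.norm_of_nonneg (by positivity)]
    have e : -(α - 2 * σ) = 2 * σ - α := by ring
    rw [e]
    have hneg : -α ≤ 0 := by linarith
    exact mul_le_mul_of_nonneg_left (Real.rpow_le_rpow_of_nonpos hc (hfar p hp j) hneg)
      (Real.exp_pos _).le
  classical
  refine ⟨S.piecewise (b C₁ (1 / 4)) (b C₂ α), Integrable.piecewise hSm i1 i2, ?_⟩
  have gen : ∀ C a T x, ‖cutInt u T x.2 x.1‖ ≤ C * (Real.exp (-a * |x.1.1|) *
      ∑ j, |lin x.2 (freq u j x.1)| ^ (-a)) →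
      Real.exp (2 * σ * |x.1.1|) * ‖cutInt u T x.2 x.1‖ ≤ b C a x := by
    intro C a T x h
    calc _ ≤ Real.exp (2 * σ * |x.1.1|) * (C * (Real.exp (-a * |x.1.1|) *
        ∑ j, |lin x.2 (freq u j x.1)| ^ (-a))) := by gcongr
      _ = _ := by
        simp only [hb]
        rw [← Finset.mul_sum, sub_mul, sub_eq_add_neg, Real.exp_add]
        ring_nf
  filter_upwards [ae_lin_freq_ne_zero hu0 hw hu] with x hx T hT
  by_cases hxS : x ∈ S
  · rw [piecewise_eq_of_mem _ _ _ hxS]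
    exact gen _ _ _ _ (hb₁ T x.2 x.1 hT hx)
  · rw [piecewise_eq_of_notMem _ _ _ hxS]
    exact gen _ _ _ _ (hb₂ T x.2 x.1 hT hx)

/-! ### The pointwise limit and its integrability -/

/-- The limit of `expInt (b * T) + log T`, up to an additive constant. -/
def limTerm (κ b : ℝ) : ℂ := -Real.log |b| + κ * Complex.I * SignType.sign b

/-- The limit of `cutInt`. -/
def limInt (κ : ℝ) (u : ℂ) (φ : ℝ) (p : ℝ × ℝ) : ℂ :=
  limTerm κ (lin φ (freq u 0 p)) - limTerm κ (lin φ (freq u 1 p)) -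
    limTerm κ (lin φ (freq u 2 p)) + limTerm κ (lin φ (freq u 3 p))

/-- `κ` is the imaginary part of the constant in the asymptotic expansion of `expInt` at `+∞`. -/
def IsJump (κ : ℝ) : Prop := ∀ b b' : ℝ, b ≠ 0 → b' ≠ 0 →
  Tendsto (fun T : ℝ => expInt (b * T) - expInt (b' * T)) atTop (𝓝 (limTerm κ b - limTerm κ b'))

/-- In a difference both `log T` and the common constant drop out. The value of `κ` is never needed,
because the sign terms average to zero. -/
lemma exists_isJump : ∃ κ, IsJump κ := by
  obtain ⟨c, κ, h1, h2⟩ := exists_expInt_asymptotics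
  have key : ∀ b : ℝ, b ≠ 0 →
      Tendsto (fun T : ℝ => expInt (b * T) + Real.log T) atTop (𝓝 (c + limTerm κ b)) := by
    intro b hb
    have h3 : Tendsto (fun T : ℝ => expInt (b * T) + Real.log |b * T| -
        κ * Complex.I * SignType.sign (b * T)) atTop (𝓝 c) := by
      rcases lt_or_gt_of_ne hb with h | h
      · exact h2.comp (tendsto_id.const_mul_atTop_of_neg h)
      · exact h1.comp (tendsto_id.const_mul_atTop h)
    refine (h3.add_const (limTerm κ b)).congr' ?_
    filter_upwards [eventually_gt_atTop 0] with T hT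
    rw [abs_mul, abs_of_pos hT, Real.log_mul (abs_ne_zero.2 hb) hT.ne', sign_mul, sign_pos hT, mul_one]
    simp only [limTerm]
    push_cast
    ring
  refine ⟨κ, fun b b' hb hb' => ?_⟩
  have h := (key b hb).sub (key b' hb')
  rw [add_sub_add_left_eq_sub] at h
  exact h.congr fun T => by ring

lemma tendsto_cutInt {κ : ℝ} (hκ : IsJump κ) {u : ℂ} {φ : ℝ} {p : ℝ × ℝ}
    (h : ∀ j, lin φ (freq u j p) ≠ 0) :
    Tendsto (fun T => cutInt u T φ p) atTop (𝓝 (limInt κ u φ p)) := by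
  have h1 := (hκ _ _ (h 0) (h 1)).sub (hκ _ _ (h 2) (h 3))
  have e : limInt κ u φ p = (limTerm κ (lin φ (freq u 0 p)) - limTerm κ (lin φ (freq u 1 p))) -
      (limTerm κ (lin φ (freq u 2 p)) - limTerm κ (lin φ (freq u 3 p))) := by
    unfold limInt; ring
  rw [e]
  exact h1.congr fun T => by unfold cutInt; ring

lemma measurable_lin_freq (u : ℂ) (j : Fin 4) :
    Measurable fun x : (ℝ × ℝ) × ℝ => lin x.2 (freq u j x.1) :=
  continuous_lin.measurable.comp (measurable_snd.prodMk ((measurable_freq u j).comp measurable_fst))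

lemma measurable_sign_cast : Measurable fun b : ℝ => (SignType.sign b : ℂ) := by
  have e : (fun b : ℝ => (SignType.sign b : ℂ)) =
      fun b => if 0 < b then 1 else if b < 0 then -1 else 0 := by
    funext b
    rw [sign_apply]
    split_ifs <;> simp
  rw [e]
  exact Measurable.ite measurableSet_Ioi measurable_const
    (Measurable.ite measurableSet_Iio measurable_const measurable_const)

lemma measurable_limTerm (κ : ℝ) : Measurable (limTerm κ) :=
  (by fun_prop : Measurable fun b : ℝ => -(Real.log |b| : ℂ)).add
    (measurable_sign_cast.const_mul (κ * Complex.I))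

lemma measurable_limInt (κ : ℝ) (u : ℂ) :
    Measurable fun x : (ℝ × ℝ) × ℝ => limInt κ u x.2 x.1 := by
  have h := fun j => (measurable_limTerm κ).comp (measurable_lin_freq u j)
  exact (((h 0).sub (h 1)).sub (h 2)).add (h 3)

lemma measurable_cutInt (u : ℂ) (T : ℝ) :
    Measurable fun x : (ℝ × ℝ) × ℝ => cutInt u T x.2 x.1 := by
  have h := fun j => continuous_expInt.measurable.comp ((measurable_lin_freq u j).mul_const T)
  exact (((h 0).sub (h 1)).sub (h 2)).add (h 3)

/-- The bound on the truncated integrals does not depend on `T` and so passes to the limit. -/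
lemma integrable_weight_limInt {κ : ℝ} (hκ : IsJump κ) {u w₁ : ℂ} (hu0 : u ≠ 0) (hw : w₁ ≠ 0)
    (hu : w₁ + w₁⁻¹ = u) {σ : ℝ} (h0 : 0 ≤ σ) (h1 : σ < 1 / 2) :
    Integrable (fun x : (ℝ × ℝ) × ℝ => Real.exp (2 * σ * |x.1.1|) * ‖limInt κ u x.2 x.1‖)
      (ann.prod circ) := by
  obtain ⟨B, hB, hb⟩ := exists_dominating hu0 hw hu h0 h1
  refine hB.mono' ?_ ?_
  · exact Measurable.aestronglyMeasurable
      ((by fun_prop : Measurable fun x : (ℝ × ℝ) × ℝ => Real.exp (2 * σ * |x.1.1|)).mul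
        (measurable_limInt κ u).norm)
  · filter_upwards [hb, ae_lin_freq_ne_zero hu0 hw hu] with x hx hne
    rw [Real.norm_of_nonneg (by positivity)]
    refine le_of_tendsto ((tendsto_cutInt hκ hne).norm.const_mul (Real.exp (2 * σ * |x.1.1|))) ?_
    filter_upwards [eventually_gt_atTop 0] with T hT using hx T hT

lemma integrable_chi_mul_limInt {κ : ℝ} (hκ : IsJump κ) {u w₁ : ℂ} (hu0 : u ≠ 0) (hw : w₁ ≠ 0)
    (hu : w₁ + w₁⁻¹ = u) {μ : ℂ} (hμ : |μ.re| < 1 / 2) (d : ℤ) :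
    Integrable (fun x : (ℝ × ℝ) × ℝ => chi μ d x.1 * limInt κ u x.2 x.1) (ann.prod circ) := by
  refine (integrable_weight_limInt hκ hu0 hw hu (abs_nonneg μ.re) hμ).mono' ?_ (ae_of_all _ fun x => ?_)
  · exact (((continuous_chi μ d).measurable.comp measurable_fst).mul
      (measurable_limInt κ u)).aestronglyMeasurable
  · rw [norm_mul]
    gcongr
    exact norm_chi_le μ d x.1

/-! ### The truncated Fourier integral -/

lemma integral_exp_sub_one_div (b T : ℝ) :
    ∫ x in (0 : ℝ)..T, (Complex.exp (Complex.I * (b * x : ℝ)) - 1) / (x : ℂ) = expInt (b * T) := by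
  have h := intervalIntegral.smul_integral_comp_mul_left (a := 0) (b := T)
    (fun τ : ℝ => (Complex.exp (Complex.I * τ) - 1) / (τ : ℂ)) b
  rw [mul_zero] at h
  rw [expInt, ← h, ← intervalIntegral.integral_smul]
  refine intervalIntegral.integral_congr fun x _ => ?_
  simp only [Complex.real_smul]
  rcases eq_or_ne b 0 with rfl | hb
  · simp
  · have : (b : ℂ) ≠ 0 := by exact_mod_cast hb
    push_cast
    rw [← mul_div_assoc, mul_div_mul_left _ _ this]

lemma intervalIntegrable_exp_sub_one_div (b T : ℝ) : IntervalIntegrable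
    (fun x : ℝ => (Complex.exp (Complex.I * (b * x : ℝ)) - 1) / (x : ℂ)) volume 0 T := by
  refine (intervalIntegrable_const (c := |b|)).mono_fun'
    (Measurable.aestronglyMeasurable (by fun_prop)) (ae_of_all _ fun x => ?_)
  beta_reduce
  rw [norm_div, Complex.norm_real]
  refine div_le_of_le_mul₀ (norm_nonneg _) (abs_nonneg _) ?_
  refine Real.norm_exp_I_mul_ofReal_sub_one_le.trans ?_
  rw [norm_mul, Real.norm_eq_abs b]

/-- The integrand of the Fourier integral before the integration over `w`. -/
def fullIntegrand (μ : ℂ) (d : ℤ) (y θ : ℝ) (q : (ℝ × ℝ) × (ℝ × ℝ)) : ℂ :=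
  chi μ d q.2 * (phasePair (4 * Real.pi * (q.1.1 * Complex.exp (q.1.2 * Complex.I))) q.2 *
    e (-2 * q.1.1 * y * Real.cos (q.1.2 + θ)) / q.1.1)

lemma norm_e (x : ℝ) : ‖e x‖ = 1 := by
  have : 2 * Real.pi * Complex.I * x = ((2 * Real.pi * x : ℝ) : ℂ) * Complex.I := by
    push_cast; ring
  rw [e, this, Complex.norm_exp_ofReal_mul_I]

lemma continuous_e : Continuous e := by unfold e; fun_prop

lemma measurable_fullIntegrand (μ : ℂ) (d : ℤ) (y θ : ℝ) : Measurable (fullIntegrand μ d y θ) := by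
  have h1 := continuous_phase
  have h2 := continuous_wexp
  have h3 := continuous_e
  have m1 : Continuous fun q : (ℝ × ℝ) × (ℝ × ℝ) =>
      phase (4 * Real.pi * (q.1.1 * Complex.exp (q.1.2 * Complex.I)) * wexp q.2) := by fun_prop
  have m2 : Continuous fun q : (ℝ × ℝ) × (ℝ × ℝ) =>
      phase (4 * Real.pi * (q.1.1 * Complex.exp (q.1.2 * Complex.I)) * wexp (-q.2)) := by fun_prop
  have m3 : Continuous fun q : (ℝ × ℝ) × (ℝ × ℝ) =>
      e (-2 * q.1.1 * y * Real.cos (q.1.2 + θ)) := by fun_prop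
  have m4 : Measurable fun q : (ℝ × ℝ) × (ℝ × ℝ) => (q.1.1 : ℂ) := by fun_prop
  exact ((continuous_chi μ d).measurable.comp measurable_snd).mul
    (((m1.mul m2).mul m3).measurable.div m4)

/-- The bound for the pair of phases is linear in the radius and cancels the `1/x`, so there is no
singularity at the origin. -/
lemma norm_fullIntegrand_le (μ : ℂ) (d : ℤ) (y θ : ℝ) {q : (ℝ × ℝ) × (ℝ × ℝ)} (hq : 0 < q.1.1) :
    ‖fullIntegrand μ d y θ q‖ ≤ 8 * Real.pi * Real.exp (-(1 - 2 * |μ.re|) * |q.2.1|) := by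
  have h := norm_chi_mul_phasePair_le μ d (4 * Real.pi * (q.1.1 * Complex.exp (q.1.2 * Complex.I))) q.2
  have hn : ‖(4 * Real.pi * (q.1.1 * Complex.exp (q.1.2 * Complex.I)) : ℂ)‖ = 4 * Real.pi * q.1.1 := by
    simp only [norm_mul, Complex.norm_exp_ofReal_mul_I, Complex.norm_real, Real.norm_eq_abs,
      abs_of_pos hq, abs_of_pos Real.pi_pos]
    norm_num
  rw [hn] at h
  unfold fullIntegrand
  rw [← mul_div_assoc, ← mul_assoc, norm_div, norm_mul, norm_e, mul_one, Complex.norm_real,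
    Real.norm_of_nonneg hq.le, div_le_iff₀ hq]
  refine h.trans (le_of_eq ?_)
  ring

lemma integrand_eq {μ : ℂ} (hμ : |μ.re| < 1 / 2) (d : ℤ) (y θ : ℝ) {x : ℝ} (hx : 0 < x) (φ : ℝ) :
    integrand μ d y θ x φ = (Real.pi ^ 2 : ℂ)⁻¹ * ∫ p, fullIntegrand μ d y θ ((x, φ), p) ∂ann := by
  have hx0 : (x : ℂ) ≠ 0 := by exact_mod_cast hx.ne'
  have hz : (x : ℂ) * Complex.exp (φ * Complex.I) ≠ 0 := mul_ne_zero hx0 (Complex.exp_ne_zero _)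
  unfold integrand fullIntegrand
  rw [boldM_eq hμ d hz, kernelInt]
  have e1 : ∀ p : ℝ × ℝ, chi μ d p * (phasePair (4 * Real.pi * (x * Complex.exp (φ * Complex.I))) p *
      e (-2 * x * y * Real.cos (φ + θ)) / x) =
      chi μ d p * phasePair (4 * Real.pi * (x * Complex.exp (φ * Complex.I))) p *
        (e (-2 * x * y * Real.cos (φ + θ)) / x) := fun p => by ring
  simp only [e1]
  rw [integral_mul_const]
  ring

lemma integrable_fullIntegrand {α : Type*} [MeasurableSpace α] {m : Measure α} [IsFiniteMeasure m]
    {f : α → ℝ × ℝ} (hf : Measurable f) (hpos : ∀ᵐ a ∂m, 0 < (f a).1)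
    {μ : ℂ} (hμ : |μ.re| < 1 / 2) (d : ℤ) (y θ : ℝ) :
    Integrable (fun q : α × (ℝ × ℝ) => fullIntegrand μ d y θ (f q.1, q.2)) (m.prod ann) := by
  have hi := ((integrable_const (μ := m) (1 : ℝ)).mul_prod (integrable_ann_exp
    (c := 1 - 2 * |μ.re|) (by linarith))).const_mul (8 * Real.pi)
  refine hi.mono' ((measurable_fullIntegrand μ d y θ).comp ((hf.comp measurable_fst).prodMk
    measurable_snd)).aestronglyMeasurable ?_
  filter_upwards [Measure.quasiMeasurePreserving_fst.ae hpos] with q hq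
  simpa using norm_fullIntegrand_le μ d y θ (q := (f q.1, q.2)) hq

lemma phase_mul_eq (x φ : ℝ) (ζ : ℂ) :
    phase (4 * Real.pi * (x * Complex.exp (φ * Complex.I)) * ζ) =
      Complex.exp (Complex.I * (lin φ ζ * x : ℝ)) - 1 := by
  have : 4 * Real.pi * (x * Complex.exp (φ * Complex.I)) * ζ =
      ((4 * Real.pi * x : ℝ) : ℂ) * (Complex.exp (φ * Complex.I) * ζ) := by push_cast; ring
  rw [phase, this, Complex.re_ofReal_mul, lin]
  congr 4; ring

lemma e_eq (x y φ θ : ℝ) : e (-2 * x * y * Real.cos (φ + θ)) =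
    Complex.exp (Complex.I * (lin φ (-(y * Complex.exp (θ * Complex.I))) * x : ℝ)) := by
  have h : (Complex.exp (φ * Complex.I) * (y * Complex.exp (θ * Complex.I))).re =
      y * Real.cos (φ + θ) := by
    rw [mul_left_comm, ← Complex.exp_add, Complex.re_ofReal_mul, ← add_mul, ← Complex.ofReal_add,
      Complex.exp_ofReal_mul_I_re]
  rw [lin_neg, lin, h, e]
  congr 1
  push_cast; ring

/-- Multiplying out gives four exponentials with signs `+, -, -, +`. The signs sum to zero, so 1 may
be subtracted from each, which makes every radial integral separately convergent at `0`. -/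
lemma integral_fullIntegrand (μ : ℂ) (d : ℤ) (y θ : ℝ) {T : ℝ} (hT : 0 < T) (φ : ℝ) (p : ℝ × ℝ) :
    ∫ x in Ioc 0 T, fullIntegrand μ d y θ ((x, φ), p) =
      chi μ d p * cutInt (y * Complex.exp (θ * Complex.I)) T φ p := by
  set u : ℂ := y * Complex.exp (θ * Complex.I) with hu
  set E : ℝ → ℝ → ℂ := fun b x => (Complex.exp (Complex.I * (b * x : ℝ)) - 1) / (x : ℂ) with hE
  have hpt : ∀ x : ℝ, fullIntegrand μ d y θ ((x, φ), p) = chi μ d p *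
      (E (lin φ (freq u 0 p)) x - E (lin φ (freq u 1 p)) x - E (lin φ (freq u 2 p)) x +
        E (lin φ (freq u 3 p)) x) := by
    intro x
    have l0 : lin φ (freq u 0 p) = lin φ (wexp p) + lin φ (wexp p)⁻¹ + lin φ (-u) := by
      rw [← lin_add, ← lin_add]; rfl
    have l1 : lin φ (freq u 1 p) = lin φ (wexp p) + lin φ (-u) := by
      rw [← lin_add]; rfl
    have l2 : lin φ (freq u 2 p) = lin φ (wexp p)⁻¹ + lin φ (-u) := by
      rw [← lin_add]; rfl
    have l3 : lin φ (freq u 3 p) = lin φ (-u) := rfl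
    have hexp : ∀ b c : ℝ, Complex.exp (Complex.I * ((b + c) * x : ℝ)) =
        Complex.exp (Complex.I * (b * x : ℝ)) * Complex.exp (Complex.I * (c * x : ℝ)) := by
      intro b c
      rw [← Complex.exp_add]; congr 1; push_cast; ring
    simp only [fullIntegrand, phasePair, wexp_neg, phase_mul_eq, e_eq, ← hu, hE, l0, l1, l2, l3, hexp]
    ring
  have hi := fun b => intervalIntegrable_exp_sub_one_div b T
  simp_rw [hpt]
  rw [integral_const_mul, ← intervalIntegral.integral_of_le hT.le,
    intervalIntegral.integral_add (((hi _).sub (hi _)).sub (hi _)) (hi _),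
    intervalIntegral.integral_sub ((hi _).sub (hi _)) (hi _),
    intervalIntegral.integral_sub (hi _) (hi _)]
  simp only [integral_exp_sub_one_div, cutInt]

lemma ae_restrict_Ioc_pos (T : ℝ) : ∀ᵐ x ∂volume.restrict (Ioc 0 T), (0 : ℝ) < x :=
  (ae_restrict_iff' measurableSet_Ioc).2 (ae_of_all _ fun _ hx => hx.1)

lemma integrable_integrand_disc {μ : ℂ} (hμ : |μ.re| < 1 / 2) (d : ℤ) (y θ T : ℝ) :
    Integrable (fun q : ℝ × ℝ => integrand μ d y θ q.1 q.2)
      ((volume.restrict (Ioc 0 T)).prod circ) := by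
  have hpos : ∀ᵐ q ∂(volume.restrict (Ioc 0 T)).prod circ, 0 < q.1 :=
    Measure.quasiMeasurePreserving_fst.ae (ae_restrict_Ioc_pos T)
  have h := (integrable_fullIntegrand (f := fun q : ℝ × ℝ => q) measurable_id hpos hμ d y θ).integral_prod_left
  refine (h.const_mul (Real.pi ^ 2 : ℂ)⁻¹).congr ?_
  filter_upwards [hpos] with q hq
  rw [integrand_eq hμ d y θ hq]

lemma integrable_fullIntegrand_slice {μ : ℂ} (hμ : |μ.re| < 1 / 2) (d : ℤ) (y θ T φ : ℝ) :
    Integrable (fun q : ℝ × (ℝ × ℝ) => fullIntegrand μ d y θ ((q.1, φ), q.2))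
      ((volume.restrict (Ioc 0 T)).prod ann) :=
  integrable_fullIntegrand (f := fun x : ℝ => (x, φ)) (by fun_prop) (ae_restrict_Ioc_pos T) hμ d y θ

lemma integrable_integrand_slice {μ : ℂ} (hμ : |μ.re| < 1 / 2) (d : ℤ) (y θ T φ : ℝ) :
    Integrable (fun x => integrand μ d y θ x φ) (volume.restrict (Ioc 0 T)) := by
  refine ((integrable_fullIntegrand_slice hμ d y θ T φ).integral_prod_left.const_mul
    (Real.pi ^ 2 : ℂ)⁻¹).congr ?_
  filter_upwards [ae_restrict_Ioc_pos T] with x hx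
  rw [integrand_eq hμ d y θ hx]

lemma integral_integrand_slice {μ : ℂ} (hμ : |μ.re| < 1 / 2) (d : ℤ) (y θ : ℝ) {T : ℝ} (hT : 0 < T)
    (φ : ℝ) : ∫ x in Ioc 0 T, integrand μ d y θ x φ =
      (Real.pi ^ 2 : ℂ)⁻¹ * ∫ p, chi μ d p * cutInt (y * Complex.exp (θ * Complex.I)) T φ p ∂ann := by
  rw [setIntegral_congr_fun measurableSet_Ioc fun x hx => integrand_eq hμ d y θ hx.1 φ,
    integral_const_mul, integral_integral_swap (integrable_fullIntegrand_slice hμ d y θ T φ)]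
  simp_rw [integral_fullIntegrand μ d y θ hT]

/-! ### Convergence as an iterated and as a double integral -/

/-- The value of the Fourier integral, before its evaluation in closed form. -/
def fourierValue (μ : ℂ) (d : ℤ) (κ : ℝ) (u : ℂ) : ℂ :=
  (Real.pi ^ 2 : ℂ)⁻¹ * ∫ p, chi μ d p * ∫ φ, limInt κ u φ p ∂circ ∂ann

section Convergence

variable {μ : ℂ} {κ : ℝ} {u w₁ : ℂ}

lemma measurable_chi_mul_cutInt (μ : ℂ) (d : ℤ) (u : ℂ) (T : ℝ) :
    Measurable fun x : (ℝ × ℝ) × ℝ => chi μ d x.1 * cutInt u T x.2 x.1 :=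
  ((continuous_chi μ d).measurable.comp measurable_fst).mul (measurable_cutInt u T)

/-- Slicing the dominating function by `φ` serves both senses of convergence: the pointwise limit in
`φ` gives the iterated integral, and the bound `B`, integrable in `φ` and free of `T`, gives the
double integral. -/
lemma exists_dominating_slices (hμ : |μ.re| < 1 / 2) (d : ℤ) (hκ : IsJump κ) (hu0 : u ≠ 0)
    (hw : w₁ ≠ 0) (hu : w₁ + w₁⁻¹ = u) :
    ∃ B : ℝ → ℝ, Integrable B circ ∧ ∀ᵐ φ ∂circ,
      (∀ T, 0 < T → ‖∫ p, chi μ d p * cutInt u T φ p ∂ann‖ ≤ B φ) ∧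
      Tendsto (fun T => ∫ p, chi μ d p * cutInt u T φ p ∂ann) atTop
        (𝓝 (∫ p, chi μ d p * limInt κ u φ p ∂ann)) := by
  obtain ⟨B, hB, hb⟩ := exists_dominating hu0 hw hu (abs_nonneg μ.re) hμ
  have hae : ∀ᵐ x ∂circ.prod ann, (∀ T, 0 < T →
      Real.exp (2 * |μ.re| * |x.2.1|) * ‖cutInt u T x.1 x.2‖ ≤ B (x.2, x.1)) ∧
      ∀ j, lin x.1 (freq u j x.2) ≠ 0 :=
    Measure.measurePreserving_swap.quasiMeasurePreserving.ae (hb.and (ae_lin_freq_ne_zero hu0 hw hu))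
  refine ⟨fun φ => ∫ p, B (p, φ) ∂ann, hB.integral_prod_right, ?_⟩
  filter_upwards [Measure.ae_ae_of_ae_prod hae, hB.prod_left_ae] with φ hφ hBφ
  have hbd : ∀ T, 0 < T → ∀ᵐ p ∂ann, ‖chi μ d p * cutInt u T φ p‖ ≤ B (p, φ) := fun T hT => by
    filter_upwards [hφ] with p hp
    refine le_trans ?_ (hp.1 T hT)
    rw [norm_mul]
    gcongr
    exact norm_chi_le μ d p
  refine ⟨fun T hT => norm_integral_le_of_norm_le hBφ (hbd T hT), ?_⟩
  refine tendsto_integral_filter_of_dominated_convergence (fun p => B (p, φ))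
    (Eventually.of_forall fun T => ?_) ?_ hBφ ?_
  · exact ((measurable_chi_mul_cutInt μ d u T).comp
      (measurable_id.prodMk measurable_const)).aestronglyMeasurable
  · filter_upwards [eventually_gt_atTop 0] with T hT using hbd T hT
  · filter_upwards [hφ] with p hp
    exact (tendsto_cutInt hκ hp.2).const_mul _

lemma integrable_integral_limInt (hμ : |μ.re| < 1 / 2) (d : ℤ) (hκ : IsJump κ) (hu0 : u ≠ 0)
    (hw : w₁ ≠ 0) (hu : w₁ + w₁⁻¹ = u) :
    Integrable (fun φ => (Real.pi ^ 2 : ℂ)⁻¹ * ∫ p, chi μ d p * limInt κ u φ p ∂ann) circ :=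
  (integrable_chi_mul_limInt hκ hu0 hw hu hμ d).integral_prod_right.const_mul _

lemma integral_integral_limInt (hμ : |μ.re| < 1 / 2) (d : ℤ) (hκ : IsJump κ) (hu0 : u ≠ 0)
    (hw : w₁ ≠ 0) (hu : w₁ + w₁⁻¹ = u) :
    ∫ φ, (Real.pi ^ 2 : ℂ)⁻¹ * ∫ p, chi μ d p * limInt κ u φ p ∂ann ∂circ =
      fourierValue μ d κ u := by
  rw [integral_const_mul, fourierValue,
    ← integral_integral_swap (integrable_chi_mul_limInt hκ hu0 hw hu hμ d)]
  simp_rw [integral_const_mul]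

end Convergence

lemma convergesAsIteratedIntegral {μ : ℂ} (hμ : |μ.re| < 1 / 2) (d : ℤ) {κ y θ : ℝ} (hκ : IsJump κ)
    (hy : 0 < y) {w₁ : ℂ} (hw : w₁ ≠ 0) (hu : w₁ + w₁⁻¹ = y * Complex.exp (θ * Complex.I)) :
    ConvergesAsIteratedIntegral (integrand μ d y θ)
      (fourierValue μ d κ (y * Complex.exp (θ * Complex.I))) := by
  have hu0 : (y : ℂ) * Complex.exp (θ * Complex.I) ≠ 0 :=
    mul_ne_zero (by exact_mod_cast hy.ne') (Complex.exp_ne_zero _)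
  obtain ⟨B, hB, hb⟩ := exists_dominating_slices hμ d hκ hu0 hw hu
  refine ⟨_, ?_, integrable_integral_limInt hμ d hκ hu0 hw hu,
    integral_integral_limInt hμ d hκ hu0 hw hu⟩
  filter_upwards [hb] with φ hφ
  refine ⟨fun T _ => integrable_integrand_slice hμ d y θ T φ, ?_⟩
  refine (hφ.2.const_mul (Real.pi ^ 2 : ℂ)⁻¹).congr' ?_
  filter_upwards [eventually_gt_atTop 0] with T hT
  rw [integral_integrand_slice hμ d y θ hT]

lemma convergesAsDoubleIntegral {μ : ℂ} (hμ : |μ.re| < 1 / 2) (d : ℤ) {κ y θ : ℝ} (hκ : IsJump κ)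
    (hy : 0 < y) {w₁ : ℂ} (hw : w₁ ≠ 0) (hu : w₁ + w₁⁻¹ = y * Complex.exp (θ * Complex.I)) :
    ConvergesAsDoubleIntegral (integrand μ d y θ)
      (fourierValue μ d κ (y * Complex.exp (θ * Complex.I))) := by
  set u : ℂ := y * Complex.exp (θ * Complex.I) with hu_def
  have hu0 : u ≠ 0 := mul_ne_zero (by exact_mod_cast hy.ne') (Complex.exp_ne_zero _)
  obtain ⟨B, hB, hb⟩ := exists_dominating_slices hμ d hκ hu0 hw hu
  have hprod : ∀ T : ℝ, (volume : Measure (ℝ × ℝ)).restrict (Ioc 0 T ×ˢ Ioc 0 (2 * Real.pi)) =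
      (volume.restrict (Ioc 0 T)).prod circ := fun T => by
    rw [Measure.volume_eq_prod, Measure.prod_restrict]
  refine ⟨fun T _ => ?_, ?_⟩
  · rw [IntegrableOn, hprod]
    exact integrable_integrand_disc hμ d y θ T
  rw [← integral_integral_limInt hμ d hκ hu0 hw hu]
  -- A second dominated convergence, now in `φ`, for the radial integrals already integrated over
  -- `w`.
  have hlim : Tendsto (fun T => ∫ φ, (Real.pi ^ 2 : ℂ)⁻¹ * ∫ p, chi μ d p * cutInt u T φ p ∂ann ∂circ)
      atTop (𝓝 (∫ φ, (Real.pi ^ 2 : ℂ)⁻¹ * ∫ p, chi μ d p * limInt κ u φ p ∂ann ∂circ)) := by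
    refine tendsto_integral_filter_of_dominated_convergence (fun φ => ‖(Real.pi ^ 2 : ℂ)⁻¹‖ * B φ)
      (Eventually.of_forall fun T => ?_) ?_ (hB.const_mul _) ?_
    · exact ((measurable_chi_mul_cutInt μ d u T).comp
        measurable_swap).stronglyMeasurable.integral_prod_right'.aestronglyMeasurable.const_mul _
    · filter_upwards [eventually_gt_atTop 0] with T hT
      filter_upwards [hb] with φ hφ
      rw [norm_mul]
      gcongr
      exact hφ.1 T hT
    · filter_upwards [hb] with φ hφ using hφ.2.const_mul _
  refine hlim.congr' ?_
  filter_upwards [eventually_gt_atTop 0] with T hT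
  rw [hprod, integral_prod_symm _ (integrable_integrand_disc hμ d y θ T)]
  refine integral_congr_ae (ae_of_all _ fun φ => ?_)
  exact (integral_integrand_slice hμ d y θ hT φ).symm

/-! ### Averaging the limit over the angle `φ` -/

lemma integrable_log_abs_sin (c : ℝ) :
    Integrable (fun φ => Real.log |Real.sin (φ + c)|) circ := by
  simp_rw [Real.log_abs]
  exact integrable_circ_comp_add (f := fun φ => Real.log (Real.sin φ))
    (fun a b => intervalIntegrable_log_sin) c

lemma integral_log_abs_sin (c : ℝ) :
    ∫ φ, Real.log |Real.sin (φ + c)| ∂circ = ∫ φ, Real.log |Real.sin φ| ∂circ :=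
  integral_circ_comp_add (f := fun φ => Real.log |Real.sin φ|)
    (fun x => by simp [Real.sin_add_two_pi]) c

lemma log_abs_lin {ζ : ℂ} (hζ : ζ ≠ 0) {φ : ℝ} (h : Real.sin (φ + (ζ.arg + Real.pi / 2)) ≠ 0) :
    Real.log |lin φ ζ| = Real.log (4 * Real.pi) + Real.log ‖ζ‖ +
      Real.log |Real.sin (φ + (ζ.arg + Real.pi / 2))| := by
  have hn := norm_pos_iff.2 hζ
  rw [lin_eq_sin, abs_mul, abs_of_pos (by positivity), Real.log_mul (by positivity) (abs_ne_zero.2 h),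
    Real.log_mul (by positivity) hn.ne']

lemma ae_log_abs_lin {ζ : ℂ} (hζ : ζ ≠ 0) : ∀ᵐ φ ∂circ,
    Real.log |lin φ ζ| = Real.log (4 * Real.pi) + Real.log ‖ζ‖ +
      Real.log |Real.sin (φ + (ζ.arg + Real.pi / 2))| := by
  filter_upwards [ae_sin_add_ne_zero (ζ.arg + Real.pi / 2)] with φ hφ using log_abs_lin hζ hφ

lemma integrable_log_abs_lin {ζ : ℂ} (hζ : ζ ≠ 0) :
    Integrable (fun φ => Real.log |lin φ ζ|) circ :=
  ((integrable_const _).add (integrable_log_abs_sin _)).congr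
    (by filter_upwards [ae_log_abs_lin hζ] with φ hφ using hφ.symm)

/-- The linear form is `4π‖ζ‖` times a shifted sine, so `ζ` enters the average only through `log
‖ζ‖`; the other summand is a constant that the signs `+, -, -, +` remove. -/
lemma integral_log_abs_lin {ζ : ℂ} (hζ : ζ ≠ 0) :
    ∫ φ, Real.log |lin φ ζ| ∂circ = 2 * Real.pi * Real.log ‖ζ‖ +
      (2 * Real.pi * Real.log (4 * Real.pi) + ∫ φ, Real.log |Real.sin φ| ∂circ) := by
  rw [integral_congr_ae (ae_log_abs_lin hζ), integral_add (integrable_const _)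
    (integrable_log_abs_sin _), integral_const, circ_real_univ, integral_log_abs_sin, smul_eq_mul]
  ring

lemma lin_add_pi (φ : ℝ) (ζ : ℂ) : lin (φ + Real.pi) ζ = -lin φ ζ := by
  rw [lin_eq_sin, lin_eq_sin, add_right_comm, Real.sin_add_pi]
  ring

lemma measurable_lin_left (ζ : ℂ) : Measurable fun φ => lin φ ζ := by
  unfold lin; fun_prop

lemma integrable_sign_lin (ζ : ℂ) : Integrable (fun φ => (SignType.sign (lin φ ζ) : ℂ)) circ := by
  refine (integrable_const (1 : ℝ)).mono'
    (measurable_sign_cast.comp (measurable_lin_left ζ)).aestronglyMeasurable (ae_of_all _ fun φ => ?_)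
  rcases lt_trichotomy (lin φ ζ) 0 with h | h | h <;> simp [h]

/-- The form changes sign under `φ ↦ φ + π`, which preserves the average. -/
lemma integral_sign_lin (ζ : ℂ) : ∫ φ, (SignType.sign (lin φ ζ) : ℂ) ∂circ = 0 := by
  have hper : Function.Periodic (fun φ => (SignType.sign (lin φ ζ) : ℂ)) (2 * Real.pi) := fun φ => by
    beta_reduce
    rw [two_mul, ← add_assoc, lin_add_pi, lin_add_pi, neg_neg]
  have h := integral_circ_comp_add hper Real.pi
  have e : ∀ φ, (SignType.sign (lin (φ + Real.pi) ζ) : ℂ) = -(SignType.sign (lin φ ζ) : ℂ) :=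
    fun φ => by
      rw [lin_add_pi, Left.sign_neg]
      rcases lt_trichotomy (lin φ ζ) 0 with h | h | h <;> simp [h]
  simp_rw [e] at h
  rw [integral_neg] at h
  linear_combination -(1 / 2) * h

lemma integrable_limTerm_lin (κ : ℝ) {ζ : ℂ} (hζ : ζ ≠ 0) :
    Integrable (fun φ => limTerm κ (lin φ ζ)) circ :=
  (integrable_log_abs_lin hζ).ofReal.neg.add ((integrable_sign_lin ζ).const_mul _)

lemma integral_limTerm_lin (κ : ℝ) {ζ : ℂ} (hζ : ζ ≠ 0) :
    ∫ φ, limTerm κ (lin φ ζ) ∂circ = -((2 * Real.pi * Real.log ‖ζ‖ +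
      (2 * Real.pi * Real.log (4 * Real.pi) + ∫ φ, Real.log |Real.sin φ| ∂circ) : ℝ) : ℂ) := by
  unfold limTerm
  rw [integral_add (f := fun φ => -(Real.log |lin φ ζ| : ℂ)) (integrable_log_abs_lin hζ).ofReal.neg ((integrable_sign_lin ζ).const_mul _),
    integral_neg, integral_const_mul, integral_sign_lin, mul_zero, add_zero, integral_complex_ofReal,
    integral_log_abs_lin hζ]

lemma integral_sub_sub_add {α E : Type*} [MeasurableSpace α] {m : Measure α}
    [NormedAddCommGroup E] [NormedSpace ℝ E] {f₀ f₁ f₂ f₃ : α → E}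
    (h₀ : Integrable f₀ m) (h₁ : Integrable f₁ m) (h₂ : Integrable f₂ m) (h₃ : Integrable f₃ m) :
    ∫ a, f₀ a - f₁ a - f₂ a + f₃ a ∂m =
      ∫ a, f₀ a ∂m - ∫ a, f₁ a ∂m - ∫ a, f₂ a ∂m + ∫ a, f₃ a ∂m := by
  rw [integral_add (f := fun a => f₀ a - f₁ a - f₂ a) ((h₀.sub h₁).sub h₂) h₃,
    integral_sub (f := fun a => f₀ a - f₁ a) (h₀.sub h₁) h₂, integral_sub h₀ h₁]

/-- The combination of logarithms obtained by averaging `limInt` over the circle. -/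
def logComb (q₁ q₂ : ℝ × ℝ) (p : ℝ × ℝ) : ℝ :=
  Real.log ‖wexp p - wexp q₁‖ - Real.log ‖wexp p - wexp q₂‖ -
    Real.log ‖wexp p - wexp (-q₂)‖ + Real.log ‖wexp p - wexp (-q₁)‖

/-- Factor `w + 1/w - u = w⁻¹ (w - w₁)(w - 1/w₁)` and `1/w - u = -u w⁻¹ (w - 1/u)`. In the
alternating sum `log ‖w‖`, `log ‖u‖` and the universal constants cancel. -/
lemma ae_integral_limInt (κ : ℝ) {q₁ q₂ : ℝ × ℝ} (hq : wexp q₁ + (wexp q₁)⁻¹ = wexp q₂) :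
    ∀ᵐ p ∂ann, ∫ φ, limInt κ (wexp q₂) φ p ∂circ = ((-(2 * Real.pi) * logComb q₁ q₂ p : ℝ) : ℂ) := by
  filter_upwards [ae_freq_ne_zero (wexp_ne_zero q₂) (wexp_ne_zero q₁) hq, ae_wexp_ne (wexp q₁),
    ae_wexp_ne (wexp q₁)⁻¹, ae_wexp_ne (wexp q₂)⁻¹] with p hp n1 n1' n2'
  have i := fun j => integrable_limTerm_lin κ (hp j)
  have hexp : ‖wexp p‖ ≠ 0 := norm_ne_zero_iff.2 (wexp_ne_zero p)
  have hu : ‖wexp q₂‖ ≠ 0 := norm_ne_zero_iff.2 (wexp_ne_zero q₂)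
  have l0 : Real.log ‖freq (wexp q₂) 0 p‖ = -Real.log ‖wexp p‖ + Real.log ‖wexp p - wexp q₁‖ +
      Real.log ‖wexp p - wexp (-q₁)‖ := by
    have : freq (wexp q₂) 0 p = _ := wexp_add_inv_sub (wexp_ne_zero q₁) hq p
    rw [this, wexp_neg, norm_mul, norm_mul, norm_inv, Real.log_mul (mul_ne_zero (inv_ne_zero hexp)
      (norm_ne_zero_iff.2 n1)) (norm_ne_zero_iff.2 n1'), Real.log_mul (inv_ne_zero hexp)
      (norm_ne_zero_iff.2 n1), Real.log_inv]
  have l1 : Real.log ‖freq (wexp q₂) 1 p‖ = Real.log ‖wexp p - wexp q₂‖ := rfl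
  have l2 : Real.log ‖freq (wexp q₂) 2 p‖ = Real.log ‖wexp q₂‖ - Real.log ‖wexp p‖ +
      Real.log ‖wexp p - wexp (-q₂)‖ := by
    have : freq (wexp q₂) 2 p = _ := wexp_inv_sub _ (wexp_ne_zero q₂) p
    rw [this, wexp_neg, norm_mul, norm_mul, norm_neg, norm_inv, Real.log_mul (mul_ne_zero hu
      (inv_ne_zero hexp)) (norm_ne_zero_iff.2 n2'), Real.log_mul hu (inv_ne_zero hexp), Real.log_inv]
    ring
  have l3 : Real.log ‖freq (wexp q₂) 3 p‖ = Real.log ‖wexp q₂‖ := by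
    have : freq (wexp q₂) 3 p = -wexp q₂ := rfl
    rw [this, norm_neg]
  unfold limInt
  rw [integral_sub_sub_add (i 0) (i 1) (i 2) (i 3), integral_limTerm_lin κ (hp 0), integral_limTerm_lin κ (hp 1),
    integral_limTerm_lin κ (hp 2), integral_limTerm_lin κ (hp 3), l0, l1, l2, l3, logComb]
  push_cast
  ring

/-! ### Fourier coefficients of `log |w - a|` on circles -/

lemma integral_circ_exp_mul_cos (k : ℤ) {n : ℕ} (hn : n ≠ 0) :
    ∫ ω : ℝ, Complex.exp (k * ω * Complex.I) * Complex.cos (n * ω) ∂circ =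
      if n = k.natAbs then (Real.pi : ℂ) else 0 := by
  have e : ∀ ω : ℝ, Complex.exp (k * ω * Complex.I) * Complex.cos (n * ω) =
      1 / 2 * Complex.exp ((k + n : ℤ) * ω * Complex.I) +
      1 / 2 * Complex.exp ((k - n : ℤ) * ω * Complex.I) := fun ω => by
    have h1 : ((k + n : ℤ) : ℂ) * ω * Complex.I = k * ω * Complex.I + n * ω * Complex.I := by
      push_cast; ring
    have h2 : ((k - n : ℤ) : ℂ) * ω * Complex.I = k * ω * Complex.I + -(n * ω) * Complex.I := by
      push_cast; ring
    rw [Complex.cos, h1, h2, Complex.exp_add, Complex.exp_add]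
    ring
  have hc : ∀ m : ℤ, Integrable (fun ω : ℝ => 1 / 2 * Complex.exp (m * ω * Complex.I)) circ :=
    fun m => Continuous.integrableOn_Ioc (by fun_prop)
  simp_rw [e]
  rw [integral_add (hc _) (hc _), integral_const_mul, integral_const_mul, integral_circ_exp,
    integral_circ_exp]
  split_ifs <;> first | omega | simp

/-- Fourier coefficients of `log |1 - ρ e^{iω}|`. -/
lemma integral_exp_mul_log_norm_one_sub (k : ℤ) {ρ : ℝ} (h0 : 0 ≤ ρ) (h1 : ρ < 1) :
    ∫ ω : ℝ, Complex.exp (k * ω * Complex.I) *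
      (Real.log ‖1 - ρ * Complex.exp (ω * Complex.I)‖ : ℝ) ∂circ =
      if k = 0 then 0 else -(Real.pi / k.natAbs * ρ ^ k.natAbs : ℂ) := by
  set F : ℕ → ℝ → ℂ := fun n ω =>
    Complex.exp (k * ω * Complex.I) * ((ρ ^ n / n : ℂ) * Complex.cos (n * ω)) with hF
  have hFn : ∀ n ω, ‖F n ω‖ ≤ ρ ^ n := fun n ω => by
    have : (n * ω : ℂ) = ((n * ω : ℝ) : ℂ) := by push_cast; rfl
    have h2 : Complex.exp (k * ω * Complex.I) = Complex.exp ((k * ω : ℝ) * Complex.I) := by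
      push_cast; rfl
    simp only [hF]
    rw [norm_mul, h2, Complex.norm_exp_ofReal_mul_I, one_mul, this, ← Complex.ofReal_cos, norm_mul,
      norm_div, norm_pow, Complex.norm_real, Complex.norm_real, Real.norm_of_nonneg h0,
      Complex.norm_natCast, Real.norm_eq_abs]
    have h3 : ρ ^ n / n ≤ ρ ^ n := by
      rcases Nat.eq_zero_or_pos n with rfl | hn
      · simp
      · exact div_le_self (pow_nonneg h0 _) (by exact_mod_cast hn)
    exact (mul_le_of_le_one_right (by positivity) (Real.abs_cos_le_one _)).trans h3
  have hsum := hasSum_integral_of_dominated_convergence (μ := circ) (F := F)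
    (f := fun ω => -(Complex.exp (k * ω * Complex.I) *
      (Real.log ‖1 - ρ * Complex.exp (ω * Complex.I)‖ : ℝ)))
    (fun n _ => ρ ^ n) (fun n => Continuous.aestronglyMeasurable (by fun_prop))
    (fun n => ae_of_all _ (hFn n)) (ae_of_all _ fun _ => summable_geometric_of_lt_one h0 h1)
    (integrable_const _) (ae_of_all _ fun ω => ?_)
  · have hval : ∀ n, ∫ ω, F n ω ∂circ =
        if n = k.natAbs then (if k = 0 then 0 else (Real.pi / k.natAbs * ρ ^ k.natAbs : ℂ)) else 0 := by
      intro n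
      rcases Nat.eq_zero_or_pos n with rfl | hn
      -- The summand with `n = 0` vanishes because division by zero gives `0`, in accordance with
      -- the logarithm series having no constant term.
      · simp only [hF, Nat.cast_zero, div_zero, zero_mul, mul_zero, integral_zero]
        split_ifs <;> first | rfl | omega
      · have e : ∀ ω, F n ω = (ρ ^ n / n : ℂ) *
            (Complex.exp (k * ω * Complex.I) * Complex.cos (n * ω)) := fun ω => by
          simp only [hF]; ring
        simp_rw [e]
        rw [integral_const_mul, integral_circ_exp_mul_cos k hn.ne']
        split_ifs with h h'
        · omega
        · rw [← h]; ring
        · rw [mul_zero]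
    simp_rw [hval] at hsum
    have := hsum.unique (hasSum_ite_eq k.natAbs _)
    rw [integral_neg] at this
    rw [← neg_eq_iff_eq_neg.2 this.symm]
    split_ifs <;> simp
  · have hz : ‖(ρ * Complex.exp (ω * Complex.I) : ℂ)‖ < 1 := by
      rw [norm_mul, Complex.norm_exp_ofReal_mul_I, Complex.norm_real, Real.norm_of_nonneg h0, mul_one]
      exact h1
    have h := (Complex.hasSum_re (Complex.hasSum_taylorSeries_neg_log hz))
    rw [Complex.neg_re, Complex.log_re] at h
    have h' := (Complex.hasSum_ofReal.2 h).mul_left (Complex.exp (k * ω * Complex.I))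
    rw [Complex.ofReal_neg, mul_neg] at h'
    refine h'.congr_fun fun n => ?_
    simp only [hF]
    congr 1
    have e1 : ((ρ * Complex.exp (ω * Complex.I)) ^ n / n : ℂ) =
        ((ρ ^ n / n : ℝ) : ℂ) * Complex.exp ((n * ω : ℝ) * Complex.I) := by
      rw [mul_pow, ← Complex.exp_nat_mul]
      push_cast
      ring_nf
    rw [e1, Complex.re_ofReal_mul, Complex.exp_ofReal_mul_I_re]
    push_cast
    ring

lemma wexp_sub (p q : ℝ × ℝ) : wexp p - wexp q = wexp p * (1 - wexp (q - p)) := by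
  have : wexp q = wexp p * wexp (q - p) := by
    rw [wexp, wexp, wexp, ← Complex.exp_add]
    congr 1
    simp only [Prod.fst_sub, Prod.snd_sub, Complex.ofReal_sub]
    ring
  rw [mul_sub, mul_one, ← this]

lemma wexp_eq_mul (p : ℝ × ℝ) : wexp p = (Real.exp p.1 : ℂ) * Complex.exp (p.2 * Complex.I) := by
  rw [wexp, Complex.exp_add, Complex.ofReal_exp]

lemma norm_one_sub_conj (ρ ω : ℝ) : ‖1 - ρ * Complex.exp ((-ω : ℝ) * Complex.I)‖ =
    ‖1 - ρ * Complex.exp (ω * Complex.I)‖ := by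
  rw [← Complex.norm_conj]
  congr 1
  simp [← Complex.exp_conj]

/-- Factor out whichever of the two points has the larger modulus; the remaining ratio has modulus
`e^{-|t - q.1|} < 1`, so the power series of the logarithm applies. -/
lemma log_norm_wexp_sub {t ω : ℝ} {q : ℝ × ℝ} (h : t ≠ q.1) :
    Real.log ‖wexp (t, ω) - wexp q‖ = max t q.1 +
      Real.log ‖1 - (Real.exp (-|t - q.1|) : ℝ) * Complex.exp ((ω + -q.2 : ℝ) * Complex.I)‖ := by
  have hne : ∀ s x : ℝ, s < 0 → ‖1 - wexp (s, x)‖ ≠ 0 := fun s x hs => by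
    rw [norm_ne_zero_iff, sub_ne_zero]
    intro h1
    have := norm_wexp (s, x)
    rw [← h1, norm_one] at this
    exact (Real.exp_lt_one_iff.2 hs).ne' this
  have e1 : (t, ω) - q = (t - q.1, ω + -q.2) := by ext <;> simp [sub_eq_add_neg]
  have e2 : q - (t, ω) = (q.1 - t, -(ω + -q.2)) := by
    ext <;> simp [sub_eq_add_neg]
  rcases lt_or_gt_of_ne h with h | h
  · rw [norm_sub_rev, wexp_sub, norm_mul, norm_wexp, max_eq_right h.le, abs_of_neg (by linarith),
      neg_neg, e1, Real.log_mul (Real.exp_pos _).ne' (hne _ _ (by simpa using h)), Real.log_exp,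
      wexp_eq_mul]
  · rw [wexp_sub, norm_mul, norm_wexp, max_eq_left h.le, abs_of_pos (by linarith),
      neg_sub, e2, Real.log_mul (Real.exp_pos _).ne' (hne _ _ (by simpa using h)), Real.log_exp,
      wexp_eq_mul, norm_one_sub_conj]

/-- The angular Fourier coefficient of `log |e^{t+iω} - e^{τ+iβ}|`. -/
def angCoef (k : ℤ) (q : ℝ × ℝ) (t : ℝ) : ℂ :=
  if k = 0 then 2 * Real.pi * (max t q.1 : ℝ) else
    -(Real.pi / k.natAbs * (Real.exp (-(k.natAbs * |t - q.1|)) : ℝ) *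
      Complex.exp (k * q.2 * Complex.I))

lemma continuous_log_norm_wexp_sub {t : ℝ} {q : ℝ × ℝ} (h : t ≠ q.1) :
    Continuous fun ω : ℝ => Real.log ‖wexp (t, ω) - wexp q‖ := by
  have h1 := continuous_wexp
  refine Continuous.log (by fun_prop) fun ω h0 => h ?_
  rw [norm_eq_zero, sub_eq_zero] at h0
  have := congrArg norm h0
  rwa [norm_wexp, norm_wexp, Real.exp_eq_exp] at this

lemma integrable_exp_mul_log_norm_wexp_sub (k : ℤ) {q : ℝ × ℝ} {t : ℝ} (h : t ≠ q.1) :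
    Integrable (fun ω : ℝ => Complex.exp (k * ω * Complex.I) *
      (Real.log ‖wexp (t, ω) - wexp q‖ : ℝ)) circ := by
  have h1 := continuous_log_norm_wexp_sub h
  exact Continuous.integrableOn_Ioc (by fun_prop)

lemma integral_exp_mul_log_norm_wexp_sub (k : ℤ) {q : ℝ × ℝ} {t : ℝ} (h : t ≠ q.1) :
    ∫ ω : ℝ, Complex.exp (k * ω * Complex.I) * (Real.log ‖wexp (t, ω) - wexp q‖ : ℝ) ∂circ =
      angCoef k q t := by
  set ρ : ℝ := Real.exp (-|t - q.1|) with hρ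
  have hρ1 : ρ < 1 :=
    Real.exp_lt_one_iff.2 (by simpa using sub_ne_zero.2 h)
  set f : ℝ → ℂ := fun ω => Complex.exp (k * ω * Complex.I) *
      (Real.log ‖1 - ρ * Complex.exp (ω * Complex.I)‖ : ℝ) with hf
  have hper : Function.Periodic f (2 * Real.pi) := fun ω => by
    have e1 : (k * (ω + 2 * Real.pi : ℝ) * Complex.I : ℂ) =
        k * ω * Complex.I + k * (2 * Real.pi * Complex.I) := by push_cast; ring
    have e2 : ((ω + 2 * Real.pi : ℝ) * Complex.I : ℂ) = ω * Complex.I + 2 * Real.pi * Complex.I := by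
      push_cast; ring
    simp only [hf]
    rw [e1, e2, Complex.exp_periodic, Complex.exp_add, Complex.exp_int_mul_two_pi_mul_I, mul_one]
  have key : ∀ ω : ℝ, Complex.exp (k * ω * Complex.I) * (Real.log ‖wexp (t, ω) - wexp q‖ : ℝ) =
      (max t q.1 : ℝ) * Complex.exp (k * ω * Complex.I) +
        Complex.exp (k * q.2 * Complex.I) * f (ω + -q.2) := fun ω => by
    have e1 : (k * ω * Complex.I : ℂ) = k * q.2 * Complex.I + k * (ω + -q.2 : ℝ) * Complex.I := by
      push_cast; ring
    rw [log_norm_wexp_sub h, ← hρ]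
    simp only [hf]
    rw [← mul_assoc, ← Complex.exp_add, ← e1]
    rw [Complex.ofReal_add]
    ring
  have i1 : Integrable (fun ω : ℝ => (max t q.1 : ℝ) * Complex.exp (k * ω * Complex.I)) circ :=
    Continuous.integrableOn_Ioc (by fun_prop)
  have i2 : Integrable (fun ω : ℝ => Complex.exp (k * q.2 * Complex.I) * f (ω + -q.2)) circ :=
    ((integrable_exp_mul_log_norm_wexp_sub k h).sub i1).congr
      (ae_of_all _ fun ω => by simp only [Pi.sub_apply]; rw [key]; ring)
  simp_rw [key]
  rw [integral_add i1 i2, integral_const_mul, integral_const_mul, integral_circ_comp_add hper,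
    integral_exp_mul_log_norm_one_sub k (Real.exp_pos _).le hρ1, integral_circ_exp, angCoef]
  split_ifs with hk
  · push_cast; ring
  · rw [← Complex.ofReal_pow, ← Real.exp_nat_mul, mul_neg, Complex.ofReal_zero]
    ring_nf

/-! ### Laplace transforms in the radial variable -/

lemma integrable_exp_mul_exp_neg_abs {c : ℂ} {a : ℝ} (h : |c.re| < a) :
    Integrable fun t : ℝ => Complex.exp (c * t) * (Real.exp (-(a * |t|)) : ℝ) := by
  refine (integrable_exp_neg_mul_abs (c := a - |c.re|) (by linarith)).mono'
    (Continuous.aestronglyMeasurable (by fun_prop)) (ae_of_all _ fun t => ?_)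
  rw [norm_mul, Complex.norm_exp, Complex.norm_real, Real.norm_of_nonneg (Real.exp_pos _).le,
    ← Real.exp_add, Real.exp_le_exp, Complex.re_mul_ofReal]
  have h1 := le_abs_self (c.re * t)
  rw [abs_mul] at h1
  linarith

lemma integral_exp_mul_exp_neg_abs {c : ℂ} {a : ℝ} (h : |c.re| < a) :
    ∫ t : ℝ, Complex.exp (c * t) * (Real.exp (-(a * |t|)) : ℝ) = 2 * a / (a ^ 2 - c ^ 2) := by
  obtain ⟨h1, h2⟩ := abs_lt.1 h
  have n1 : c - a ≠ 0 := fun h0 => by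
    have := congrArg Complex.re h0
    simp at this; linarith
  have n2 : c + a ≠ 0 := fun h0 => by
    have := congrArg Complex.re h0
    simp at this; linarith
  have n3 : (a : ℂ) ^ 2 - c ^ 2 ≠ 0 := by
    have : (a : ℂ) ^ 2 - c ^ 2 = -(c - a) * (c + a) := by ring
    rw [this]; exact mul_ne_zero (neg_ne_zero.2 n1) n2
  have hi := integrable_exp_mul_exp_neg_abs h
  have e1 : ∀ t ∈ Iic (0 : ℝ), Complex.exp (c * t) * (Real.exp (-(a * |t|)) : ℝ) =
      Complex.exp ((c + a) * t) := fun t ht => by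
    rw [abs_of_nonpos ht, Complex.ofReal_exp, ← Complex.exp_add]
    push_cast; ring_nf
  have e2 : ∀ t ∈ Ioi (0 : ℝ), Complex.exp (c * t) * (Real.exp (-(a * |t|)) : ℝ) =
      Complex.exp ((c - a) * t) := fun t ht => by
    rw [abs_of_pos ht, Complex.ofReal_exp, ← Complex.exp_add]
    push_cast; ring_nf
  rw [← intervalIntegral.integral_Iic_add_Ioi hi.integrableOn hi.integrableOn (b := 0),
    setIntegral_congr_fun measurableSet_Iic e1, setIntegral_congr_fun measurableSet_Ioi e2,
    integral_exp_mul_complex_Iic (by simpa using by linarith),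
    integral_exp_mul_complex_Ioi (by simpa using by linarith)]
  simp only [Complex.ofReal_zero, mul_zero, Complex.exp_zero]
  rw [eq_div_iff n3]
  field_simp
  ring

lemma integral_exp_mul_exp_neg_abs_sub {c : ℂ} {a : ℝ} (h : |c.re| < a) (τ : ℝ) :
    ∫ t : ℝ, Complex.exp (c * t) * (Real.exp (-(a * |t - τ|)) : ℝ) =
      Complex.exp (c * τ) * (2 * a / (a ^ 2 - c ^ 2)) := by
  rw [← integral_exp_mul_exp_neg_abs h, ← integral_const_mul,
    ← integral_sub_right_eq_self (fun t : ℝ => Complex.exp (c * τ) *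
      (Complex.exp (c * t) * (Real.exp (-(a * |t|)) : ℝ))) τ]
  refine integral_congr_ae (ae_of_all _ fun t => ?_)
  beta_reduce
  rw [← mul_assoc, ← Complex.exp_add]
  push_cast; ring_nf

lemma integrable_exp_mul_exp_neg_abs_sub {c : ℂ} {a : ℝ} (h : |c.re| < a) (τ : ℝ) :
    Integrable fun t : ℝ => Complex.exp (c * t) * (Real.exp (-(a * |t - τ|)) : ℝ) := by
  refine (((integrable_exp_mul_exp_neg_abs h).const_mul (Complex.exp (c * τ))).comp_sub_right τ).congr
    (ae_of_all _ fun t => ?_)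
  beta_reduce
  rw [← mul_assoc, ← Complex.exp_add]
  push_cast; ring_nf

/-- The tent function of half-width `|τ|`. -/
def tent (τ t : ℝ) : ℝ := max (|τ| - |t|) 0

/-- In the zero mode the separate terms grow with `t`. The growing part `t + |t|` does not depend on
`τ`, so it cancels between `w₁` and `u`, leaving functions of compact support. -/
lemma max_add_max_neg (t τ : ℝ) : max t τ + max t (-τ) = t + |t| + tent τ t := by
  unfold tent
  rcases abs_cases t with ⟨h, _⟩ | ⟨h, _⟩ <;> rcases abs_cases τ with ⟨h', _⟩ | ⟨h', _⟩ <;>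
    rcases max_cases t τ with ⟨h1, _⟩ | ⟨h1, _⟩ <;> rcases max_cases t (-τ) with ⟨h2, _⟩ | ⟨h2, _⟩ <;>
    rcases max_cases (|τ| - |t|) 0 with ⟨h3, _⟩ | ⟨h3, _⟩ <;> linarith

lemma tent_eq_zero {τ t : ℝ} (h : t ∉ Ioc (-|τ|) |τ|) : tent τ t = 0 := by
  refine max_eq_right (sub_nonpos.2 ?_)
  rw [mem_Ioc, not_and_or, not_lt, not_le] at h
  rcases h with h | h
  · linarith [neg_abs_le t]
  · linarith [le_abs_self t]

lemma continuous_exp_mul_tent (c : ℂ) (τ : ℝ) :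
    Continuous fun t : ℝ => Complex.exp (c * t) * (tent τ t : ℝ) := by
  unfold tent; fun_prop

lemma integrable_exp_mul_tent (c : ℂ) (τ : ℝ) :
    Integrable fun t : ℝ => Complex.exp (c * t) * (tent τ t : ℝ) :=
  (integrableOn_iff_integrable_of_support_subset (s := Ioc (-|τ|) |τ|) fun t ht => by
    by_contra h
    exact ht (by simp [tent_eq_zero h])).1 (continuous_exp_mul_tent c τ).integrableOn_Ioc

lemma integral_exp_mul_tent {c : ℂ} (hc : c ≠ 0) (τ : ℝ) :
    ∫ t : ℝ, Complex.exp (c * t) * (tent τ t : ℝ) =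
      (Complex.exp (c * τ) + Complex.exp (-(c * τ)) - 2) / c ^ 2 := by
  have hτ := abs_nonneg τ
  set A : ℝ := |τ| with hA
  -- The values `ε = -1` and `ε = 1` treat the two slopes of the tent together.
  have hder : ∀ ε : ℂ, ε ^ 2 = 1 → ∀ t : ℝ, HasDerivAt
      (fun t : ℝ => ((A - ε * t) / c + ε / c ^ 2) * Complex.exp (c * t))
      (Complex.exp (c * t) * (A - ε * t)) t := fun ε hε t => by
    have h1 : HasDerivAt (fun z : ℂ => ((A - ε * z) / c + ε / c ^ 2) * Complex.exp (c * z)) _ t :=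
      (((((hasDerivAt_id (t : ℂ)).const_mul ε).const_sub (A : ℂ)).div_const c).add_const
        (ε / c ^ 2)).mul ((hasDerivAt_id (t : ℂ)).const_mul c).cexp
    refine h1.comp_ofReal.congr_deriv ?_
    simp only [id, mul_one]
    field_simp
    ring
  have hcont : ∀ ε : ℂ, Continuous fun t : ℝ => Complex.exp (c * t) * (A - ε * t) := fun ε => by
    fun_prop
  have hint : ∀ ε : ℂ, ε ^ 2 = 1 → ∀ a b : ℝ, ∫ t : ℝ in a..b, Complex.exp (c * t) * (A - ε * t) =
      ((A - ε * b) / c + ε / c ^ 2) * Complex.exp (c * b) -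
        ((A - ε * a) / c + ε / c ^ 2) * Complex.exp (c * a) := fun ε hε a b =>
    intervalIntegral.integral_eq_sub_of_hasDerivAt (fun t _ => hder ε hε t)
      ((hcont ε).intervalIntegrable _ _)
  have hci := fun a b => (continuous_exp_mul_tent c τ).intervalIntegrable (μ := volume) a b
  have l1 : ∫ t : ℝ in (-A)..0, Complex.exp (c * t) * (tent τ t : ℝ) =
      ∫ t : ℝ in (-A)..0, Complex.exp (c * t) * (A - (-1) * t) := by
    refine intervalIntegral.integral_congr fun t ht => ?_
    rw [uIcc_of_le (by linarith)] at ht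
    simp only [tent, ← hA]
    rw [abs_of_nonpos ht.2, max_eq_left (by linarith [ht.1])]
    push_cast; ring
  have l2 : ∫ t : ℝ in (0 : ℝ)..A, Complex.exp (c * t) * (tent τ t : ℝ) =
      ∫ t : ℝ in (0 : ℝ)..A, Complex.exp (c * t) * (A - 1 * t) := by
    refine intervalIntegral.integral_congr fun t ht => ?_
    rw [uIcc_of_le (by linarith)] at ht
    simp only [tent, ← hA]
    rw [abs_of_nonneg ht.1, max_eq_left (by linarith [ht.2])]
    push_cast; ring
  have hsym : Complex.exp (c * A) + Complex.exp (-(c * A)) =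
      Complex.exp (c * τ) + Complex.exp (-(c * τ)) := by
    rcases abs_choice τ with h | h <;> rw [hA, h]
    push_cast
    rw [mul_neg, neg_neg, add_comm]
  rw [← setIntegral_eq_integral_of_forall_compl_eq_zero (s := Ioc (-A) A)
    (fun t ht => by simp [tent_eq_zero ht]), ← intervalIntegral.integral_of_le (by linarith),
    ← intervalIntegral.integral_add_adjacent_intervals (hci _ 0) (hci 0 _), l1, l2,
    hint _ (by norm_num), hint _ (by norm_num), ← hsym]
  push_cast
  simp only [mul_zero, Complex.exp_zero, mul_neg]
  field_simp
  ring

lemma chi_eq_mul (μ : ℂ) (d : ℤ) (t ω : ℝ) : chi μ d (t, ω) =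
    Complex.exp (2 * μ * t) * Complex.exp ((2 * d : ℤ) * ω * Complex.I) := by
  rw [chi, ← Complex.exp_add]
  push_cast
  rfl

/-- The angular integral of `chi * logComb`. -/
def radial (d : ℤ) (q₁ q₂ : ℝ × ℝ) (t : ℝ) : ℂ :=
  angCoef (2 * d) q₁ t - angCoef (2 * d) q₂ t - angCoef (2 * d) (-q₂) t + angCoef (2 * d) (-q₁) t

lemma ae_integral_chi_mul_logComb (μ : ℂ) (d : ℤ) (q₁ q₂ : ℝ × ℝ) :
    ∀ᵐ t : ℝ, ∫ ω, chi μ d (t, ω) * (logComb q₁ q₂ (t, ω) : ℝ) ∂circ =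
      Complex.exp (2 * μ * t) * radial d q₁ q₂ t := by
  filter_upwards [Measure.ae_ne volume q₁.1, Measure.ae_ne volume (-q₁).1,
    Measure.ae_ne volume q₂.1, Measure.ae_ne volume (-q₂).1] with t h1 h1' h2 h2'
  have i := fun {q : ℝ × ℝ} (h : t ≠ q.1) => integrable_exp_mul_log_norm_wexp_sub (2 * d) h
  rw [radial, ← integral_exp_mul_log_norm_wexp_sub _ h1, ← integral_exp_mul_log_norm_wexp_sub _ h1',
    ← integral_exp_mul_log_norm_wexp_sub _ h2, ← integral_exp_mul_log_norm_wexp_sub _ h2',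
    ← integral_sub_sub_add (i h1) (i h2) (i h2') (i h1'), ← integral_const_mul]
  refine integral_congr_ae (ae_of_all _ fun ω => ?_)
  beta_reduce
  rw [chi_eq_mul, logComb]
  push_cast
  ring

/-- Within `|Re μ| < 1/2` the only integer is `0`, so `μ = ±d` forces both to vanish. -/
lemma sq_sub_sq_ne_zero {μ : ℂ} (hμ : |μ.re| < 1 / 2) {d : ℤ} (h : d ≠ 0 ∨ μ ≠ 0) :
    (d : ℂ) ^ 2 - μ ^ 2 ≠ 0 := by
  intro h0
  have h1 : ((d : ℂ) - μ) * (d + μ) = 0 := by linear_combination h0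
  have key : ∀ m : ℤ, μ = m → m = 0 := fun m hm => by
    rw [hm, Complex.intCast_re] at hμ
    have : |m| < 1 := by
      have : (|m| : ℝ) < 1 := by linarith
      exact_mod_cast this
    exact Int.abs_lt_one_iff.1 this
  have hd : d = 0 := by
    rcases mul_eq_zero.1 h1 with h2 | h2
    · exact key d (sub_eq_zero.1 h2).symm
    · have := key (-d) (by push_cast; linear_combination h2)
      omega
  rcases h with h | h
  · exact h hd
  · rw [hd] at h0
    simp at h0
    exact h h0

/-- With `a = 2|d|` the two-sided exponential transforms to `2a / (4(d² - μ²))`, and the phase of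
the coefficient together with the shift by `q.1` assembles the character at `q`. -/
lemma integral_exp_mul_angCoef {μ : ℂ} (hμ : |μ.re| < 1 / 2) {d : ℤ} (hd : d ≠ 0) (q : ℝ × ℝ) :
    Integrable (fun t : ℝ => Complex.exp (2 * μ * t) * angCoef (2 * d) q t) ∧
    ∫ t : ℝ, Complex.exp (2 * μ * t) * angCoef (2 * d) q t =
      -(Real.pi / (2 * (d ^ 2 - μ ^ 2))) * chi μ d q := by
  set a : ℝ := ((2 * d).natAbs : ℝ) with ha
  have ha1 : (a : ℂ) ≠ 0 := by
    rw [ha]; simpa using hd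
  have hasq : (a : ℂ) ^ 2 = 4 * d ^ 2 := by
    have h1 : ((2 * d).natAbs : ℤ) ^ 2 = 4 * d ^ 2 := by rw [Int.natAbs_sq]; ring
    have h2 := congrArg (Int.cast : ℤ → ℂ) h1
    rw [Int.cast_pow, Int.cast_natCast] at h2
    rw [ha, Complex.ofReal_natCast, h2]
    push_cast; ring
  have hre : |(2 * μ).re| < a := by
    have h2 : 1 ≤ (2 * d).natAbs := by omega
    have h3 : (1 : ℝ) ≤ a := by rw [ha]; exact_mod_cast h2
    have h4 : (2 * μ).re = 2 * μ.re := by simp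
    rw [h4, abs_mul, abs_two]
    linarith
  have e : ∀ t : ℝ, Complex.exp (2 * μ * t) * angCoef (2 * d) q t =
      -(Real.pi / a * Complex.exp ((2 * d : ℤ) * q.2 * Complex.I)) *
        (Complex.exp (2 * μ * t) * (Real.exp (-(a * |t - q.1|)) : ℝ)) := fun t => by
    rw [angCoef, if_neg (by omega)]
    simp only [ha, Complex.ofReal_natCast]
    ring
  simp_rw [e]
  refine ⟨(integrable_exp_mul_exp_neg_abs_sub hre q.1).const_mul _, ?_⟩
  have hne := sq_sub_sq_ne_zero hμ (Or.inl hd)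
  have e4 : (a : ℂ) ^ 2 - (2 * μ) ^ 2 = 4 * (d ^ 2 - μ ^ 2) := by rw [hasq]; ring
  rw [integral_const_mul, integral_exp_mul_exp_neg_abs_sub hre, e4, ← Prod.mk.eta (p := q),
    chi_eq_mul]
  field_simp
  ring

lemma radial_zero (q₁ q₂ : ℝ × ℝ) (t : ℝ) :
    radial 0 q₁ q₂ t = 2 * Real.pi * ((tent q₁.1 t : ℝ) - (tent q₂.1 t : ℝ)) := by
  have h1 := congrArg (fun x : ℝ => (x : ℂ)) (max_add_max_neg t q₁.1)
  have h2 := congrArg (fun x : ℝ => (x : ℂ)) (max_add_max_neg t q₂.1)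
  simp only [Complex.ofReal_add] at h1 h2
  simp only [radial, angCoef, mul_zero, if_true, Prod.fst_neg]
  linear_combination 2 * Real.pi * h1 - 2 * Real.pi * h2

lemma chi_zero (μ : ℂ) (q : ℝ × ℝ) : chi μ 0 q = Complex.exp (2 * μ * q.1) := by
  simp [chi]

/-- For `d ≠ 0` the four coefficients are integrated separately. For `d = 0` only the difference of
tents is integrable; its transform has the same shape, the constants `-2` cancelling. -/
lemma integral_exp_mul_radial {μ : ℂ} (hμ : |μ.re| < 1 / 2) {d : ℤ} (h : d ≠ 0 ∨ μ ≠ 0)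
    (q₁ q₂ : ℝ × ℝ) :
    ∫ t : ℝ, Complex.exp (2 * μ * t) * radial d q₁ q₂ t = -(Real.pi / (2 * (d ^ 2 - μ ^ 2))) *
      (chi μ d q₁ - chi μ d q₂ - chi μ d (-q₂) + chi μ d (-q₁)) := by
  rcases eq_or_ne d 0 with rfl | hd
  · have hμ0 : μ ≠ 0 := by simpa using h
    have e : ∀ t : ℝ, Complex.exp (2 * μ * t) * radial 0 q₁ q₂ t = 2 * Real.pi *
        (Complex.exp (2 * μ * t) * (tent q₁.1 t : ℝ) - Complex.exp (2 * μ * t) * (tent q₂.1 t : ℝ)) :=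
      fun t => by rw [radial_zero]; ring
    simp_rw [e]
    rw [integral_const_mul, integral_sub (integrable_exp_mul_tent _ _) (integrable_exp_mul_tent _ _),
      integral_exp_mul_tent (by simpa using hμ0), integral_exp_mul_tent (by simpa using hμ0)]
    simp only [chi_zero, Prod.fst_neg, Complex.ofReal_neg, mul_neg, Int.cast_zero]
    field_simp
    ring
  · have i := fun q => integral_exp_mul_angCoef hμ hd q
    have e : ∀ t : ℝ, Complex.exp (2 * μ * t) * radial d q₁ q₂ t =
        Complex.exp (2 * μ * t) * angCoef (2 * d) q₁ t - Complex.exp (2 * μ * t) * angCoef (2 * d) q₂ t -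
        Complex.exp (2 * μ * t) * angCoef (2 * d) (-q₂) t +
        Complex.exp (2 * μ * t) * angCoef (2 * d) (-q₁) t := fun t => by
      rw [radial]; ring
    simp_rw [e]
    rw [integral_sub_sub_add (i q₁).1 (i q₂).1 (i (-q₂)).1 (i (-q₁)).1, (i q₁).2, (i q₂).2,
      (i (-q₂)).2, (i (-q₁)).2]
    ring

/-! ### Evaluation of the Fourier integral -/

lemma measurable_logComb (q₁ q₂ : ℝ × ℝ) : Measurable (logComb q₁ q₂) := by
  have := continuous_wexp.measurable
  unfold logComb
  fun_prop

/-- No new estimate is needed: the combination is, up to a factor, the `φ`-average of the limit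
integrand, whose weighted integrability is already known. -/
lemma integrable_weight_logComb {q₁ q₂ : ℝ × ℝ} (hq : wexp q₁ + (wexp q₁)⁻¹ = wexp q₂) {σ : ℝ}
    (h0 : 0 ≤ σ) (h1 : σ < 1 / 2) :
    Integrable (fun p => Real.exp (2 * σ * |p.1|) * |logComb q₁ q₂ p|) ann := by
  obtain ⟨κ, hκ⟩ := exists_isJump
  have hi := (integrable_weight_limInt hκ (wexp_ne_zero q₂) (wexp_ne_zero q₁) hq h0 h1).integral_prod_left
  have hm : AEStronglyMeasurable (fun p => Real.exp (2 * σ * |p.1|) * |logComb q₁ q₂ p|) ann := by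
    have := measurable_logComb q₁ q₂
    exact Measurable.aestronglyMeasurable (by fun_prop)
  refine (hi.const_mul (2 * Real.pi)⁻¹).mono' hm ?_
  filter_upwards [ae_integral_limInt κ hq] with p hp
  have h2 : ‖((-(2 * Real.pi) * logComb q₁ q₂ p : ℝ) : ℂ)‖ = 2 * Real.pi * |logComb q₁ q₂ p| := by
    rw [Complex.norm_real, norm_mul, norm_neg, Real.norm_of_nonneg (by positivity), Real.norm_eq_abs]
  have h3 : 2 * Real.pi * |logComb q₁ q₂ p| ≤ ∫ φ, ‖limInt κ (wexp q₂) φ p‖ ∂circ := by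
    rw [← h2, ← hp]
    exact norm_integral_le_integral_norm _
  rw [Real.norm_of_nonneg (by positivity), integral_const_mul, mul_left_comm]
  refine mul_le_mul_of_nonneg_left ?_ (Real.exp_pos _).le
  rwa [inv_mul_eq_div, le_div_iff₀ (by positivity), mul_comm]

lemma fourierValue_eq_integral_logComb (μ : ℂ) (d : ℤ) (κ : ℝ) {q₁ q₂ : ℝ × ℝ}
    (hq : wexp q₁ + (wexp q₁)⁻¹ = wexp q₂) :
    fourierValue μ d κ (wexp q₂) =
      -(2 / Real.pi) * ∫ p, chi μ d p * (logComb q₁ q₂ p : ℝ) ∂ann := by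
  have e : ∫ p, chi μ d p * ∫ φ, limInt κ (wexp q₂) φ p ∂circ ∂ann =
      ∫ p, -(2 * Real.pi) * (chi μ d p * (logComb q₁ q₂ p : ℝ)) ∂ann := by
    refine integral_congr_ae ?_
    filter_upwards [ae_integral_limInt κ hq] with p hp
    rw [hp]
    push_cast
    ring
  have hπ : (Real.pi : ℂ) ≠ 0 := by exact_mod_cast Real.pi_ne_zero
  rw [fourierValue, e, integral_const_mul]
  field_simp

lemma integrable_chi_mul_logComb {q₁ q₂ : ℝ × ℝ} (hq : wexp q₁ + (wexp q₁)⁻¹ = wexp q₂) {μ : ℂ}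
    (hμ : |μ.re| < 1 / 2) (d : ℤ) :
    Integrable (fun p => chi μ d p * (logComb q₁ q₂ p : ℝ)) ann := by
  refine (integrable_weight_logComb hq (abs_nonneg μ.re) hμ).mono' ?_ (ae_of_all _ fun p => ?_)
  · have := (continuous_chi μ d).measurable
    have := measurable_logComb q₁ q₂
    exact Measurable.aestronglyMeasurable (by fun_prop)
  · rw [norm_mul, Complex.norm_real, Real.norm_eq_abs]
    gcongr
    exact norm_chi_le μ d p

/-- The evaluation of the Fourier integral. -/
lemma fourierValue_eq {q₁ q₂ : ℝ × ℝ} (hq : wexp q₁ + (wexp q₁)⁻¹ = wexp q₂) {μ : ℂ}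
    (hμ : |μ.re| < 1 / 2) {d : ℤ} (h : d ≠ 0 ∨ μ ≠ 0) (κ : ℝ) :
    fourierValue μ d κ (wexp q₂) = 1 / (d ^ 2 - μ ^ 2) *
      ((chi μ d q₁ - chi μ d q₂) + (chi μ d (-q₁) - chi μ d (-q₂))) := by
  have hπ : (Real.pi : ℂ) ≠ 0 := by exact_mod_cast Real.pi_ne_zero
  have hne := sq_sub_sq_ne_zero hμ h
  rw [fourierValue_eq_integral_logComb μ d κ hq, integral_prod _ (integrable_chi_mul_logComb hq hμ d),
    integral_congr_ae (ae_integral_chi_mul_logComb μ d q₁ q₂), integral_exp_mul_radial hμ h]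
  field_simp
  ring

/-- For `|Re s| ≤ 1/4` the characters are dominated by the weight with `σ = 1/4`, still below the
critical `1/2`. -/
lemma tendsto_fourierValue {q₁ q₂ : ℝ × ℝ} (hq : wexp q₁ + (wexp q₁)⁻¹ = wexp q₂) (κ : ℝ) :
    Tendsto (fun s => fourierValue s 0 κ (wexp q₂)) (𝓝 0) (𝓝 (fourierValue 0 0 κ (wexp q₂))) := by
  simp_rw [fourierValue_eq_integral_logComb _ _ κ hq]
  refine Tendsto.const_mul _ ?_
  refine tendsto_integral_filter_of_dominated_convergence
    (fun p => Real.exp (2 * (1 / 4) * |p.1|) * |logComb q₁ q₂ p|) (Eventually.of_forall fun s => ?_) ?_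
    (integrable_weight_logComb hq (by norm_num) (by norm_num)) (ae_of_all _ fun p => ?_)
  · have := (continuous_chi s 0).measurable
    have := measurable_logComb q₁ q₂
    exact Measurable.aestronglyMeasurable (by fun_prop)
  · filter_upwards [Metric.ball_mem_nhds (0 : ℂ) (by norm_num : (0 : ℝ) < 1 / 4)] with s hs
    refine ae_of_all _ fun p => ?_
    have h1 : |s.re| ≤ 1 / 4 := by
      rw [mem_ball_zero_iff] at hs
      exact (Complex.abs_re_le_norm s).trans hs.le
    rw [norm_mul, Complex.norm_real, Real.norm_eq_abs]
    refine mul_le_mul_of_nonneg_right ((norm_chi_le s 0 p).trans ?_) (abs_nonneg _)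
    gcongr
  · have : Continuous fun s => chi s 0 p := by unfold chi; fun_prop
    exact (this.tendsto 0).mul_const _

/-! ### Passage to the closed form -/

/-- The logarithmic coordinates of a nonzero complex number. -/
def logCoord (z : ℂ) : ℝ × ℝ := (Real.log ‖z‖, z.arg)

lemma wexp_logCoord {z : ℂ} (hz : z ≠ 0) : wexp (logCoord z) = z := by
  rw [wexp_eq_mul, logCoord, Real.exp_log (norm_pos_iff.2 hz), Complex.norm_mul_exp_arg_mul_I]

lemma chi_neg (μ : ℂ) (d : ℤ) (p : ℝ × ℝ) : chi μ d (-p) = 1 / chi μ d p := by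
  rw [chi, chi, one_div, ← Complex.exp_neg]
  congr 1
  simp only [Prod.fst_neg, Prod.snd_neg, Complex.ofReal_neg]
  ring

lemma ofReal_cpow_two_mul {x : ℝ} (hx : 0 < x) (μ : ℂ) :
    (x : ℂ) ^ (2 * μ) = Complex.exp (2 * μ * Real.log x) := by
  rw [Complex.cpow_def_of_ne_zero (by exact_mod_cast hx.ne'), ← Complex.ofReal_log hx.le, mul_comm]

lemma closedForm_eq (μ : ℂ) (d : ℤ) {y : ℝ} (hy : 0 < y) (θ : ℝ) {r : ℂ}
    (hr : (y : ℂ) * Complex.exp (θ * Complex.I) + r ≠ 0) :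
    closedForm μ d y θ r = 1 / ((d : ℂ) ^ 2 - μ ^ 2) *
      ((chi μ d (logCoord ((y * Complex.exp (θ * Complex.I) + r) / 2)) - chi μ d (Real.log y, θ)) +
      (chi μ d (-logCoord ((y * Complex.exp (θ * Complex.I) + r) / 2)) -
        chi μ d (-(Real.log y, θ)))) := by
  set z : ℂ := y * Complex.exp (θ * Complex.I) with hz
  have hn := norm_pos_iff.2 hr
  have hnorm : ‖(z + r) / 2‖ = ‖z + r‖ / 2 := by rw [norm_div, Complex.norm_two]
  have hE : E z r = Complex.exp (((z + r) / 2).arg * Complex.I) := by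
    have h1 := Complex.norm_mul_exp_arg_mul_I ((z + r) / 2)
    have h2 : (‖z + r‖ : ℂ) ≠ 0 := by exact_mod_cast hn.ne'
    rw [hnorm] at h1
    rw [E, div_eq_iff h2]
    push_cast at h1
    linear_combination -2 * h1
  have hA : (Y z r : ℂ) ^ (2 * μ) * E z r ^ (2 * d) = chi μ d (logCoord ((z + r) / 2)) := by
    rw [logCoord, chi_eq_mul, hnorm, hE, Y, ofReal_cpow_two_mul (by positivity), ← Complex.exp_int_mul]
    congr 2; ring
  have hB : (y : ℂ) ^ (2 * μ) * Complex.exp (2 * Complex.I * d * θ) = chi μ d (Real.log y, θ) := by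
    rw [chi_eq_mul, ofReal_cpow_two_mul hy]
    congr 2; push_cast; ring
  simp only [closedForm, ← hz, hA, hB, chi_neg]

/-- The improper Fourier integral converges to its closed form in both senses. -/
theorem exists_fourierValue (μ : ℂ) (d : ℤ) (hμ : |μ.re| < 1 / 2) (y θ : ℝ) (hy : 0 < y)
    (r : ℂ) (hr : r ^ 2 = ((y : ℂ) * Complex.exp (θ * Complex.I)) ^ 2 - 4) :
    ∃ L : ℂ,
      ((d ≠ 0 ∨ μ ≠ 0) → L = closedForm μ d y θ r) ∧
      (d = 0 → μ = 0 →
        Tendsto (fun s : ℂ => closedForm s 0 y θ r) (𝓝[≠] 0) (𝓝 L)) ∧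
      ConvergesAsDoubleIntegral (integrand μ d y θ) L ∧
      ConvergesAsIteratedIntegral (integrand μ d y θ) L := by
  obtain ⟨κ, hκ⟩ := exists_isJump
  set z : ℂ := (y : ℂ) * Complex.exp (θ * Complex.I) with hz
  -- Hence `w₁ = (z + r)/2` is nonzero with inverse `(z - r)/2`, so it solves `w₁ + 1/w₁ = z`. The
  -- other square root exchanges `w₁` and its inverse, under which the formula is symmetric.
  have hprod : (z + r) * (z - r) = 4 := by linear_combination -hr
  have hzr : z + r ≠ 0 := fun h => by
    rw [h, zero_mul] at hprod
    norm_num at hprod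
  have hw : (z + r) / 2 ≠ 0 := div_ne_zero hzr two_ne_zero
  have hinv : ((z + r) / 2)⁻¹ = (z - r) / 2 := by
    refine inv_eq_of_mul_eq_one_right ?_
    linear_combination hprod / 4
  have hsum : (z + r) / 2 + ((z + r) / 2)⁻¹ = z := by rw [hinv]; ring
  set q₁ := logCoord ((z + r) / 2) with hq₁
  have hz2 : wexp (Real.log y, θ) = z := by rw [wexp_eq_mul, Real.exp_log hy]
  have hq : wexp q₁ + (wexp q₁)⁻¹ = wexp (Real.log y, θ) := by rw [wexp_logCoord hw, hsum, hz2]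
  have hval : ∀ (s : ℂ) (m : ℤ), |s.re| < 1 / 2 → (m ≠ 0 ∨ s ≠ 0) →
      fourierValue s m κ z = closedForm s m y θ r := fun s m hs h => by
    rw [closedForm_eq s m hy θ hzr, ← hz2, fourierValue_eq hq hs h]
  refine ⟨fourierValue μ d κ z, hval μ d hμ, ?_, convergesAsDoubleIntegral hμ d hκ hy hw hsum,
    convergesAsIteratedIntegral hμ d hκ hy hw hsum⟩
  rintro rfl rfl
  -- At `μ = d = 0` the value is the limit of the values at nearby `s ≠ 0`, where the closed form is
  -- available.
  have h1 := (tendsto_fourierValue hq κ).mono_left (nhdsWithin_le_nhds (s := {0}ᶜ))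
  rw [hz2] at h1
  refine h1.congr' ?_
  filter_upwards [self_mem_nhdsWithin, nhdsWithin_le_nhds
    (Metric.ball_mem_nhds (0 : ℂ) (by norm_num : (0 : ℝ) < 1 / 2))] with s hs0 hs
  rw [mem_ball_zero_iff] at hs
  exact hval s 0 ((Complex.abs_re_le_norm s).trans_lt hs) (Or.inr hs0)

end

end ComplexBessel

theorem theorem1p2 (μ : ℂ) (d : ℤ) (hμ : |μ.re| < 1 / 2) (y θ : ℝ) (hy : 0 < y)
    (hθ : θ ∈ Set.Ico 0 (2 * Real.pi))
    (r : ℂ) (hr : r ^ 2 = ((y : ℂ) * Complex.exp (θ * Complex.I)) ^ 2 - 4) :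
    ∃ L : ℂ,
      ((d ≠ 0 ∨ μ ≠ 0) → L = ComplexBessel.closedForm μ d y θ r) ∧
      (d = 0 → μ = 0 →
        Tendsto (fun s : ℂ => ComplexBessel.closedForm s 0 y θ r) (𝓝[≠] 0) (𝓝 L)) ∧
      ComplexBessel.ConvergesAsDoubleIntegral (ComplexBessel.integrand μ d y θ) L ∧
      ComplexBessel.ConvergesAsIteratedIntegral (ComplexBessel.integrand μ d y θ) L :=
  ComplexBessel.exists_fourierValue μ d hμ y θ hy r hr
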